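/- Let $\mathcal X=\{1,\dots,K\}$ and let $\mathcal X^*$ be the set of finite words over $\mathcal X$. For a finite set $\mathcal F\subset\mathcal X^*$ of forbidden words, the finite-type constraint defined by $\mathcal F$ is the set $\mathcal S$ of all words in $\mathcal X^*$ containing no element of $\mathcal F$ as a contiguous subword. The length of $\mathcal F$ is the length of its longest word, and the topological order $m$ of $\mathcal S$ is the smallest length of a finite $\mathcal F$ defining $\mathcal S$, minus $1$ (with $m=0$ if $\mathcal S=\mathcal X^*$). $\mathcal S$ is irreducible if for all $u,v\in\mathcal S$ there is $w\in\mathcal S$ with $uwv\in\mathcal S$. A stationary $\mathcal X$-valued process $X=(X_n)_{n\in\mathbb Z}$ is supported on $\mathcal S$ if $\mathcal A(X)\subseteq\mathcal S$, where $\mathcal A(X)$ is the set of words occurring in $X$ with positive probability. For $\varepsilon\in[0,1]$ let $(E_n)_{n\in\mathbb Z}$ be i.i.d. $\{0,1\}$-valued, independent of $X$, with $P(E_n=0)=\varepsilon$, and let $Y_n=X_nE_n$ be the output of the erasure channel. Let $I(X;Y)=\lim_{n\to\infty}\frac1n I(X_0^{n-1};Y_0^{n-1})$ be the mutual information rate and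 $H(X)=\lim_{n\to\infty}\frac1nH(X_0^{n-1})$ the entropy rate. Put $$C(\mathcal S,\varepsilon)=\sup_X I(X;Y),\qquad C^{(n)}(\mathcal S,\varepsilon)=\sup_{X\ n\text{-th order Markov}} I(X;Y),$$ the suprema being over all stationary processes, respectively all stationary $n$-th order Markov chains, supported on $\mathcal S$. Theorem. Let $\mathcal S$ be an irreducible finite-type constraint of topological order $m$ that contains a non-empty word. There is a unique (in law) stationary $m$-th order Markov chain $\hat X$ with $\mathcal A(\hat X)=\mathcal S$ and $H(\hat X)=\max_{\mathcal A(X)\subseteq\mathcal S}H(X)$, the maximum being over all stationary processes supported on $\mathcal S$, and, as $\varepsilon\to0^+$, $$C(\mathcal S,\varepsilon)=C(\mathcal S,0)-\Big\{(m+1)H(\hat X_0\mid\hat X_{-m}^{-1})-\sum_{i=1}^{m}H(\hat X_0\mid\hat X_{-i+1}^{-1},\hat X_{-i-m}^{-i-1})\Big\}\varepsilon+O(\varepsilon^2).$$ Moreover, for every $n\ge m$, $$C^{(n)}(\mathcal S,\varepsilon)=C(\mathcal S,0)-\Big\{(m+1)H(\hat X_0\mid\hat X_{-m}^{-1})-\sum_{i=1}^{m}H(\hat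 X_0\mid\hat X_{-i+1}^{-1},\hat X_{-i-m}^{-i-1})\Big\}\varepsilon+O(\varepsilon^2).$$ -/

import Mathlib

open Filter MeasureTheory ProbabilityTheory
open scoped Topology unitInterval

noncomputable section

namespace ErasureChannel

/-! ### Shannon information of finitely-valued random variables (natural logarithm) -/

section Information

variable {Ω α β : Type*} [MeasurableSpace Ω]

/-- The Shannon entropy `H(A) = -∑ p(a) log p(a)`. -/
def entropy [Fintype α] (μ : Measure Ω) (A : Ω → α) : ℝ :=
  ∑ a, Real.negMulLog (μ.real (A ⁻¹' {a}))

/-- The conditional entropy `H(A | B) = -∑ p(a, b) log p(a | b)`. -/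
def condEntropy [Fintype α] [Fintype β] (μ : Measure Ω) (A : Ω → α) (B : Ω → β) : ℝ :=
  -∑ a, ∑ b, μ.real (A ⁻¹' {a} ∩ B ⁻¹' {b}) *
    Real.log (μ.real (A ⁻¹' {a} ∩ B ⁻¹' {b}) / μ.real (B ⁻¹' {b}))

/-- The mutual information `I(A; B) = ∑ p(a, b) log (p(a, b) / (p(a) p(b)))`. -/
def mutualInfo [Fintype α] [Fintype β] (μ : Measure Ω) (A : Ω → α) (B : Ω → β) : ℝ :=
  ∑ a, ∑ b, μ.real (A ⁻¹' {a} ∩ B ⁻¹' {b}) *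
    Real.log (μ.real (A ⁻¹' {a} ∩ B ⁻¹' {b}) /
      (μ.real (A ⁻¹' {a}) * μ.real (B ⁻¹' {b})))

end Information

/-! ### Finite-type constraints over the alphabet `Fin K` -/

variable {K : ℕ}

/-- All finite words that contain no element of `F` as a contiguous subword. -/
def constraint (F : Finset (List (Fin K))) : Set (List (Fin K)) :=
  {w | ∀ f ∈ F, ¬ f <:+: w}

/-- `S` is a finite-type constraint. -/
def IsFiniteType (S : Set (List (Fin K))) : Prop :=
  ∃ F : Finset (List (Fin K)), S = constraint F

/-- The topological order: the least possible length (maximal word length) of a finite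
forbidden set defining `S`, minus one. The subtraction is truncated only for the unconstrained
`S`, whose forbidden set is empty; its order is `0`. -/
def topologicalOrder (S : Set (List (Fin K))) : ℕ :=
  sInf {L | ∃ F : Finset (List (Fin K)), S = constraint F ∧ F.sup List.length = L} - 1

/-- Any two words of `S` can be joined, inside `S`, by a word of `S`. -/
def IsIrreducibleConstraint (S : Set (List (Fin K))) : Prop :=
  ∀ u ∈ S, ∀ v ∈ S, ∃ w ∈ S, u ++ w ++ v ∈ S

/-! ### Stationary processes, given by their laws on two-sided sequences -/

/-- The left shift on two-sided sequences. -/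
def shift (x : ℤ → Fin K) : ℤ → Fin K := fun n => x (n + 1)

/-- `μ` is the law of a stationary process with values in `Fin K`. -/
structure IsStationaryLaw (μ : Measure (ℤ → Fin K)) : Prop where
  isProbabilityMeasure : IsProbabilityMeasure μ
  measurePreserving : MeasurePreserving shift μ μ

/-- The word `x_i x_{i+1} ⋯ x_{i+l-1}`. -/
def wordAt (x : ℤ → Fin K) (i : ℤ) (l : ℕ) : List (Fin K) :=
  List.ofFn fun k : Fin l => x (i + (k : ℤ))

/-- The set of all words that occur with positive probability. -/
def allowedWords (μ : Measure (ℤ → Fin K)) : Set (List (Fin K)) :=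
  {w | ∃ i : ℤ, 0 < μ {x | wordAt x i w.length = w}}

/-- The event that the process agrees with `z` at all times in `s`. -/
def agreeOn (s : Set ℤ) (z : ℤ → Fin K) : Set (ℤ → Fin K) :=
  {x | ∀ i ∈ s, x i = z i}

/-- The `n`-th order Markov property: given any longer past (of positive probability), the
conditional distribution of the present depends only on the last `n` symbols. For `n = 0` this
is independence of the present from the past. -/
def IsMarkovOfOrder (n : ℕ) (μ : Measure (ℤ → Fin K)) : Prop :=
  ∀ (t : ℤ) (k : ℕ) (z : ℤ → Fin K), n ≤ k → μ (agreeOn (Set.Ico (t - k) t) z) ≠ 0 →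
    μ[agreeOn {t} z | agreeOn (Set.Ico (t - k) t) z] =
      μ[agreeOn {t} z | agreeOn (Set.Ico (t - n) t) z]

/-- The entropy rate `H(X) = lim H(X_0, …, X_{n-1}) / n`. -/
def entropyRate (μ : Measure (ℤ → Fin K)) : ℝ :=
  limUnder atTop fun n : ℕ => entropy μ (fun x (k : Fin n) => x (k : ℤ)) / (n : ℝ)

/-- The conditional entropy `H(X_0 | X_D)` for a finite set `D` of times. -/
def condEntropyZero (μ : Measure (ℤ → Fin K)) (D : Finset ℤ) : ℝ :=
  condEntropy μ (fun x => x 0) (fun x (d : D) => x (d : ℤ))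

/-- `μ` is the law of a maxentropic chain of order `m` for `S`: a stationary `m`-th order Markov
chain whose set of allowed words is `S` and whose entropy rate is the maximum over all stationary
processes supported on `S`. -/
structure IsMaxentropic (S : Set (List (Fin K))) (m : ℕ) (μ : Measure (ℤ → Fin K)) : Prop where
  stationary : IsStationaryLaw μ
  markov : IsMarkovOfOrder m μ
  allowedWords_eq : allowedWords μ = S
  entropyRate_le : ∀ ν : Measure (ℤ → Fin K), IsStationaryLaw ν → allowedWords ν ⊆ S →
    entropyRate ν ≤ entropyRate μ

/-! ### The memoryless erasure channel -/

/-- The i.i.d. erasure process: `E_n = false` (erasure) has probability `ε`. -/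
def erasureLaw (ε : I) : Measure (ℤ → Bool) :=
  Measure.infinitePi fun _ => bernoulliMeasure false true ε

/-- The channel output: `Y_n = X_n` if `E_n = 1`, and the erasure symbol `none` otherwise. -/
def output (p : (ℤ → Fin K) × (ℤ → Bool)) (n : ℤ) : Option (Fin K) :=
  if p.2 n then some (p.1 n) else none

/-- The mutual information rate `I(X; Y) = lim I(X_0^{n-1}; Y_0^{n-1}) / n` of the channel with
erasure rate `ε` and input law `μ`, the erasure process being independent of the input. -/
def mutualInfoRate (μ : Measure (ℤ → Fin K)) (ε : I) : ℝ :=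
  limUnder atTop fun n : ℕ =>
    mutualInfo (μ.prod (erasureLaw ε))
      (fun p (k : Fin n) => p.1 (k : ℤ)) (fun p (k : Fin n) => output p (k : ℤ)) / (n : ℝ)

/-- The capacity `C(S, ε)`. -/
def capacity (S : Set (List (Fin K))) (ε : I) : ℝ :=
  sSup {r | ∃ μ : Measure (ℤ → Fin K),
    IsStationaryLaw μ ∧ allowedWords μ ⊆ S ∧ r = mutualInfoRate μ ε}

/-- The `n`-th order Markov capacity `C⁽ⁿ⁾(S, ε)`. -/
def markovCapacity (n : ℕ) (S : Set (List (Fin K))) (ε : I) : ℝ :=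
  sSup {r | ∃ μ : Measure (ℤ → Fin K),
    IsStationaryLaw μ ∧ IsMarkovOfOrder n μ ∧ allowedWords μ ⊆ S ∧ r = mutualInfoRate μ ε}

/-- The coefficient
`(m + 1) H(X_0 | X_{-m}^{-1}) - ∑_{i=1}^m H(X_0 | X_{-i+1}^{-1}, X_{-i-m}^{-i-1})`. -/
def linearCoeff (m : ℕ) (μ : Measure (ℤ → Fin K)) : ℝ :=
  ((m : ℝ) + 1) * condEntropyZero μ (Finset.Icc (-(m : ℤ)) (-1)) -
    ∑ i ∈ Finset.Icc 1 m,
      condEntropyZero μ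
        (Finset.Icc (-(i : ℤ) + 1) (-1) ∪ Finset.Icc (-(i : ℤ) - m) (-(i : ℤ) - 1))

end ErasureChannel

end

open ErasureChannel

namespace ErasureChannel

/-! The output of the erasure channel reveals which letters were erased, and the erasures are
independent of the input. Hence `I(X_0^{n-1}; Y_0^{n-1})` is the mean of `H(X_D)` over the random
set `D` of surviving times (`mutualInfo_eq_erasureAvg`). By the chain rule and stationarity, the
rate is `(1 - ε)` times the limit of the mean of `H(X_0 | X_D)`, with `D` random in `[-n, -1]`.
These means decrease in `n`, so any finite window bounds the rate from above
(`exists_tendsto_rate`). A window carries finitely many erasure patterns, so the mean has a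
first-order expansion in `ε` whose error is uniform over all inputs
(`exists_abs_erasureAvg_expansion_le`). The window `[-2m, -1]` is long enough: for a chain of order
`m` its linear coefficient is exactly minus the bracket of the theorem (`erasureSlope_of_markov`).

Lower bound: evaluate the rate at the maxentropic chain. Revealing all letters older than `2m` can
only decrease the conditional entropies, and by the Markov property it does not change the terms of
order zero and one (`le_erasureAvg_of_markov`).

Upper bound: let `δ` be the `ℓ¹` distance between the `(2m+1)`-letter laws of a competitor and of
the maxentropic chain. The zeroth-order term of the competitor is at most `log c - κ δ²`
(`exists_increment_le`), while its slope differs by at most `L δ` from that of the chain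
(`exists_abs_erasureSlope_sub_le`). The possible gain `ε L δ - κ δ²` never exceeds `L² ε² / (4κ)`,
so departing from the maxentropic chain pays only at second order. As that chain has every order `n
≥ m`, the same two bounds settle the Markov capacities.

The quadratic gap comes from Parry's description. The chain has transition probabilities `ρ(v) / (c
ρ(u))`, with Perron eigenvalue `c` and right eigenfunction `ρ`. Their logarithm is `-log c` up to a
coboundary, so the entropy defect of any stationary law is its conditional relative entropy with
respect to these transitions (`log_sub_increment`). A Pinsker-type inequality controls the deviation
of the transitions, and irreducibility turns this into control of the word probabilities
(`exists_stability`). The same gap gives maximality and uniqueness of the chain. -/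

/-! ### Entropy inequalities for finite random variables -/

open Real in
/-- Strong subadditivity of Shannon entropy for a nonnegative array. -/
lemma sum_negMulLog_submodular {α β γ : Type*} [Fintype α] [Fintype β] [Fintype γ]
    (p : α → β → γ → ℝ) (hp : ∀ a b c, 0 ≤ p a b c) :
    (∑ a, ∑ b, ∑ c, negMulLog (p a b c)) + ∑ b, negMulLog (∑ a, ∑ c, p a b c) ≤
      (∑ a, ∑ b, negMulLog (∑ c, p a b c)) + ∑ b, ∑ c, negMulLog (∑ a, p a b c) := by
  set u : α → β → ℝ := fun a b => ∑ c, p a b c with hu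
  set v : β → γ → ℝ := fun b c => ∑ a, p a b c with hv
  set q : β → ℝ := fun b => ∑ a, ∑ c, p a b c with hq
  have huq : ∀ b, ∑ a, u a b = q b := fun b => rfl
  have hvq : ∀ b, ∑ c, v b c = q b := fun b => Finset.sum_comm
  have hu0 : ∀ a b, 0 ≤ u a b := fun a b => Finset.sum_nonneg fun c _ => hp a b c
  have hv0 : ∀ b c, 0 ≤ v b c := fun b c => Finset.sum_nonneg fun a _ => hp a b c
  have hq0 : ∀ b, 0 ≤ q b := fun b => Finset.sum_nonneg fun a _ => hu0 a b
  have hpu : ∀ a b c, p a b c ≤ u a b := fun a b c =>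
    Finset.single_le_sum (f := fun c => p a b c) (fun c _ => hp a b c) (Finset.mem_univ c)
  have hpv : ∀ a b c, p a b c ≤ v b c := fun a b c =>
    Finset.single_le_sum (f := fun a => p a b c) (fun a _ => hp a b c) (Finset.mem_univ a)
  have huq' : ∀ a b, u a b ≤ q b := fun a b =>
    Finset.single_le_sum (f := fun a => u a b) (fun a _ => hu0 a b) (Finset.mem_univ a)
  -- This is `log t ≥ 1 - 1/t` at `t = p q / (u v)`, multiplied by `p`. The conditionally
  -- independent array `u v / q` has the same total mass as `p`, so the left sides sum to zero.
  have key : ∀ a b c, p a b c - u a b * v b c / q b ≤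
      p a b c * (log (p a b c) + log (q b) - log (u a b) - log (v b c)) := by
    intro a b c
    rcases (hp a b c).eq_or_lt with h0 | h0
    · rw [← h0]
      have : 0 ≤ u a b * v b c / q b := by have := hu0 a b; have := hv0 b c; have := hq0 b; positivity
      linarith
    · have h1 : 0 < u a b := h0.trans_le (hpu a b c)
      have h2 : 0 < v b c := h0.trans_le (hpv a b c)
      have h3 : 0 < q b := h1.trans_le (huq' a b)
      have hx : 0 < p a b c * q b / (u a b * v b c) := by positivity
      have := one_sub_inv_le_log_of_pos hx
      rw [log_div (by positivity) (by positivity), log_mul h0.ne' h3.ne',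
        log_mul h1.ne' h2.ne'] at this
      have h4 := mul_le_mul_of_nonneg_left this h0.le
      have h5 : p a b c * (1 - (p a b c * q b / (u a b * v b c))⁻¹) =
          p a b c - u a b * v b c / q b := by field_simp
      rw [h5] at h4
      linarith
  have hsum := Finset.sum_le_sum fun a (_ : a ∈ Finset.univ) => Finset.sum_le_sum
    fun b (_ : b ∈ Finset.univ) => Finset.sum_le_sum fun c (_ : c ∈ Finset.univ) => key a b c
  have hl : ∑ a, ∑ b, ∑ c, (p a b c - u a b * v b c / q b) = 0 := by
    have h1 : ∀ a b, ∑ c, u a b * v b c / q b = u a b := by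
      intro a b
      rw [← Finset.sum_div, ← Finset.mul_sum, hvq]
      rcases (hq0 b).eq_or_lt with h | h
      · have : u a b = 0 := le_antisymm (h ▸ huq' a b) (hu0 a b)
        simp [this]
      · field_simp
    simp only [Finset.sum_sub_distrib, h1]
    simp [hu]
  have hr : ∑ a, ∑ b, ∑ c, p a b c * (log (p a b c) + log (q b) - log (u a b) - log (v b c)) =
      -(∑ a, ∑ b, ∑ c, negMulLog (p a b c)) - (∑ b, negMulLog (q b)) +
        (∑ a, ∑ b, negMulLog (u a b)) + ∑ b, ∑ c, negMulLog (v b c) := by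
    have e1 : ∑ b, negMulLog (q b) = ∑ a, ∑ b, ∑ c, -(p a b c * log (q b)) := by
      rw [Finset.sum_comm]
      refine Finset.sum_congr rfl fun b _ => ?_
      simp only [negMulLog, hq, Finset.sum_neg_distrib, ← Finset.sum_mul, neg_mul]
    have e2 : ∑ a, ∑ b, negMulLog (u a b) = ∑ a, ∑ b, ∑ c, -(p a b c * log (u a b)) := by
      refine Finset.sum_congr rfl fun a _ => Finset.sum_congr rfl fun b _ => ?_
      simp only [negMulLog, hu, Finset.sum_neg_distrib, ← Finset.sum_mul, neg_mul]
    have e3 : ∑ b, ∑ c, negMulLog (v b c) = ∑ a, ∑ b, ∑ c, -(p a b c * log (v b c)) := by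
      rw [Finset.sum_comm (s := (Finset.univ : Finset α))]
      refine Finset.sum_congr rfl fun b _ => ?_
      rw [Finset.sum_comm (s := (Finset.univ : Finset α))]
      refine Finset.sum_congr rfl fun c _ => ?_
      simp only [negMulLog, hv, Finset.sum_neg_distrib, ← Finset.sum_mul, neg_mul]
    rw [e1, e2, e3]
    simp only [← Finset.sum_neg_distrib, ← Finset.sum_sub_distrib, ← Finset.sum_add_distrib]
    refine Finset.sum_congr rfl fun a _ => Finset.sum_congr rfl fun b _ =>
      Finset.sum_congr rfl fun c _ => ?_
    simp only [negMulLog]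
    ring
  rw [hl, hr] at hsum
  linarith

open Real in
lemma negMulLog_sum_le {α : Type*} [Fintype α] (p : α → ℝ) (hp : ∀ a, 0 ≤ p a) :
    negMulLog (∑ a, p a) ≤ ∑ a, negMulLog (p a) := by
  rw [negMulLog, neg_mul, Finset.sum_mul, ← Finset.sum_neg_distrib]
  refine Finset.sum_le_sum fun a _ => ?_
  rw [negMulLog, neg_mul, neg_le_neg_iff]
  rcases (hp a).eq_or_lt with h | h
  · simp [← h]
  · exact mul_le_mul_of_nonneg_left (log_le_log h
      (Finset.single_le_sum (fun a _ => hp a) (Finset.mem_univ a))) h.le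

lemma negMulLog_le_one {x : ℝ} (hx : 0 ≤ x) : Real.negMulLog x ≤ 1 := by
  rcases hx.eq_or_lt with h | h
  · simp [← h]
  · have := mul_le_mul_of_nonneg_left (Real.one_sub_inv_le_log_of_pos h) hx
    rw [mul_sub, mul_inv_cancel₀ h.ne'] at this
    simp only [Real.negMulLog]
    linarith

lemma preimage_pair_singleton {Ω α β : Type*} (A : Ω → α) (B : Ω → β) (a : α) (b : β) :
    (fun x => (A x, B x)) ⁻¹' {(a, b)} = A ⁻¹' {a} ∩ B ⁻¹' {b} := by
  ext; simp

section RandomVariables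

variable {Ω α β γ : Type*} [MeasurableSpace Ω] {μ : Measure Ω}

lemma measureReal_eq_sum_inter [Fintype β] [IsFiniteMeasure μ] {s : Set Ω} (hs : MeasurableSet s)
    (B : Ω → β) (hB : ∀ b, MeasurableSet (B ⁻¹' {b})) :
    μ.real s = ∑ b, μ.real (s ∩ B ⁻¹' {b}) := by
  rw [← measureReal_biUnion_finset]
  · congr 1
    ext x; simp
  · intro b _ c _ hbc
    refine Set.disjoint_left.2 fun x hx hy => hbc ?_
    rw [← hx.2, ← hy.2]
  · exact fun b _ => hs.inter (hB b)

/-- Entropy depends only on the partition generated by the random variable. -/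
lemma entropy_congr [Fintype α] [Fintype β] {A : Ω → α} {B : Ω → β}
    (h : ∀ x y, A x = A y ↔ B x = B y) : entropy μ A = entropy μ B := by
  have ne : ∀ a, Real.negMulLog (μ.real (A ⁻¹' {a})) ≠ 0 → ∃ x, A x = a := by
    intro a ha
    by_contra hx
    push Not at hx
    have : A ⁻¹' {a} = ∅ := by ext y; simpa using hx y
    simp [this] at ha
  have ne' : ∀ b, Real.negMulLog (μ.real (B ⁻¹' {b})) ≠ 0 → ∃ x, B x = b := by
    intro b hb
    by_contra hx
    push Not at hx
    have : B ⁻¹' {b} = ∅ := by ext y; simpa using hx y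
    simp [this] at hb
  have fib : ∀ x, A ⁻¹' {A x} = B ⁻¹' {B x} := by
    intro x; ext y; simpa using h y x
  -- Values that are never taken contribute `negMulLog 0 = 0`, so only attained values have to be
  -- matched.
  refine Finset.sum_bij_ne_zero (fun a _ ha => B (ne a ha).choose) (fun _ _ _ => Finset.mem_univ _)
    ?_ ?_ ?_
  · intro a _ ha a' _ ha' hh
    rw [← (ne a ha).choose_spec, ← (ne a' ha').choose_spec]
    exact (h _ _).2 hh
  · intro b _ hb
    obtain ⟨x, rfl⟩ := ne' b hb
    have hx : Real.negMulLog (μ.real (A ⁻¹' {A x})) ≠ 0 := by rwa [fib]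
    exact ⟨A x, Finset.mem_univ _, hx, (h _ _).1 (ne _ hx).choose_spec⟩
  · intro a _ ha
    conv_lhs => rw [← (ne a ha).choose_spec]
    rw [fib]

lemma condEntropy_eq_sub [Fintype α] [Fintype β] [IsFiniteMeasure μ] (A : Ω → α) (B : Ω → β)
    (hA : ∀ a, MeasurableSet (A ⁻¹' {a})) (hB : ∀ b, MeasurableSet (B ⁻¹' {b})) :
    condEntropy μ A B = entropy μ (fun x => (A x, B x)) - entropy μ B := by
  have e : entropy μ B =
      ∑ a, ∑ b, -(μ.real (A ⁻¹' {a} ∩ B ⁻¹' {b}) * Real.log (μ.real (B ⁻¹' {b}))) := by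
    rw [Finset.sum_comm]
    refine Finset.sum_congr rfl fun b _ => ?_
    rw [Finset.sum_neg_distrib, ← Finset.sum_mul, Real.negMulLog, neg_mul]
    conv_lhs => rw [measureReal_eq_sum_inter (hB b) A hA]
    simp only [Set.inter_comm (B ⁻¹' {b})]
    congr 3
    rw [measureReal_eq_sum_inter (hB b) A hA]
    simp only [Set.inter_comm (B ⁻¹' {b})]
  rw [e, entropy, Fintype.sum_prod_type, condEntropy]
  simp only [preimage_pair_singleton, ← Finset.sum_neg_distrib, ← Finset.sum_sub_distrib]
  refine Finset.sum_congr rfl fun a _ => Finset.sum_congr rfl fun b _ => ?_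
  by_cases h : μ.real (A ⁻¹' {a} ∩ B ⁻¹' {b}) = 0
  · simp [h]
  · have h' : μ.real (B ⁻¹' {b}) ≠ 0 := by
      intro h0
      exact h (le_antisymm (h0 ▸ measureReal_mono Set.inter_subset_right) measureReal_nonneg)
    rw [Real.log_div h h', Real.negMulLog]
    ring

lemma entropy_submodular [Fintype α] [Fintype β] [Fintype γ] [IsFiniteMeasure μ]
    (A : Ω → α) (B : Ω → β) (C : Ω → γ) (hA : ∀ a, MeasurableSet (A ⁻¹' {a}))
    (hB : ∀ b, MeasurableSet (B ⁻¹' {b})) (hC : ∀ c, MeasurableSet (C ⁻¹' {c})) :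
    entropy μ (fun x => (A x, B x, C x)) + entropy μ B ≤
      entropy μ (fun x => (A x, B x)) + entropy μ (fun x => (B x, C x)) := by
  have := sum_negMulLog_submodular
    (fun a b c => μ.real (A ⁻¹' {a} ∩ (B ⁻¹' {b} ∩ C ⁻¹' {c}))) fun _ _ _ => measureReal_nonneg
  have e1 : ∀ a b, ∑ c, μ.real (A ⁻¹' {a} ∩ (B ⁻¹' {b} ∩ C ⁻¹' {c})) =
      μ.real (A ⁻¹' {a} ∩ B ⁻¹' {b}) := by
    intro a b
    rw [measureReal_eq_sum_inter ((hA a).inter (hB b)) C hC]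
    simp only [Set.inter_assoc]
  have e2 : ∀ b c, ∑ a, μ.real (A ⁻¹' {a} ∩ (B ⁻¹' {b} ∩ C ⁻¹' {c})) =
      μ.real (B ⁻¹' {b} ∩ C ⁻¹' {c}) := by
    intro b c
    rw [measureReal_eq_sum_inter ((hB b).inter (hC c)) A hA]
    simp only [Set.inter_comm (A ⁻¹' _)]
  have e3 : ∀ b, ∑ a, μ.real (A ⁻¹' {a} ∩ B ⁻¹' {b}) = μ.real (B ⁻¹' {b}) := by
    intro b
    rw [measureReal_eq_sum_inter (hB b) A hA]
    simp only [Set.inter_comm (A ⁻¹' _)]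
  simp only [e1, e2, e3] at this
  simpa only [entropy, Fintype.sum_prod_type, preimage_pair_singleton] using this

lemma entropy_le_entropy_pair [Fintype α] [Fintype β] [IsFiniteMeasure μ]
    (A : Ω → α) (B : Ω → β) (hA : ∀ a, MeasurableSet (A ⁻¹' {a}))
    (hB : ∀ b, MeasurableSet (B ⁻¹' {b})) :
    entropy μ A ≤ entropy μ (fun x => (A x, B x)) := by
  rw [entropy, entropy, Fintype.sum_prod_type]
  refine Finset.sum_le_sum fun a _ => ?_
  rw [measureReal_eq_sum_inter (hA a) B hB]
  simp only [preimage_pair_singleton]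
  exact negMulLog_sum_le _ fun _ => measureReal_nonneg

/-- Cruder than `log (card α)`; only a bound independent of the law is needed. -/
lemma entropy_le_card [Fintype α] (A : Ω → α) : entropy μ A ≤ Fintype.card α := by
  refine (Finset.sum_le_card_nsmul _ _ 1 fun a _ => negMulLog_le_one measureReal_nonneg).trans ?_
  simp

lemma entropy_of_subsingleton [Fintype α] [Subsingleton α] [IsProbabilityMeasure μ] (A : Ω → α) :
    entropy μ A = 0 := by
  refine Finset.sum_eq_zero fun a _ => ?_
  have : A ⁻¹' {a} = Set.univ := by ext x; simpa using Subsingleton.elim _ _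
  simp [this]

end RandomVariables

/-- An abstract entropy function of finite sets of times: normalized, monotone, submodular and
shift-invariant, with one-point values bounded by `M`. -/
structure IsStationaryEntropy (H : Finset ℤ → ℝ) (M : ℝ) : Prop where
  empty : H ∅ = 0
  mono : ∀ {X Y}, X ⊆ Y → H X ≤ H Y
  submodular : ∀ X Y, H (X ∪ Y) + H (X ∩ Y) ≤ H X + H Y
  shift : ∀ X t, H (X.image (· + t)) = H X
  singleton_le : H {0} ≤ M

/-! ### Block entropies of a stationary law -/

variable {K : ℕ}

/-- The entropy of the coordinates in the finite set `D`. -/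
noncomputable def blockEntropy (μ : Measure (ℤ → Fin K)) (D : Finset ℤ) : ℝ :=
  entropy μ (fun x (d : D) => x (d : ℤ))

lemma measurableSet_restrict_fiber {ι : Type*} [Finite ι] (f : ι → ℤ) (z : ι → Fin K) :
    MeasurableSet ((fun (x : ℤ → Fin K) (i : ι) => x (f i)) ⁻¹' {z}) :=
  (by fun_prop : Measurable fun (x : ℤ → Fin K) (i : ι) => x (f i)) (measurableSet_singleton z)

lemma restrict_eq_iff (D : Finset ℤ) (x y : ℤ → Fin K) :
    (fun (d : D) => x (d : ℤ)) = (fun (d : D) => y (d : ℤ)) ↔ ∀ d ∈ D, x d = y d := by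
  simp [funext_iff]

lemma measurable_shift : Measurable (shift : (ℤ → Fin K) → ℤ → Fin K) := by
  unfold shift; fun_prop

lemma IsStationaryLaw.blockEntropy_image_succ {μ : Measure (ℤ → Fin K)} (h : IsStationaryLaw μ)
    (X : Finset ℤ) : blockEntropy μ (X.image (· + 1)) = blockEntropy μ X := by
  have e : blockEntropy μ (X.image (· + 1)) =
      entropy μ (fun x (d : X) => shift x (d : ℤ)) := by
    refine entropy_congr fun x y => ?_
    rw [restrict_eq_iff, restrict_eq_iff, Finset.forall_mem_image]
    rfl
  rw [e, blockEntropy, entropy, entropy]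
  refine Finset.sum_congr rfl fun z _ => ?_
  have := h.measurePreserving.measureReal_preimage
    (measurableSet_restrict_fiber (fun d : X => (d : ℤ)) z).nullMeasurableSet
  rw [← this]
  rfl

lemma IsStationaryLaw.blockEntropy_image {μ : Measure (ℤ → Fin K)} (h : IsStationaryLaw μ)
    (X : Finset ℤ) (t : ℤ) : blockEntropy μ (X.image (· + t)) = blockEntropy μ X := by
  have key : ∀ (n : ℕ) (X : Finset ℤ), blockEntropy μ (X.image (· + (n : ℤ))) = blockEntropy μ X := by
    intro n
    induction n with
    | zero => intro X; simp
    | succ n ih =>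
      intro X
      rw [← ih X, ← h.blockEntropy_image_succ (X.image (· + (n : ℤ))), Finset.image_image]
      congr 2
      ext i; simp [add_assoc]
  obtain ⟨n, rfl | rfl⟩ := t.eq_nat_or_neg
  · exact key n X
  · rw [← key n (X.image _), Finset.image_image]
    simp [Function.comp_def]

/-- Submodularity is strong subadditivity with the coordinates in `X ∩ Y` as the middle variable.
From here on most entropy arguments use only these set-function properties. -/
lemma IsStationaryLaw.isStationaryEntropy {μ : Measure (ℤ → Fin K)} (h : IsStationaryLaw μ) :
    IsStationaryEntropy (blockEntropy μ) K := by
  have := h.isProbabilityMeasure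
  refine ⟨entropy_of_subsingleton _, ?_, ?_, h.blockEntropy_image, ?_⟩
  · intro X Y hXY
    refine (entropy_le_entropy_pair _ (fun x (d : Y) => x (d : ℤ))
      (measurableSet_restrict_fiber _) (measurableSet_restrict_fiber _)).trans_eq ?_
    refine entropy_congr fun x y => ?_
    rw [Prod.mk.injEq, restrict_eq_iff, restrict_eq_iff]
    exact ⟨fun h => h.2, fun h => ⟨fun d hd => h d (hXY hd), h⟩⟩
  · intro X Y
    have := entropy_submodular (μ := μ) (fun x (d : X) => x (d : ℤ))
      (fun x (d : (X ∩ Y : Finset ℤ)) => x (d : ℤ)) (fun x (d : Y) => x (d : ℤ))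
      (measurableSet_restrict_fiber _) (measurableSet_restrict_fiber _)
      (measurableSet_restrict_fiber _)
    refine Eq.trans_le ?_ (this.trans_eq ?_)
    · congr 1
      refine entropy_congr fun x y => ?_
      simp only [Prod.mk.injEq, restrict_eq_iff, Finset.mem_union, Finset.mem_inter]
      grind
    · congr 1 <;> refine entropy_congr fun x y => ?_ <;>
      · simp only [Prod.mk.injEq, restrict_eq_iff, Finset.mem_inter]
        grind
  · refine (entropy_congr (B := fun x : ℤ → Fin K => x 0) fun x y => ?_).trans_le
      ((entropy_le_card _).trans_eq (by simp))
    rw [restrict_eq_iff]; simp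

lemma condEntropyZero_eq_sub (μ : Measure (ℤ → Fin K)) [IsFiniteMeasure μ] (D : Finset ℤ) :
    condEntropyZero μ D = blockEntropy μ (insert 0 D) - blockEntropy μ D := by
  rw [condEntropyZero, condEntropy_eq_sub _ _ (fun a => measurable_pi_apply (0 : ℤ) (measurableSet_singleton a))
    (measurableSet_restrict_fiber _)]
  congr 1
  refine entropy_congr fun x y => ?_
  simp [restrict_eq_iff, Prod.mk.injEq]

/-! ### Averages over random erasure patterns -/

/-- The average of `f D` over the random set `D` of times in `s` that are not erased. -/
noncomputable def erasureAvg (ε : ℝ) (s : Finset ℤ) (f : Finset ℤ → ℝ) : ℝ :=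
  ∑ D ∈ s.powerset, (1 - ε) ^ D.card * ε ^ (s.card - D.card) * f D

lemma erasureAvg_empty (ε : ℝ) (f : Finset ℤ → ℝ) : erasureAvg ε ∅ f = f ∅ := by
  simp [erasureAvg]

/-- Condition on whether the time `i` survives. This recursion drives the inductions on the window.
-/
lemma erasureAvg_insert (ε : ℝ) {s : Finset ℤ} {i : ℤ} (hi : i ∉ s) (f : Finset ℤ → ℝ) :
    erasureAvg ε (insert i s) f =
      (1 - ε) * erasureAvg ε s (fun D => f (insert i D)) + ε * erasureAvg ε s f := by
  rw [erasureAvg, Finset.sum_powerset_insert hi, add_comm, erasureAvg, erasureAvg,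
    Finset.mul_sum, Finset.mul_sum]
  congr 1 <;> refine Finset.sum_congr rfl fun D hD => ?_
  · rw [Finset.mem_powerset] at hD
    rw [Finset.card_insert_of_notMem hi, Finset.card_insert_of_notMem fun h => hi (hD h),
      Nat.add_sub_add_right]
    ring
  · rw [Finset.mem_powerset] at hD
    rw [Finset.card_insert_of_notMem hi, Nat.succ_sub (Finset.card_le_card hD), pow_succ]
    ring

lemma erasureAvg_sub (ε : ℝ) (s : Finset ℤ) (f g : Finset ℤ → ℝ) :
    erasureAvg ε s (fun D => f D - g D) = erasureAvg ε s f - erasureAvg ε s g := by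
  simp only [erasureAvg, mul_sub, Finset.sum_sub_distrib]

lemma erasureAvg_const (ε : ℝ) (s : Finset ℤ) (c : ℝ) : erasureAvg ε s (fun _ => c) = c := by
  induction s using Finset.induction_on with
  | empty => simp [erasureAvg]
  | insert i s hi ih => rw [erasureAvg_insert ε hi, ih]; ring

lemma erasureAvg_mono {ε : ℝ} (h0 : 0 ≤ ε) (h1 : ε ≤ 1) {s : Finset ℤ} {f g : Finset ℤ → ℝ}
    (h : ∀ D ⊆ s, f D ≤ g D) : erasureAvg ε s f ≤ erasureAvg ε s g := by
  refine Finset.sum_le_sum fun D hD => ?_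
  have : 0 ≤ 1 - ε := by linarith
  exact mul_le_mul_of_nonneg_left (h D (Finset.mem_powerset.1 hD)) (by positivity)

lemma abs_erasureAvg_le {ε : ℝ} (h0 : 0 ≤ ε) (h1 : ε ≤ 1) (s : Finset ℤ) {f : Finset ℤ → ℝ} {M : ℝ}
    (h : ∀ D, |f D| ≤ M) : |erasureAvg ε s f| ≤ M := by
  rw [abs_le]
  constructor
  · rw [← erasureAvg_const ε s (-M)]
    exact erasureAvg_mono h0 h1 fun D _ => (abs_le.1 (h D)).1
  · rw [← erasureAvg_const ε s M]
    exact erasureAvg_mono h0 h1 fun D _ => (abs_le.1 (h D)).2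

lemma erasureAvg_image_add (ε : ℝ) (s : Finset ℤ) (t : ℤ) (f : Finset ℤ → ℝ) :
    erasureAvg ε (s.image (· + t)) f = erasureAvg ε s (fun D => f (D.image (· + t))) := by
  induction s using Finset.induction_on generalizing f with
  | empty => simp [erasureAvg]
  | insert i s hi ih =>
    rw [Finset.image_insert, erasureAvg_insert ε (by simpa using hi), erasureAvg_insert ε hi, ih, ih]
    simp only [Finset.image_insert]

/-- Extra times can only enlarge the observed set, which lowers an antitone `f`. -/
lemma erasureAvg_union_le {ε : ℝ} (h0 : 0 ≤ ε) (h1 : ε ≤ 1) (s t : Finset ℤ)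
    {f : Finset ℤ → ℝ} (hf : Antitone f) : erasureAvg ε (s ∪ t) f ≤ erasureAvg ε s f := by
  induction t using Finset.induction_on with
  | empty => simp
  | insert i t hi ih =>
    rw [Finset.union_insert]
    by_cases h : i ∈ s ∪ t
    · rwa [Finset.insert_eq_of_mem h]
    · rw [erasureAvg_insert ε h]
      have := erasureAvg_mono (s := s ∪ t) h0 h1 fun D _ => hf (Finset.subset_insert i D)
      nlinarith

/-- Compare with a genie that never erases a time of `t`: the observed set becomes larger, so `f`
becomes smaller. -/
lemma le_erasureAvg_union {ε : ℝ} (h0 : 0 ≤ ε) (h1 : ε ≤ 1) (s t : Finset ℤ)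
    {f : Finset ℤ → ℝ} (hf : Antitone f) (hst : Disjoint s t) :
    erasureAvg ε s (fun D => f (D ∪ t)) ≤ erasureAvg ε (s ∪ t) f := by
  induction t using Finset.induction_on generalizing f with
  | empty => simp
  | insert i t hi ih =>
    rw [Finset.disjoint_insert_right] at hst
    have h : i ∉ s ∪ t := by simp [hst.1, hi]
    rw [Finset.union_insert, erasureAvg_insert ε h]
    have h2 := erasureAvg_mono (s := s ∪ t) h0 h1 fun D _ => hf (Finset.subset_insert i D)
    have h3 := ih (f := fun D => f (insert i D))
      (fun D E hDE => hf (Finset.insert_subset_insert i hDE)) hst.2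
    simp only [Finset.union_insert]
    nlinarith

/-- The expansion to order zero, needed for the term that already carries a factor `ε` in the
first-order expansion. The constant depends on `s` alone, hence is uniform in `f`. -/
lemma abs_erasureAvg_sub_le (s : Finset ℤ) : ∃ C : ℝ, 0 ≤ C ∧ ∀ (ε : ℝ), 0 ≤ ε → ε ≤ 1 →
    ∀ (f : Finset ℤ → ℝ) (M : ℝ), (∀ D, |f D| ≤ M) → |erasureAvg ε s f - f s| ≤ C * M * ε := by
  induction s using Finset.induction_on with
  | empty => exact ⟨0, le_rfl, fun ε h0 _ f M _ => by simp [erasureAvg_empty]⟩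
  | insert i s hi ih =>
    obtain ⟨C, hC, ih⟩ := ih
    refine ⟨C + 2, by positivity, fun ε h0 h1 f M hf => ?_⟩
    have hM : 0 ≤ M := (abs_nonneg _).trans (hf ∅)
    have a1 := ih ε h0 h1 (fun D => f (insert i D)) M fun D => hf _
    have a2 := abs_erasureAvg_le h0 h1 s hf
    have a3 := hf (insert i s)
    rw [erasureAvg_insert ε hi]
    set A := erasureAvg ε s (fun D => f (insert i D))
    set B := erasureAvg ε s f
    set F := f (insert i s)
    have e : (1 - ε) * A + ε * B - F = (1 - ε) * (A - F) + ε * (B - F) := by ring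
    rw [e]
    refine (abs_add_le _ _).trans ?_
    rw [abs_mul, abs_mul, abs_of_nonneg h0, abs_of_nonneg (by linarith : 0 ≤ 1 - ε)]
    have a4 : |B - F| ≤ 2 * M := (abs_sub _ _).trans (by linarith)
    have : (1 - ε) * |A - F| ≤ 1 * (C * M * ε) :=
      mul_le_mul (by linarith) a1 (abs_nonneg _) zero_le_one
    have := mul_le_mul_of_nonneg_left a4 h0
    linarith

/-- First-order expansion of an average over erasure patterns. -/
lemma abs_erasureAvg_sub_firstOrder_le (s : Finset ℤ) : ∃ C : ℝ, 0 ≤ C ∧ ∀ (ε : ℝ), 0 ≤ ε → ε ≤ 1 →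
    ∀ (f : Finset ℤ → ℝ) (M : ℝ), (∀ D, |f D| ≤ M) →
    |erasureAvg ε s f - (f s + ε * ∑ i ∈ s, (f (s.erase i) - f s))| ≤ C * M * ε ^ 2 := by
  induction s using Finset.induction_on with
  | empty => exact ⟨0, le_rfl, fun ε h0 _ f M _ => by simp [erasureAvg_empty]⟩
  | insert i s hi ih =>
    obtain ⟨C, hC, ih⟩ := ih
    obtain ⟨C₀, hC₀, h⟩ := abs_erasureAvg_sub_le s
    refine ⟨C + C₀ + 2 * s.card, by positivity, fun ε h0 h1 f M hf => ?_⟩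
    have hM : 0 ≤ M := (abs_nonneg _).trans (hf ∅)
    have a1 := ih ε h0 h1 (fun D => f (insert i D)) M fun D => hf _
    have a2 := h ε h0 h1 f M hf
    rw [erasureAvg_insert ε hi, Finset.sum_insert hi, Finset.erase_insert hi]
    have e1 : ∑ j ∈ s, (f ((insert i s).erase j) - f (insert i s)) =
        ∑ j ∈ s, (f (insert i (s.erase j)) - f (insert i s)) := by
      refine Finset.sum_congr rfl fun j hj => ?_
      rw [Finset.erase_insert_of_ne (by rintro rfl; exact hi hj)]
    rw [e1]
    have a3 : |∑ j ∈ s, (f (insert i (s.erase j)) - f (insert i s))| ≤ 2 * s.card * M := by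
      refine (Finset.abs_sum_le_sum_abs _ _).trans ?_
      refine (Finset.sum_le_card_nsmul _ _ (2 * M) fun j _ => ?_).trans_eq ?_
      · have := hf (insert i (s.erase j)); have := hf (insert i s)
        exact (abs_sub _ _).trans (by linarith)
      · simp; ring
    set A := erasureAvg ε s (fun D => f (insert i D))
    set B := erasureAvg ε s f
    set F := f (insert i s)
    set Q := ∑ j ∈ s, (f (insert i (s.erase j)) - F)
    -- If `i` survives, the first-order expansion on `s` applies; if `i` is erased, the zeroth-order
    -- one suffices. What remains is the cross term `-ε² Q`.
    have e : (1 - ε) * A + ε * B - (F + ε * (f s - F + Q)) =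
      (1 - ε) * (A - (F + ε * Q)) + ε * (B - f s) + (-(ε ^ 2) * Q) := by ring
    rw [e]
    refine (abs_add_three _ _ _).trans ?_
    rw [abs_mul, abs_mul, abs_mul, abs_of_nonneg h0, abs_of_nonneg (by linarith : 0 ≤ 1 - ε),
      abs_neg, abs_of_nonneg (sq_nonneg ε)]
    have b1 : (1 - ε) * |A - (F + ε * Q)| ≤ 1 * (C * M * ε ^ 2) :=
      mul_le_mul (by linarith) a1 (abs_nonneg _) zero_le_one
    have b2 := mul_le_mul_of_nonneg_left a2 h0
    have b3 := mul_le_mul_of_nonneg_left a3 (sq_nonneg ε)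
    nlinarith

/-! ### Entropy increments and rates -/

/-- The increment `H(X_0 | X_D)` of an entropy function. -/
def increment (H : Finset ℤ → ℝ) (D : Finset ℤ) : ℝ := H (insert 0 D) - H D

/-- The coefficient of `ε` in the expansion of `(1 - ε) 𝔼 H(X_0 | X_D)`, where `D` is the set of
times in `[-N, -1]` that are not erased. -/
noncomputable def erasureSlope (H : Finset ℤ → ℝ) (N : ℕ) : ℝ :=
  ∑ i ∈ Finset.Ico (-(N : ℤ)) 0, increment H ((Finset.Ico (-(N : ℤ)) 0).erase i) -
    (N + 1) * increment H (Finset.Ico (-(N : ℤ)) 0)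

namespace IsStationaryEntropy

variable {H : Finset ℤ → ℝ} {M : ℝ}

/-- Conditioning reduces entropy. Monotonicity of `H` is also used because the intersection `insert
0 D ∩ E` exceeds `D` when `E` contains `0`. -/
lemma antitone_increment (hH : IsStationaryEntropy H M) : Antitone (increment H) := by
  intro D E hDE
  have h1 := hH.submodular (insert 0 D) E
  have h2 : insert 0 D ∪ E = insert 0 E := by
    rw [Finset.insert_union, Finset.union_eq_right.2 hDE]
  have h3 := hH.mono (X := D) (Y := insert 0 D ∩ E)
    (Finset.subset_inter (Finset.subset_insert _ _) hDE)
  rw [h2] at h1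
  simp only [increment]
  linarith

lemma increment_nonneg (hH : IsStationaryEntropy H M) (D : Finset ℤ) : 0 ≤ increment H D :=
  sub_nonneg.2 (hH.mono (Finset.subset_insert _ _))

lemma increment_le (hH : IsStationaryEntropy H M) (D : Finset ℤ) : increment H D ≤ M := by
  refine (hH.antitone_increment (Finset.empty_subset D)).trans ?_
  simpa [increment, hH.empty] using hH.singleton_le

lemma abs_increment_le (hH : IsStationaryEntropy H M) (D : Finset ℤ) : |increment H D| ≤ M := by
  rw [abs_of_nonneg (hH.increment_nonneg D)]
  exact hH.increment_le D

lemma Ico_succ_sub (hH : IsStationaryEntropy H M) {a b : ℤ} (hab : a ≤ b) :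
    H (Finset.Ico a (b + 1)) - H (Finset.Ico a b) = increment H (Finset.Ico (a - b) 0) := by
  rw [increment, ← hH.shift (insert 0 _) b, ← hH.shift (Finset.Ico (a - b) 0) b]
  congr 2
  · ext x; simp; omega
  · ext x; simp

/-- Chain rule for averaged entropies: the new time survives with probability `1 - ε` and then adds
its conditional entropy given the survivors, translated to time `0`. -/
lemma erasureAvg_Ico_succ (hH : IsStationaryEntropy H M) (ε : ℝ) (n : ℕ) :
    erasureAvg ε (Finset.Ico 0 ((n + 1 : ℕ) : ℤ)) H = erasureAvg ε (Finset.Ico 0 (n : ℤ)) H +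
      (1 - ε) * erasureAvg ε (Finset.Ico (-(n : ℤ)) 0) (increment H) := by
  have e1 : Finset.Ico 0 ((n + 1 : ℕ) : ℤ) = insert (n : ℤ) (Finset.Ico 0 (n : ℤ)) := by
    ext x; simp only [Finset.mem_Ico, Finset.mem_insert]; omega
  have e2 : Finset.Ico 0 (n : ℤ) = (Finset.Ico (-(n : ℤ)) 0).image (· + (n : ℤ)) := by
    ext x; simp
  have e3 : erasureAvg ε (Finset.Ico (-(n : ℤ)) 0) (increment H) =
      erasureAvg ε (Finset.Ico 0 (n : ℤ)) (fun D => H (insert (n : ℤ) D) - H D) := by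
    rw [e2, erasureAvg_image_add]
    congr 1
    ext D
    have : insert (n : ℤ) (D.image (· + (n : ℤ))) = (insert 0 D).image (· + (n : ℤ)) := by simp
    rw [this, hH.shift, hH.shift, increment]
  rw [e1, erasureAvg_insert ε (by simp), e3, erasureAvg_sub]
  ring

/-- Existence of the rate `lim 𝔼 H(X_D) / n`, with upper and lower bounds. -/
lemma exists_tendsto_rate (hH : IsStationaryEntropy H M) {ε : ℝ} (h0 : 0 ≤ ε) (h1 : ε ≤ 1) :
    ∃ l : ℝ, Tendsto (fun n : ℕ => erasureAvg ε (Finset.Ico 0 (n : ℤ)) H / n) atTop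
        (𝓝 ((1 - ε) * l)) ∧
      (∀ n : ℕ, l ≤ erasureAvg ε (Finset.Ico (-(n : ℤ)) 0) (increment H)) ∧
      ∀ (c : ℝ) (N : ℕ), (∀ n : ℕ, N ≤ n →
        c ≤ erasureAvg ε (Finset.Ico (-(n : ℤ)) 0) (increment H)) → c ≤ l := by
  set a : ℕ → ℝ := fun n => erasureAvg ε (Finset.Ico (-(n : ℤ)) 0) (increment H) with ha
  have anti : Antitone a := by
    refine antitone_nat_of_succ_le fun n => ?_
    have : Finset.Ico (-((n + 1 : ℕ) : ℤ)) 0 =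
        Finset.Ico (-(n : ℤ)) 0 ∪ {-((n + 1 : ℕ) : ℤ)} := by
      ext x; simp; omega
    simp only [ha]
    rw [this]
    exact erasureAvg_union_le h0 h1 _ _ hH.antitone_increment
  have bdd : BddBelow (Set.range a) := by
    refine ⟨0, ?_⟩
    rintro _ ⟨n, rfl⟩
    simp only [ha]
    rw [← erasureAvg_const ε (Finset.Ico (-(n : ℤ)) 0) 0]
    exact erasureAvg_mono h0 h1 fun D _ => hH.increment_nonneg D
  -- The averaged block entropy is a sum of the terms `(1 - ε) a i`, so its mean tends to `(1 - ε) ⨅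
  -- a` by Cesàro. An infimum of a decreasing sequence also gives both one-sided bounds.
  refine ⟨⨅ n, a n, ?_, fun n => ciInf_le bdd n, fun c N h => le_ciInf fun n => ?_⟩
  · have lim := ((tendsto_atTop_ciInf anti bdd).const_mul (1 - ε)).cesaro
    refine lim.congr fun n => ?_
    have : erasureAvg ε (Finset.Ico 0 (n : ℤ)) H = ∑ i ∈ Finset.range n, (1 - ε) * a i := by
      induction n with
      | zero => simp [erasureAvg_empty, hH.empty]
      | succ n ih => rw [hH.erasureAvg_Ico_succ, ih, Finset.sum_range_succ]
    rw [this]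
    ring
  · exact (h _ (le_max_left N n)).trans (anti (le_max_right N n))

/-- Uniform first-order expansion of `(1 - ε) 𝔼 f(D)` over erasure patterns in `[-N, -1]`. -/
lemma exists_abs_erasureAvg_expansion_le (N : ℕ) (M : ℝ) (hM : 0 ≤ M) : ∃ C : ℝ, 0 ≤ C ∧ ∀ (ε : ℝ), 0 ≤ ε → ε ≤ 1 →
    ∀ (f : Finset ℤ → ℝ), (∀ D, |f D| ≤ M) →
    |(1 - ε) * erasureAvg ε (Finset.Ico (-(N : ℤ)) 0) f -
      (f (Finset.Ico (-(N : ℤ)) 0) + ε * (∑ i ∈ Finset.Ico (-(N : ℤ)) 0,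
        f ((Finset.Ico (-(N : ℤ)) 0).erase i) - (N + 1) * f (Finset.Ico (-(N : ℤ)) 0)))| ≤
      C * ε ^ 2 := by
  obtain ⟨C, hC, h⟩ := abs_erasureAvg_sub_firstOrder_le (Finset.Ico (-(N : ℤ)) 0)
  refine ⟨C * M + 2 * N * M, by positivity, fun ε h0 h1 f hf => ?_⟩
  have a1 := h ε h0 h1 f M hf
  set W := Finset.Ico (-(N : ℤ)) 0 with hW
  have hcard : (W.card : ℝ) = N := by simp [hW]
  have a2 : |∑ i ∈ W, (f (W.erase i) - f W)| ≤ 2 * N * M := by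
    refine (Finset.abs_sum_le_sum_abs _ _).trans ?_
    refine (Finset.sum_le_card_nsmul _ _ (2 * M) fun j _ => ?_).trans_eq ?_
    · have := hf (W.erase j); have := hf W
      exact (abs_sub _ _).trans (by linarith)
    · rw [nsmul_eq_mul, hcard]; ring
  have e0 : ∑ i ∈ W, f (W.erase i) = ∑ i ∈ W, (f (W.erase i) - f W) + N * f W := by
    rw [Finset.sum_sub_distrib, Finset.sum_const, nsmul_eq_mul, hcard]; ring
  rw [e0]
  set Q := ∑ i ∈ W, (f (W.erase i) - f W)
  set A := erasureAvg ε W f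
  have e : (1 - ε) * A - (f W + ε * (Q + N * f W - (N + 1) * f W)) =
      (1 - ε) * (A - (f W + ε * Q)) + (-(ε ^ 2) * Q) := by ring
  rw [e]
  refine (abs_add_le _ _).trans ?_
  rw [abs_mul, abs_mul, abs_of_nonneg (by linarith : 0 ≤ 1 - ε), abs_neg,
    abs_of_nonneg (sq_nonneg ε)]
  have b1 : (1 - ε) * |A - (f W + ε * Q)| ≤ 1 * (C * M * ε ^ 2) :=
    mul_le_mul (by linarith) a1 (abs_nonneg _) zero_le_one
  have b3 := mul_le_mul_of_nonneg_left a2 (sq_nonneg ε)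
  nlinarith

/-! ### Entropy functions with finite memory -/

section Markov

variable {m : ℕ} {h : ℝ}

lemma Ico_sub_of_markov (hH : IsStationaryEntropy H M)
    (hm : ∀ k : ℕ, m ≤ k → increment H (Finset.Ico (-(k : ℤ)) 0) = h) {a b : ℤ} (hab : a + m ≤ b)
    (n : ℕ) : H (Finset.Ico a (b + n)) - H (Finset.Ico a b) = n * h := by
  induction n with
  | zero => simp
  | succ n ih =>
    have h1 := hH.Ico_succ_sub (a := a) (b := b + n) (by omega)
    have h2 : a - (b + n) = -(((b + n - a).toNat : ℕ) : ℤ) := by omega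
    rw [h2, hm _ (by omega)] at h1
    push_cast
    rw [← add_assoc]
    linarith

/-- Under the Markov property, the block of `m` symbols before an erased symbol screens off the
earlier past. -/
lemma increment_erase_of_markov (hH : IsStationaryEntropy H M)
    (hm : ∀ k : ℕ, m ≤ k → increment H (Finset.Ico (-(k : ℤ)) 0) = h) {j : ℤ} (hj : j < 0)
    {k : ℕ} (hk : -(k : ℤ) ≤ j - m) :
    increment H ((Finset.Ico (-(k : ℤ)) 0).erase j) =
      increment H (Finset.Ico (j + 1) 0 ∪ Finset.Ico (j - m) j) := by
  -- The block from `j` to `0` has the same conditional entropy, `(1 - j) h`, given the long past as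
  -- given only `m` letters of it.
  have full : H (Finset.Ico (-(k : ℤ)) 1) - H (Finset.Ico (-(k : ℤ)) j) =
      H (Finset.Ico (j - m) 1) - H (Finset.Ico (j - m) j) := by
    have e : (1 : ℤ) = j + ((1 - j).toNat : ℕ) := by omega
    have h1 := hH.Ico_sub_of_markov hm (a := -(k : ℤ)) (b := j) (by omega) (1 - j).toNat
    have h2 := hH.Ico_sub_of_markov hm (a := j - m) (b := j) (by omega) (1 - j).toNat
    rw [← e] at h1 h2
    rw [h1, h2]
  have mono : ∀ C C' : Finset ℤ, C ⊆ C' →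
      H (C' ∪ Finset.Ico (-(k : ℤ)) j) - H (C ∪ Finset.Ico (-(k : ℤ)) j) ≤
      H (C' ∪ Finset.Ico (j - m) j) - H (C ∪ Finset.Ico (j - m) j) := by
    intro C C' hC
    have h1 := hH.submodular (C' ∪ Finset.Ico (j - m) j) (C ∪ Finset.Ico (-(k : ℤ)) j)
    have hs : Finset.Ico (j - m) j ⊆ Finset.Ico (-(k : ℤ)) j := Finset.Ico_subset_Ico_left hk
    have h2 : C' ∪ Finset.Ico (j - m) j ∪ (C ∪ Finset.Ico (-(k : ℤ)) j) =
        C' ∪ Finset.Ico (-(k : ℤ)) j := by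
      ext x
      have := @hC x; have := @hs x
      simp only [Finset.mem_union]; tauto
    have h3 := hH.mono (X := C ∪ Finset.Ico (j - m) j)
      (Y := (C' ∪ Finset.Ico (j - m) j) ∩ (C ∪ Finset.Ico (-(k : ℤ)) j))
      (Finset.subset_inter (Finset.union_subset_union_left hC) (Finset.union_subset_union_right hs))
    rw [h2] at h1
    linarith
  -- Along `∅ ⊆ C ⊆ Ico j 1` both conditional increments can only drop when the past gets longer.
  -- Their sums agree by `full`, so each of them agrees.
  have eq : ∀ C : Finset ℤ, C ⊆ Finset.Ico j 1 →
      H (C ∪ Finset.Ico (-(k : ℤ)) j) - H (Finset.Ico (-(k : ℤ)) j) =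
        H (C ∪ Finset.Ico (j - m) j) - H (Finset.Ico (j - m) j) := by
    intro C hC
    have h1 := mono ∅ C (Finset.empty_subset _)
    have h2 := mono C _ hC
    have u1 : Finset.Ico j 1 ∪ Finset.Ico (-(k : ℤ)) j = Finset.Ico (-(k : ℤ)) 1 := by
      ext x; simp; omega
    have u2 : Finset.Ico j 1 ∪ Finset.Ico (j - m) j = Finset.Ico (j - m) 1 := by
      ext x; simp; omega
    rw [u1, u2] at h2
    simp only [Finset.empty_union] at h1
    linarith
  have e1 := eq (Finset.Ico (j + 1) 0) (fun x => by simp; omega)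
  have e2 := eq (Finset.Ico (j + 1) 1) (fun x => by simp; omega)
  have v1 : (Finset.Ico (-(k : ℤ)) 0).erase j = Finset.Ico (j + 1) 0 ∪ Finset.Ico (-(k : ℤ)) j := by
    ext x; simp; omega
  have v2 : ∀ s : Finset ℤ, insert 0 (Finset.Ico (j + 1) 0 ∪ s) = Finset.Ico (j + 1) 1 ∪ s := by
    intro s; ext x; simp only [Finset.mem_insert, Finset.mem_union, Finset.mem_Ico]
    constructor
    · rintro (h | h | h)
      · left; omega
      · left; omega
      · exact Or.inr h
    · rintro (h | h)
      · by_cases hx : x = 0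
        · exact Or.inl hx
        · right; left; omega
      · exact Or.inr (Or.inr h)
  rw [v1, increment, increment, v2, v2]
  linarith

/-- The last `m` letters are untouched, so the observed set lies between two sets whose increment is
`h`. -/
lemma increment_erase_of_lt (hH : IsStationaryEntropy H M)
    (hm : ∀ k : ℕ, m ≤ k → increment H (Finset.Ico (-(k : ℤ)) 0) = h) {j : ℤ} (hj : j < -(m : ℤ))
    {k : ℕ} (hk : m ≤ k) : increment H ((Finset.Ico (-(k : ℤ)) 0).erase j) = h := by
  refine le_antisymm ?_ ?_
  · rw [← hm m le_rfl]
    refine hH.antitone_increment fun x => ?_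
    simp; omega
  · rw [← hm k hk]
    exact hH.antitone_increment (Finset.erase_subset _ _)

/-- The slope of a Markov entropy function. -/
lemma erasureSlope_of_markov (hH : IsStationaryEntropy H M)
    (hm : ∀ k : ℕ, m ≤ k → increment H (Finset.Ico (-(k : ℤ)) 0) = h) :
    erasureSlope H (2 * m) = -((m + 1) * increment H (Finset.Icc (-(m : ℤ)) (-1)) -
      ∑ i ∈ Finset.Icc 1 m, increment H
        (Finset.Icc (-(i : ℤ) + 1) (-1) ∪ Finset.Icc (-(i : ℤ) - m) (-(i : ℤ) - 1))) := by
  have e0 : Finset.Icc (-(m : ℤ)) (-1) = Finset.Ico (-(m : ℤ)) 0 := by ext x; simp; omega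
  rw [erasureSlope, hm _ (by omega), e0, hm m le_rfl]
  -- The `m` erasures older than `m` each leave the increment `h`. For an erasure at `-i` with `i ≤
  -- m`, the window of length `2m` still contains the `m` letters before it, as screening off
  -- requires. Hence the slope is `m h + ∑ - (2m + 1) h`.
  have split : Finset.Ico (-((2 * m : ℕ) : ℤ)) 0 =
      Finset.Ico (-((2 * m : ℕ) : ℤ)) (-m) ∪ Finset.Ico (-(m : ℤ)) 0 := by ext x; simp; omega
  have disj : Disjoint (Finset.Ico (-((2 * m : ℕ) : ℤ)) (-m)) (Finset.Ico (-(m : ℤ)) 0) :=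
    Finset.Ico_disjoint_Ico_consecutive _ _ _
  have s1 : ∑ i ∈ Finset.Ico (-((2 * m : ℕ) : ℤ)) (-m),
      increment H ((Finset.Ico (-((2 * m : ℕ) : ℤ)) 0).erase i) = m * h := by
    rw [Finset.sum_congr rfl fun j hj => hH.increment_erase_of_lt hm
      (Finset.mem_Ico.1 hj).2 (by omega)]
    rw [Finset.sum_const, nsmul_eq_mul, Int.card_Ico]
    congr 2
    push_cast; omega
  have s2 : ∑ i ∈ Finset.Ico (-(m : ℤ)) 0,
      increment H ((Finset.Ico (-((2 * m : ℕ) : ℤ)) 0).erase i) =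
      ∑ i ∈ Finset.Icc 1 m, increment H
        (Finset.Icc (-(i : ℤ) + 1) (-1) ∪ Finset.Icc (-(i : ℤ) - m) (-(i : ℤ) - 1)) := by
    refine (Finset.sum_bij (fun (i : ℕ) _ => -(i : ℤ)) ?_ ?_ ?_ ?_).symm
    · intro i hi; simp at hi ⊢; omega
    · intro i _ j _ hij; simpa using hij
    · intro j hj
      simp only [Finset.mem_Ico] at hj
      exact ⟨(-j).toNat, by simp; omega, by omega⟩
    · intro i hi
      simp only [Finset.mem_Icc] at hi
      rw [hH.increment_erase_of_markov hm (by omega) (by push_cast; omega)]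
      congr 1
      ext x; simp; omega
  have key : ∑ i ∈ Finset.Ico (-((2 * m : ℕ) : ℤ)) 0,
      increment H ((Finset.Ico (-((2 * m : ℕ) : ℤ)) 0).erase i) = m * h +
      ∑ i ∈ Finset.Icc 1 m, increment H
        (Finset.Icc (-(i : ℤ) + 1) (-1) ∪ Finset.Icc (-(i : ℤ) - m) (-(i : ℤ) - 1)) := by
    rw [← s1, ← s2, ← Finset.sum_union disj, ← split]
  rw [key]
  push_cast
  ring

/-- Never erasing the times `T` older than `2m` lowers the average and leaves only patterns in the
fixed window `W`, so the error constant does not depend on `k`. By the Markov property the presence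
of `T` changes neither the full increment nor any increment with one erasure. -/
lemma le_erasureAvg_of_markov (hH : IsStationaryEntropy H M)
    (hm : ∀ k : ℕ, m ≤ k → increment H (Finset.Ico (-(k : ℤ)) 0) = h) {C ε : ℝ}
    (h0 : 0 ≤ ε) (h1 : ε ≤ 1)
    (hC : ∀ (f : Finset ℤ → ℝ), (∀ D, |f D| ≤ M) →
      |(1 - ε) * erasureAvg ε (Finset.Ico (-((2 * m : ℕ) : ℤ)) 0) f -
        (f (Finset.Ico (-((2 * m : ℕ) : ℤ)) 0) + ε * (∑ i ∈ Finset.Ico (-((2 * m : ℕ) : ℤ)) 0,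
          f ((Finset.Ico (-((2 * m : ℕ) : ℤ)) 0).erase i) -
            ((2 * m : ℕ) + 1) * f (Finset.Ico (-((2 * m : ℕ) : ℤ)) 0)))| ≤ C * ε ^ 2)
    {k : ℕ} (hk : 2 * m ≤ k) :
    h + ε * erasureSlope H (2 * m) - C * ε ^ 2 ≤
      (1 - ε) * erasureAvg ε (Finset.Ico (-(k : ℤ)) 0) (increment H) := by
  set W := Finset.Ico (-((2 * m : ℕ) : ℤ)) 0 with hW
  set T := Finset.Ico (-(k : ℤ)) (-((2 * m : ℕ) : ℤ)) with hT
  have split : Finset.Ico (-(k : ℤ)) 0 = W ∪ T := by ext x; simp [hW, hT]; omega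
  have disj : Disjoint W T := (Finset.Ico_disjoint_Ico_consecutive _ _ _).symm
  have a1 := hC (fun D => increment H (D ∪ T)) fun D => hH.abs_increment_le _
  have a2 := le_erasureAvg_union h0 h1 W T hH.antitone_increment disj
  have e1 : increment H (W ∪ T) = h := by rw [← split, hm k (by omega)]
  have e2 : ∀ i ∈ W, increment H (W.erase i ∪ T) = increment H (W.erase i) := by
    intro i hi
    have e3 : W.erase i ∪ T = (Finset.Ico (-(k : ℤ)) 0).erase i := by
      rw [split]
      have : i ∉ T := Finset.disjoint_left.1 disj hi
      ext x
      simp only [Finset.mem_union, Finset.mem_erase]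
      constructor
      · rintro (hx | hx)
        · exact ⟨hx.1, Or.inl hx.2⟩
        · exact ⟨by rintro rfl; exact this hx, Or.inr hx⟩
      · rintro ⟨hx, hx' | hx'⟩
        · exact Or.inl ⟨hx, hx'⟩
        · exact Or.inr hx'
    rw [e3, hW]
    rw [hW, Finset.mem_Ico] at hi
    by_cases hi' : i < -(m : ℤ)
    · rw [hH.increment_erase_of_lt hm hi' (by omega), hH.increment_erase_of_lt hm hi' (by omega)]
    · rw [hH.increment_erase_of_markov hm hi.2 (by omega),
        hH.increment_erase_of_markov hm hi.2 (by push_cast; omega)]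
  have e4 : increment H W = h := hm _ (by omega)
  rw [Finset.sum_congr rfl e2, e1] at a1
  rw [split, erasureSlope, e4]
  have := (abs_le.1 a1).1
  have := mul_le_mul_of_nonneg_left a2 (by linarith : 0 ≤ 1 - ε)
  linarith

end Markov

end IsStationaryEntropy

/-! ### Mutual information of the erasure channel -/

/-- Entropy as the mean of `-log` of the probability of the observed value, distributed over the
values of `A`. This is the form in which the mutual information appears for a fixed erasure pattern.
-/
lemma entropy_comp_eq_sum {Ω α β : Type*} [MeasurableSpace Ω] {μ : Measure Ω} [IsFiniteMeasure μ]
    [Fintype α] [Fintype β] (A : Ω → α) (f : α → β) (hA : ∀ a, MeasurableSet (A ⁻¹' {a})) :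
    entropy μ (fun x => f (A x)) =
      ∑ a, μ.real (A ⁻¹' {a}) * -Real.log (μ.real ((fun x => f (A x)) ⁻¹' {f a})) := by
  classical
  have hB : ∀ b, MeasurableSet ((fun x => f (A x)) ⁻¹' {b}) := by
    intro b
    have : (fun x => f (A x)) ⁻¹' {b} = ⋃ a ∈ {a | f a = b}, A ⁻¹' {a} := by
      ext x; simp
    rw [this]
    exact MeasurableSet.biUnion (Set.to_countable _) fun a _ => hA a
  have h1 : ∀ a b, μ.real ((fun x => f (A x)) ⁻¹' {b} ∩ A ⁻¹' {a}) =
      if f a = b then μ.real (A ⁻¹' {a}) else 0 := by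
    intro a b
    split_ifs with h
    · congr 1
      ext x
      simp only [Set.mem_inter_iff, Set.mem_preimage, Set.mem_singleton_iff, and_iff_right_iff_imp]
      rintro rfl; exact h
    · have : (fun x => f (A x)) ⁻¹' {b} ∩ A ⁻¹' {a} = ∅ := by
        ext x
        simp only [Set.mem_inter_iff, Set.mem_preimage, Set.mem_singleton_iff,
          Set.mem_empty_iff_false, iff_false, not_and]
        rintro h1 rfl; exact h h1
      simp [this]
  have h2 : ∀ b, Real.negMulLog (μ.real ((fun x => f (A x)) ⁻¹' {b})) =
      ∑ a, if f a = b then μ.real (A ⁻¹' {a}) *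
        -Real.log (μ.real ((fun x => f (A x)) ⁻¹' {b})) else 0 := by
    intro b
    have := measureReal_eq_sum_inter (μ := μ) (hB b) A hA
    simp only [h1] at this
    rw [Real.negMulLog, neg_mul, ← mul_neg]
    nth_rw 1 [this]
    rw [Finset.sum_mul]
    exact Finset.sum_congr rfl fun a _ => by split_ifs <;> simp
  rw [entropy, Finset.sum_congr rfl fun b _ => h2 b, Finset.sum_comm]
  exact Finset.sum_congr rfl fun a _ => by simp

/-- The word `x` with the letters at the positions where `e` is `false` erased. -/
def mask {n : ℕ} (x : Fin n → Fin K) (e : Fin n → Bool) (k : Fin n) : Option (Fin K) :=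
  if e k then some (x k) else none

lemma mask_injective {n : ℕ} (x : Fin n → Fin K) : Function.Injective (mask x) := by
  intro e e' h
  ext k
  have := congrFun h k
  simp only [mask] at this
  cases h1 : e k <;> cases h2 : e' k <;> simp_all

/-- The set of times that are not erased by the pattern `e`. -/
def keptTimes {n : ℕ} (e : Fin n → Bool) : Finset ℤ :=
  (Finset.univ.filter fun k => e k = true).image fun k : Fin n => (k : ℤ)

lemma natCast_fin_injective (n : ℕ) : Function.Injective fun k : Fin n => (k : ℤ) := by
  intro a b h; ext; simpa using h

lemma mask_eq_iff {n : ℕ} (x y : Fin n → Fin K) (e e' : Fin n → Bool) :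
    mask x e = mask y e' ↔ e = e' ∧ ∀ k, e k = true → x k = y k := by
  constructor
  · intro h
    have : e = e' := by
      ext k
      have := congrFun h k
      simp only [mask] at this
      cases h1 : e k <;> cases h2 : e' k <;> simp_all
    subst this
    refine ⟨rfl, fun k hk => ?_⟩
    have := congrFun h k
    simpa [mask, hk] using this
  · rintro ⟨rfl, h⟩
    ext1 k
    simp only [mask]
    split_ifs with hk
    · rw [h k hk]
    · rfl

lemma entropy_mask (μ : Measure (ℤ → Fin K)) {n : ℕ} (e : Fin n → Bool) :
    entropy μ (fun x => mask (fun k : Fin n => x (k : ℤ)) e) = blockEntropy μ (keptTimes e) := by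
  refine entropy_congr fun x y => ?_
  rw [mask_eq_iff, restrict_eq_iff]
  simp [keptTimes]

lemma erasureLaw_real_pattern (ε : I) {n : ℕ} (e : Fin n → Bool) :
    (erasureLaw ε).real {f | ∀ k : Fin n, f (k : ℤ) = e k} =
      (1 - (ε : ℝ)) ^ (keptTimes e).card * (ε : ℝ) ^ (n - (keptTimes e).card) := by
  classical
  -- The product formula wants a set for every time: the singleton `{e k}` at time `k < n`, no
  -- condition elsewhere.
  set t : ℤ → Set Bool := fun i => {b | ∀ k : Fin n, (k : ℤ) = i → b = e k} with ht
  have htk : ∀ k : Fin n, t k = {e k} := by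
    intro k
    ext b
    simp only [ht, Set.mem_ofPred_eq, Set.mem_singleton_iff]
    constructor
    · intro h; exact h k rfl
    · rintro rfl j hj
      rw [natCast_fin_injective n hj]
  have hset : {f : ℤ → Bool | ∀ k : Fin n, f (k : ℤ) = e k} =
      Set.pi ((Finset.univ.image fun k : Fin n => (k : ℤ)) : Finset ℤ) t := by
    ext f
    simp only [Set.mem_ofPred_eq, Set.mem_pi, Finset.mem_coe, Finset.mem_image, Finset.mem_univ,
      true_and, forall_exists_index, forall_apply_eq_imp_iff, htk, Set.mem_singleton_iff]
  have hone : ∀ k : Fin n, (bernoulliMeasure false true ε).real (t k) =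
      if e k then 1 - (ε : ℝ) else ε := by
    intro k
    rw [htk, bernoulliMeasure_real_apply _ (measurableSet_singleton _)]
    cases e k <;> simp
  rw [hset, erasureLaw, measureReal_def, Measure.infinitePi_pi _ (fun _ _ => MeasurableSet.of_discrete),
    ENNReal.toReal_prod, Finset.prod_image fun a _ b _ h => natCast_fin_injective n h]
  simp only [← measureReal_def, hone]
  rw [Finset.prod_ite, Finset.prod_const, Finset.prod_const]
  have hc : (keptTimes e).card = (Finset.univ.filter fun k => e k = true).card :=
    Finset.card_image_of_injective _ (natCast_fin_injective n)
  have hc' : (Finset.univ.filter fun k => ¬ e k = true).card = n - (keptTimes e).card := by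
    rw [hc]
    have := Finset.card_filter_add_card_filter_not (s := (Finset.univ : Finset (Fin n)))
      (fun k => e k = true)
    simp only [Finset.card_univ, Fintype.card_fin] at this
    omega
  rw [hc', hc]

lemma sum_pattern_eq_erasureAvg (ε : ℝ) (n : ℕ) (f : Finset ℤ → ℝ) :
    ∑ e : Fin n → Bool, (1 - ε) ^ (keptTimes e).card * ε ^ (n - (keptTimes e).card) *
      f (keptTimes e) = erasureAvg ε (Finset.Ico 0 (n : ℤ)) f := by
  classical
  rw [erasureAvg]
  refine Finset.sum_bij' (fun e _ => keptTimes e) (fun D _ k => decide ((k : ℤ) ∈ D)) ?_ ?_ ?_ ?_ ?_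
  · intro e _
    rw [Finset.mem_powerset]
    intro x hx
    simp only [keptTimes, Finset.mem_image] at hx
    obtain ⟨k, _, rfl⟩ := hx
    simp
  · intro D _; exact Finset.mem_univ _
  · intro e _
    ext k
    have := (natCast_fin_injective n).mem_finset_image (s := Finset.univ.filter fun k => e k = true)
      (a := k)
    simp [keptTimes, this, -Finset.mem_image]
  · intro D hD
    rw [Finset.mem_powerset] at hD
    ext x
    simp only [keptTimes, Finset.mem_image, Finset.mem_filter, Finset.mem_univ, true_and,
      decide_eq_true_eq]
    constructor
    · rintro ⟨k, hk, rfl⟩; exact hk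
    · intro hx
      have := Finset.mem_Ico.1 (hD hx)
      refine ⟨⟨x.toNat, by omega⟩, ?_, ?_⟩
      · simpa [this.1] using hx
      · simpa using this.1
  · intro e _
    simp

instance (ε : I) : IsProbabilityMeasure (erasureLaw ε) := by
  unfold erasureLaw; infer_instance

/-- If `y` is `x` masked by `e`, then `p(x, y) = p(x) w(e)` and `p(y) = q w(e)`, where `q` is the
probability of the letters kept. The pattern weight cancels inside the logarithm, leaving `-log q`,
whose mean given `e` is the entropy of the surviving letters. -/
lemma mutualInfo_eq_erasureAvg (μ : Measure (ℤ → Fin K)) [IsProbabilityMeasure μ] (ε : I) (n : ℕ) :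
    mutualInfo (μ.prod (erasureLaw ε)) (fun p (k : Fin n) => p.1 (k : ℤ))
      (fun p (k : Fin n) => output p (k : ℤ)) =
    erasureAvg ε (Finset.Ico 0 (n : ℤ)) (blockEntropy μ) := by
  set P := μ.prod (erasureLaw ε) with hP
  set A : (ℤ → Fin K) → Fin n → Fin K := fun x k => x (k : ℤ) with hA
  set Y : (ℤ → Fin K) × (ℤ → Bool) → Fin n → Option (Fin K) := fun p k => output p (k : ℤ) with hY
  set w : (Fin n → Bool) → ℝ := fun e => (erasureLaw ε).real {f | ∀ k : Fin n, f (k : ℤ) = e k}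
    with hw
  have hYmask : ∀ p, Y p = mask (A p.1) (fun k => p.2 (k : ℤ)) := fun p => rfl
  set q : (Fin n → Fin K) → (Fin n → Bool) → ℝ :=
    fun x e => μ.real ((fun x' => mask (A x') e) ⁻¹' {mask x e}) with hq
  have hX : ∀ x, P.real ((fun p (k : Fin n) => p.1 (k : ℤ)) ⁻¹' {x}) = μ.real (A ⁻¹' {x}) := by
    intro x
    have : ((fun p (k : Fin n) => p.1 (k : ℤ)) ⁻¹' {x} : Set ((ℤ → Fin K) × (ℤ → Bool))) =
        (A ⁻¹' {x}) ×ˢ Set.univ := by ext p; simp [hA]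
    rw [this, measureReal_prod_prod]; simp
  have hJ : ∀ x e, P.real ((fun p (k : Fin n) => p.1 (k : ℤ)) ⁻¹' {x} ∩ Y ⁻¹' {mask x e}) =
      μ.real (A ⁻¹' {x}) * w e := by
    intro x e
    have : ((fun p (k : Fin n) => p.1 (k : ℤ)) ⁻¹' {x} ∩ Y ⁻¹' {mask x e} :
        Set ((ℤ → Fin K) × (ℤ → Bool))) =
        (A ⁻¹' {x}) ×ˢ {f | ∀ k : Fin n, f (k : ℤ) = e k} := by
      ext p
      simp only [Set.mem_inter_iff, Set.mem_preimage, Set.mem_singleton_iff, hYmask, mask_eq_iff,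
        Set.mem_prod, Set.mem_ofPred_eq]
      constructor
      · rintro ⟨h1, h2, -⟩; exact ⟨h1, congrFun h2⟩
      · rintro ⟨h1, h2⟩; exact ⟨h1, funext h2, fun k _ => congrFun h1 k⟩
    rw [this, measureReal_prod_prod]
  have hYq : ∀ x e, P.real (Y ⁻¹' {mask x e}) = q x e * w e := by
    intro x e
    have : Y ⁻¹' {mask x e} = ((fun x' => mask (A x') e) ⁻¹' {mask x e}) ×ˢ
        {f | ∀ k : Fin n, f (k : ℤ) = e k} := by
      ext p
      simp only [Set.mem_preimage, Set.mem_singleton_iff, hYmask, mask_eq_iff,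
        Set.mem_prod, Set.mem_ofPred_eq, true_and]
      constructor
      · rintro ⟨h1, h2⟩; exact ⟨fun k hk => h2 k (by rw [congrFun h1, hk]), congrFun h1⟩
      · rintro ⟨h1, h2⟩; exact ⟨funext h2, fun k hk => h1 k (by rw [← h2, hk])⟩
    rw [this, measureReal_prod_prod]
  have hinner : ∀ x, ∑ y, P.real ((fun p (k : Fin n) => p.1 (k : ℤ)) ⁻¹' {x} ∩ Y ⁻¹' {y}) *
      Real.log (P.real ((fun p (k : Fin n) => p.1 (k : ℤ)) ⁻¹' {x} ∩ Y ⁻¹' {y}) /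
        (P.real ((fun p (k : Fin n) => p.1 (k : ℤ)) ⁻¹' {x}) * P.real (Y ⁻¹' {y}))) =
      ∑ e, w e * (μ.real (A ⁻¹' {x}) * -Real.log (q x e)) := by
    intro x
    symm
    -- For fixed `x` only the masks of `x` have positive joint probability, one for each pattern.
    refine Fintype.sum_of_injective (mask x) (mask_injective x) _ _ ?_ ?_
    · intro y hy
      have : ((fun p (k : Fin n) => p.1 (k : ℤ)) ⁻¹' {x} ∩ Y ⁻¹' {y} :
          Set ((ℤ → Fin K) × (ℤ → Bool))) = ∅ := by
        ext p
        simp only [Set.mem_inter_iff, Set.mem_preimage, Set.mem_singleton_iff, hYmask,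
          Set.mem_empty_iff_false, iff_false, not_and]
        rintro rfl rfl
        exact hy ⟨_, rfl⟩
      simp [this]
    · intro e
      rw [hJ, hX, hYq]
      by_cases h1 : μ.real (A ⁻¹' {x}) = 0
      · simp [h1]
      by_cases h2 : w e = 0
      · simp [h2]
      have h3 : q x e ≠ 0 := by
        intro h3
        refine h1 (le_antisymm (h3 ▸ measureReal_mono ?_) measureReal_nonneg)
        rintro y rfl; rfl
      have : μ.real (A ⁻¹' {x}) * w e / (μ.real (A ⁻¹' {x}) * (q x e * w e)) = (q x e)⁻¹ := by
        field_simp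
      rw [this, Real.log_inv]
      ring
  rw [mutualInfo, Finset.sum_congr rfl fun x _ => hinner x, Finset.sum_comm,
    ← sum_pattern_eq_erasureAvg]
  refine Finset.sum_congr rfl fun e _ => ?_
  rw [← Finset.mul_sum, ← erasureLaw_real_pattern, ← entropy_mask]
  congr 1
  exact (entropy_comp_eq_sum A (fun x => mask x e) (measurableSet_restrict_fiber _)).symm

lemma blockEntropy_Ico (μ : Measure (ℤ → Fin K)) (n : ℕ) :
    blockEntropy μ (Finset.Ico 0 (n : ℤ)) = entropy μ (fun x (k : Fin n) => x (k : ℤ)) := by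
  refine entropy_congr fun x y => ?_
  rw [restrict_eq_iff, funext_iff]
  constructor
  · intro h k; exact h _ (by simp)
  · intro h d hd
    rw [Finset.mem_Ico] at hd
    have := h ⟨d.toNat, by omega⟩
    simpa [hd.1] using this

lemma erasureAvg_zero (s : Finset ℤ) (f : Finset ℤ → ℝ) : erasureAvg 0 s f = f s := by
  rw [erasureAvg, Finset.sum_eq_single_of_mem s (Finset.mem_powerset_self s)]
  · simp
  · intro D hD hne
    have := Finset.card_lt_card ((Finset.mem_powerset.1 hD).ssubset_of_ne hne)
    rw [zero_pow (by omega)]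
    simp

/-- The mutual information rate is the limit of the averaged entropy increments. -/
lemma IsStationaryLaw.exists_mutualInfoRate_eq {μ : Measure (ℤ → Fin K)} (h : IsStationaryLaw μ)
    (ε : I) :
    ∃ l : ℝ, mutualInfoRate μ ε = (1 - ε) * l ∧
      (∀ n : ℕ, l ≤ erasureAvg ε (Finset.Ico (-(n : ℤ)) 0) (increment (blockEntropy μ))) ∧
      ∀ (c : ℝ) (N : ℕ), (∀ n : ℕ, N ≤ n →
        c ≤ erasureAvg ε (Finset.Ico (-(n : ℤ)) 0) (increment (blockEntropy μ))) → c ≤ l := by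
  have := h.isProbabilityMeasure
  obtain ⟨l, h1, h2, h3⟩ := h.isStationaryEntropy.exists_tendsto_rate ε.2.1 ε.2.2
  refine ⟨l, ?_, h2, h3⟩
  rw [mutualInfoRate]
  simp only [mutualInfo_eq_erasureAvg]
  exact h1.limUnder_eq

/-- Without erasures every letter is observed, so statements about the entropy rate become the case
`ε = 0` of those about information rates. -/
lemma IsStationaryLaw.entropyRate_eq {μ : Measure (ℤ → Fin K)} (h : IsStationaryLaw μ) :
    entropyRate μ = mutualInfoRate μ 0 := by
  have := h.isProbabilityMeasure
  rw [mutualInfoRate, entropyRate]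
  simp only [mutualInfo_eq_erasureAvg, ← blockEntropy_Ico, Set.Icc.coe_zero, erasureAvg_zero]

/-! ### Words -/

lemma wordAt_succ (x : ℤ → Fin K) (i : ℤ) (l : ℕ) :
    wordAt x i (l + 1) = x i :: wordAt x (i + 1) l := by
  rw [wordAt, wordAt, List.ofFn_succ]
  simp only [Fin.val_zero, Nat.cast_zero, add_zero, Fin.val_succ, Nat.cast_add, Nat.cast_one,
    add_comm, add_left_comm]

lemma wordAt_succ_last (x : ℤ → Fin K) (i : ℤ) (l : ℕ) :
    wordAt x i (l + 1) = wordAt x i l ++ [x (i + l)] := by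
  rw [wordAt, List.ofFn_succ', List.concat_eq_append]
  simp [wordAt]

lemma length_wordAt (x : ℤ → Fin K) (i : ℤ) (l : ℕ) : (wordAt x i l).length = l := by
  simp [wordAt]

/-- The event that the word `w` occurs at time `i`. -/
def wordEvent (i : ℤ) (w : List (Fin K)) : Set (ℤ → Fin K) := {x | wordAt x i w.length = w}

lemma mem_wordEvent {i : ℤ} {w : List (Fin K)} {x : ℤ → Fin K} :
    x ∈ wordEvent i w ↔ wordAt x i w.length = w := Iff.rfl

lemma mem_wordEvent_cons {i : ℤ} {a : Fin K} {w : List (Fin K)} {x : ℤ → Fin K} :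
    x ∈ wordEvent i (a :: w) ↔ x i = a ∧ x ∈ wordEvent (i + 1) w := by
  rw [mem_wordEvent, List.length_cons, wordAt_succ, List.cons.injEq, mem_wordEvent]

lemma mem_wordEvent_concat {i : ℤ} {b : Fin K} {w : List (Fin K)} {x : ℤ → Fin K} :
    x ∈ wordEvent i (w ++ [b]) ↔ x ∈ wordEvent i w ∧ x (i + w.length) = b := by
  rw [mem_wordEvent, List.length_append, List.length_singleton, wordAt_succ_last, mem_wordEvent,
    List.append_singleton_inj]

lemma measurableSet_wordEvent (i : ℤ) (w : List (Fin K)) : MeasurableSet (wordEvent i w) := by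
  induction w generalizing i with
  | nil =>
    convert MeasurableSet.univ
    ext x; simp [wordEvent, wordAt]
  | cons a w ih =>
    have : wordEvent i (a :: w) = (fun x : ℤ → Fin K => x i) ⁻¹' {a} ∩ wordEvent (i + 1) w := by
      ext x; exact mem_wordEvent_cons
    rw [this]
    exact (measurable_pi_apply i (measurableSet_singleton a)).inter (ih _)

lemma measurableSet_coord (i : ℤ) (a : Fin K) :
    MeasurableSet ((fun x : ℤ → Fin K => x i) ⁻¹' {a}) :=
  measurable_pi_apply i (measurableSet_singleton a)

/-! ### Marginalisation of word probabilities -/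

section Marginals

variable (μ : Measure (ℤ → Fin K)) [IsFiniteMeasure μ]

lemma measureReal_wordEvent_eq_sum_concat (i : ℤ) (w : List (Fin K)) :
    μ.real (wordEvent i w) = ∑ b, μ.real (wordEvent i (w ++ [b])) := by
  rw [measureReal_eq_sum_inter (measurableSet_wordEvent i w) (fun x => x (i + w.length))
    (measurableSet_coord _)]
  refine Finset.sum_congr rfl fun b _ => congrArg _ ?_
  ext x; exact mem_wordEvent_concat.symm

lemma measureReal_wordEvent_eq_sum_cons (i : ℤ) (w : List (Fin K)) :
    μ.real (wordEvent (i + 1) w) = ∑ a, μ.real (wordEvent i (a :: w)) := by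
  rw [measureReal_eq_sum_inter (measurableSet_wordEvent _ w) (fun x => x i)
    (measurableSet_coord _)]
  refine Finset.sum_congr rfl fun b _ => congrArg _ ?_
  ext x; exact (mem_wordEvent_cons.trans and_comm).symm

end Marginals

/-- The sum of `f` over all words of length `n`. -/
noncomputable def wordSum (n : ℕ) (f : List (Fin K) → ℝ) : ℝ :=
  ∑ z : Fin n → Fin K, f (List.ofFn z)

lemma wordSum_zero (f : List (Fin K) → ℝ) : wordSum 0 f = f [] := by
  simp [wordSum]

lemma wordSum_succ (n : ℕ) (f : List (Fin K) → ℝ) :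
    wordSum (n + 1) f = ∑ a, wordSum n (fun w => f (a :: w)) := by
  rw [wordSum, ← (Fin.consEquiv fun _ => Fin K).sum_comp, Fintype.sum_prod_type]
  simp [wordSum, Fin.consEquiv, List.ofFn_succ]

lemma wordSum_succ_last (n : ℕ) (f : List (Fin K) → ℝ) :
    wordSum (n + 1) f = wordSum n (fun w => ∑ b, f (w ++ [b])) := by
  rw [wordSum, ← (Fin.snocEquiv fun _ => Fin K).sum_comp, Fintype.sum_prod_type, Finset.sum_comm]
  simp only [wordSum, Fin.snocEquiv, Equiv.coe_fn_mk, List.ofFn_succ', Fin.snoc_castSucc,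
    Fin.snoc_last, List.concat_eq_append]

lemma wordSum_succ' (n : ℕ) (f : List (Fin K) → ℝ) :
    wordSum (n + 1) f = wordSum n (fun w => ∑ a, f (a :: w)) := by
  rw [wordSum_succ]; exact Finset.sum_comm

lemma exists_ofFn_eq {n : ℕ} {w : List (Fin K)} (h : w.length = n) :
    ∃ z : Fin n → Fin K, List.ofFn z = w := by
  subst h; exact ⟨w.get, List.ofFn_get w⟩

lemma wordSum_congr {n : ℕ} {f g : List (Fin K) → ℝ} (h : ∀ w, w.length = n → f w = g w) :
    wordSum n f = wordSum n g :=
  Finset.sum_congr rfl fun z _ => h _ (by simp)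

lemma le_wordSum {n : ℕ} {f : List (Fin K) → ℝ} (h : ∀ w, w.length = n → 0 ≤ f w)
    {w : List (Fin K)} (hw : w.length = n) : f w ≤ wordSum n f := by
  obtain ⟨z, rfl⟩ := exists_ofFn_eq hw
  exact Finset.single_le_sum (f := fun z : Fin n → Fin K => f (List.ofFn z))
    (fun z _ => h _ (by simp)) (Finset.mem_univ z)

/-- The probability that the word `w` occurs at time `0`. -/
noncomputable def wordProb (μ : Measure (ℤ → Fin K)) (w : List (Fin K)) : ℝ :=
  μ.real (wordEvent 0 w)

lemma wordProb_nonneg (μ : Measure (ℤ → Fin K)) (w : List (Fin K)) : 0 ≤ wordProb μ w :=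
  measureReal_nonneg

lemma shift_mem_wordEvent {i : ℤ} {w : List (Fin K)} {x : ℤ → Fin K} :
    shift x ∈ wordEvent i w ↔ x ∈ wordEvent (i + 1) w := by
  simp only [mem_wordEvent, wordAt, shift]
  simp only [add_right_comm]

namespace IsStationaryLaw

variable {μ : Measure (ℤ → Fin K)}

lemma measureReal_wordEvent_succ (h : IsStationaryLaw μ) (i : ℤ) (w : List (Fin K)) :
    μ.real (wordEvent (i + 1) w) = μ.real (wordEvent i w) := by
  rw [← h.measurePreserving.measureReal_preimage (measurableSet_wordEvent i w).nullMeasurableSet]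
  congr 1
  ext x; exact shift_mem_wordEvent.symm

lemma measureReal_wordEvent (h : IsStationaryLaw μ) (i : ℤ) (w : List (Fin K)) :
    μ.real (wordEvent i w) = wordProb μ w := by
  induction i using Int.induction_on with
  | zero => rfl
  | succ i ih => rw [h.measureReal_wordEvent_succ, ih]
  | pred i ih =>
    rw [← ih, ← h.measureReal_wordEvent_succ, sub_add_cancel]

lemma sum_wordProb_concat (h : IsStationaryLaw μ) (w : List (Fin K)) : ∑ b, wordProb μ (w ++ [b]) = wordProb μ w := by
  have := h.isProbabilityMeasure
  exact (measureReal_wordEvent_eq_sum_concat μ 0 w).symm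

lemma sum_wordProb_cons (h : IsStationaryLaw μ) (w : List (Fin K)) : ∑ a, wordProb μ (a :: w) = wordProb μ w := by
  have := h.isProbabilityMeasure
  rw [← h.measureReal_wordEvent (0 + 1)]
  exact (measureReal_wordEvent_eq_sum_cons μ 0 w).symm

lemma wordProb_nil (h : IsStationaryLaw μ) : wordProb μ [] = 1 := by
  have := h.isProbabilityMeasure
  have : wordEvent 0 ([] : List (Fin K)) = Set.univ := by ext x; simp [wordEvent, wordAt]
  rw [wordProb, this]; simp

lemma wordSum_wordProb (h : IsStationaryLaw μ) (n : ℕ) : wordSum n (wordProb μ) = 1 := by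
  induction n with
  | zero => rw [wordSum_zero, h.wordProb_nil]
  | succ n ih => rw [wordSum_succ_last, ← ih]; exact wordSum_congr fun w _ => h.sum_wordProb_concat w

lemma mem_allowedWords (h : IsStationaryLaw μ) {w : List (Fin K)} : w ∈ allowedWords μ ↔ 0 < wordProb μ w := by
  have := h.isProbabilityMeasure
  have key : ∀ i, 0 < μ {x | wordAt x i w.length = w} ↔ 0 < wordProb μ w := by
    intro i
    rw [← h.measureReal_wordEvent i w, measureReal_def, ENNReal.toReal_pos_iff]
    exact ⟨fun h => ⟨h, measure_lt_top _ _⟩, fun h => h.1⟩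
  exact ⟨fun ⟨i, hi⟩ => (key i).1 hi, fun h => ⟨0, (key 0).2 h⟩⟩

lemma wordProb_eq_zero_of_notMem (h : IsStationaryLaw μ) {w : List (Fin K)} (hw : w ∉ allowedWords μ) :
    wordProb μ w = 0 := by
  rw [h.mem_allowedWords, not_lt] at hw
  exact le_antisymm hw (wordProb_nonneg μ w)

lemma increment_Ico (h : IsStationaryLaw μ) (n : ℕ) : increment (blockEntropy μ) (Finset.Ico (-(n : ℤ)) 0) =
    wordSum (n + 1) (fun w => Real.negMulLog (wordProb μ w)) -
      wordSum n (fun w => Real.negMulLog (wordProb μ w)) := by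
  have hb : ∀ n : ℕ, blockEntropy μ (Finset.Ico 0 (n : ℤ)) =
      wordSum n (fun w => Real.negMulLog (wordProb μ w)) := by
    intro n
    rw [blockEntropy_Ico, entropy, wordSum]
    refine Finset.sum_congr rfl fun z _ => ?_
    congr 2
    ext x
    rw [mem_wordEvent, wordAt, List.length_ofFn]
    simp [List.ofFn_inj]
  rw [← hb, ← hb]
  have := h.isStationaryEntropy.Ico_succ_sub (a := 0) (b := (n : ℤ)) (by omega)
  rw [zero_sub] at this
  rw [← this]
  norm_cast

end IsStationaryLaw

/-- The letters at the times `i, …, i + l - 1`. -/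
def window (i : ℤ) (l : ℕ) (x : ℤ → Fin K) (k : Fin l) : Fin K := x (i + (k : ℤ))

lemma measurable_window (i : ℤ) (l : ℕ) : Measurable (window i l : (ℤ → Fin K) → _) := by
  unfold window; fun_prop

lemma window_preimage_singleton (i : ℤ) {l : ℕ} (z : Fin l → Fin K) :
    window i l ⁻¹' {z} = wordEvent i (List.ofFn z) := by
  ext x
  rw [mem_wordEvent, wordAt, List.length_ofFn]
  simp only [Set.mem_preimage, Set.mem_singleton_iff, List.ofFn_inj]
  rfl

/-- A finite measure on two-sided sequences is determined by the probabilities of long words. -/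
lemma measure_ext_of_wordEvent {μ ν : Measure (ℤ → Fin K)} [IsFiniteMeasure μ] [IsFiniteMeasure ν]
    (m : ℕ) (h : ∀ i w, m ≤ w.length → μ (wordEvent i w) = ν (wordEvent i w)) : μ = ν := by
  have hw : ∀ i l, m ≤ l → μ.map (window i l) = ν.map (window i l) := by
    intro i l hl
    refine Measure.ext_of_singleton fun z => ?_
    rw [Measure.map_apply (measurable_window i l) (measurableSet_singleton z),
      Measure.map_apply (measurable_window i l) (measurableSet_singleton z),
      window_preimage_singleton]
    exact h _ _ (by simpa using hl)
  have hJ : ∀ J : Finset ℤ, μ.map J.restrict = ν.map J.restrict := by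
    intro J
    set R : ℕ := J.sup Int.natAbs + m + 1 with hR
    have hlt : ∀ d ∈ J, -(R : ℤ) ≤ d ∧ d < R := by
      intro d hd
      have := Finset.le_sup (f := Int.natAbs) hd
      omega
    let g : (Fin (2 * R) → Fin K) → (J → Fin K) := fun z d =>
      z ⟨((d : ℤ) + R).toNat, by have := hlt d d.2; omega⟩
    have hg : (J.restrict : (ℤ → Fin K) → _) = g ∘ window (-(R : ℤ)) (2 * R) := by
      ext x d
      have := hlt d d.2
      simp only [Finset.restrict, Function.comp, g, window]
      congr 2
      have : (((((d : ℤ) + R).toNat : ℕ)) : ℤ) = d + R := by omega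
      rw [this]; ring
    rw [hg, ← Measure.map_map (by fun_prop) (measurable_window _ _),
      ← Measure.map_map (by fun_prop) (measurable_window _ _), hw _ _ (by omega)]
  exact IsProjectiveLimit.unique (P := fun J : Finset ℤ => ν.map J.restrict) hJ fun _ => rfl

/-! ### Kolmogorov extension over a finite alphabet -/

lemma isClopen_of_mem_measurableCylinders {ι : Type*} {s : Set (ι → Fin K)}
    (hs : s ∈ measurableCylinders fun _ : ι => Fin K) : IsClopen s := by
  obtain ⟨J, T, -, rfl⟩ := (mem_measurableCylinders s).1 hs
  exact (isClopen_discrete T).preimage (by fun_prop)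

/-- Over a finite alphabet, every projective family of finite measures has a projective limit. -/
lemma exists_isProjectiveLimit {ι : Type*} {P : ∀ J : Finset ι, Measure (J → Fin K)}
    (hP : IsProjectiveMeasureFamily (α := fun _ => Fin K) P) :
    ∃ μ : Measure (ι → Fin K), IsProjectiveLimit (α := fun _ => Fin K) μ P := by
  -- Cylinders are clopen in a compact space, so a countable cover of a cylinder by cylinders has a
  -- finite subcover and finite subadditivity is enough.
  have hsub : (projectiveFamilyContent hP).IsSigmaSubadditive := by
    intro f hf hU
    obtain ⟨t, ht⟩ := (isClopen_of_mem_measurableCylinders hU).isClosed.isCompact.elim_finite_subcover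
      f (fun i => (isClopen_of_mem_measurableCylinders (hf i)).isOpen) subset_rfl
    have hb : ⋃ i ∈ t, f i ∈ measurableCylinders fun _ : ι => Fin K :=
      isSetRing_measurableCylinders.biUnion_mem t fun i _ => hf i
    calc projectiveFamilyContent hP (⋃ i, f i)
        ≤ projectiveFamilyContent hP (⋃ i ∈ t, f i) := projectiveFamilyContent_mono hP hU hb ht
      _ ≤ ∑ i ∈ t, projectiveFamilyContent hP (f i) :=
        addContent_biUnion_le isSetRing_measurableCylinders fun i _ => hf i
      _ ≤ ∑' i, projectiveFamilyContent hP (f i) := ENNReal.sum_le_tsum _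
  refine ⟨(projectiveFamilyContent hP).measure isSetSemiring_measurableCylinders
    generateFrom_measurableCylinders.ge hsub, fun J => ?_⟩
  ext s hs
  rw [Measure.map_apply (Finset.measurable_restrict J) hs, AddContent.measure_eq, ← cylinder,
    projectiveFamilyContent_cylinder hP hs]
  · exact generateFrom_measurableCylinders.symm
  · exact cylinder_mem_measurableCylinders _ _ hs

/-- The sequence that reads `w` from time `-R` on. -/
def place [NeZero K] (R : ℕ) (w : List (Fin K)) (i : ℤ) : Fin K := w.getD (i + R).toNat 0

lemma place_succ [NeZero K] {R : ℕ} {w : List (Fin K)} (hw : w.length = 2 * R) (a b : Fin K)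
    {i : ℤ} (h1 : -(R : ℤ) ≤ i) (h2 : i < R) :
    place (R + 1) (a :: (w ++ [b])) i = place R w i := by
  have : (i + (R + 1 : ℕ)).toNat = (i + R).toNat + 1 := by omega
  rw [place, place, this, List.getD_cons_succ, List.getD_append]
  omega

/-- The law of a random word placed at `[-R, R)`. -/
noncomputable def placedLaw [NeZero K] (P : List (Fin K) → ℝ) (R : ℕ) : Measure (ℤ → Fin K) :=
  ∑ z : Fin (2 * R) → Fin K, ENNReal.ofReal (P (List.ofFn z)) • Measure.dirac (place R (List.ofFn z))

/-- A family of word probabilities that is consistent under both one-sided extensions, for words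
of length at least `m`. -/
structure IsConsistent (m : ℕ) (P : List (Fin K) → ℝ) : Prop where
  nonneg : ∀ w, 0 ≤ P w
  sum_concat : ∀ w, m ≤ w.length → ∑ b, P (w ++ [b]) = P w
  sum_cons : ∀ w, m ≤ w.length → ∑ a, P (a :: w) = P w
  wordSum_eq_one : wordSum m P = 1

namespace IsConsistent

variable {m : ℕ} {P : List (Fin K) → ℝ}

lemma wordSum_of_le (hP : IsConsistent m P) {n : ℕ} (hn : m ≤ n) : wordSum n P = 1 := by
  induction n, hn using Nat.le_induction with
  | base => exact hP.wordSum_eq_one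
  | succ n hn ih =>
    rw [wordSum_succ_last, ← ih]
    exact wordSum_congr fun w hw => hP.sum_concat w (by omega)

lemma placedLaw_apply [NeZero K] (hP : IsConsistent m P) (R : ℕ) {s : Set (ℤ → Fin K)}
    (hs : MeasurableSet s) :
    placedLaw P R s = ENNReal.ofReal (wordSum (2 * R) fun w =>
      P w * s.indicator 1 (place R w)) := by
  rw [placedLaw, Measure.coe_finsetSum, Finset.sum_apply, wordSum,
    ENNReal.ofReal_sum_of_nonneg]
  · refine Finset.sum_congr rfl fun z _ => ?_
    rw [Measure.smul_apply, Measure.dirac_apply' _ hs, smul_eq_mul,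
      ENNReal.ofReal_mul (hP.nonneg _)]
    congr 1
    by_cases h : place R (List.ofFn z) ∈ s <;> simp [h]
  · intro z _
    exact mul_nonneg (hP.nonneg _) (Set.indicator_nonneg (by simp) _)

/-- The larger window has one new letter at each end, invisible to `J`; the two consistency
relations sum them out. -/
lemma placedLaw_succ [NeZero K] (hP : IsConsistent m P) {R : ℕ} (hR : m ≤ 2 * R)
    {J : Finset ℤ} (hJ : ∀ i ∈ J, -(R : ℤ) ≤ i ∧ i < R) {s : Set (J → Fin K)}
    (hs : MeasurableSet s) :
    placedLaw P (R + 1) (J.restrict ⁻¹' s) = placedLaw P R (J.restrict ⁻¹' s) := by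
  have hs' := Finset.measurable_restrict (X := fun _ : ℤ => Fin K) J hs
  rw [hP.placedLaw_apply _ hs', hP.placedLaw_apply _ hs',
    show 2 * (R + 1) = 2 * R + 1 + 1 by ring, wordSum_succ', wordSum_succ_last]
  congr 1
  have e : ∀ w : List (Fin K), w.length = 2 * R → ∀ a b,
      (J.restrict ⁻¹' s).indicator (1 : (ℤ → Fin K) → ℝ) (place (R + 1) (a :: (w ++ [b]))) =
      (J.restrict ⁻¹' s).indicator 1 (place R w) := by
    intro w hw a b
    have : J.restrict (place (R + 1) (a :: (w ++ [b]))) = J.restrict (place R w) := by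
      ext1 d
      exact place_succ hw a b (hJ d d.2).1 (hJ d d.2).2
    have hm : place (R + 1) (a :: (w ++ [b])) ∈ J.restrict ⁻¹' s ↔ place R w ∈ J.restrict ⁻¹' s := by
      rw [Set.mem_preimage, Set.mem_preimage, this]
    by_cases h : place R w ∈ J.restrict ⁻¹' s
    · rw [Set.indicator_of_mem h, Set.indicator_of_mem (hm.2 h), Pi.one_apply, Pi.one_apply]
    · rw [Set.indicator_of_notMem h, Set.indicator_of_notMem (mt hm.1 h)]
  refine wordSum_congr fun w hw => ?_
  simp only [e w hw, ← Finset.sum_mul]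
  congr 1
  rw [← hP.sum_concat w (by omega)]
  exact Finset.sum_congr rfl fun b _ => hP.sum_cons _ (by simp; omega)

lemma placedLaw_map_restrict [NeZero K] (hP : IsConsistent m P) {R R' : ℕ} (hR : m ≤ 2 * R)
    (hRR : R ≤ R') {J : Finset ℤ} (hJ : ∀ i ∈ J, -(R : ℤ) ≤ i ∧ i < R) :
    (placedLaw P R').map J.restrict = (placedLaw P R).map J.restrict := by
  induction R', hRR using Nat.le_induction with
  | base => rfl
  | succ R' h ih =>
    rw [← ih]
    ext s hs
    rw [Measure.map_apply (Finset.measurable_restrict J) hs,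
      Measure.map_apply (Finset.measurable_restrict J) hs]
    exact hP.placedLaw_succ (by omega) (fun i hi => by have := hJ i hi; omega) hs

/-- A consistent family of word probabilities is realized by a law on two-sided sequences. -/
lemma exists_measure [NeZero K] (hP : IsConsistent m P) :
    ∃ μ : Measure (ℤ → Fin K), IsProbabilityMeasure μ ∧
      ∀ i w, m ≤ w.length → μ.real (wordEvent i w) = P w := by
  let rad : Finset ℤ → ℕ := fun J => J.sup Int.natAbs + m + 1
  have hrad : ∀ J : Finset ℤ, ∀ i ∈ J, -(rad J : ℤ) ≤ i ∧ i < rad J := by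
    intro J i hi
    have := Finset.le_sup (f := Int.natAbs) hi
    simp only [rad]
    omega
  have hproj : IsProjectiveMeasureFamily (α := fun _ => Fin K)
      fun J : Finset ℤ => (placedLaw P (rad J)).map J.restrict := by
    intro J J' hJ
    rw [Measure.map_map (Finset.measurable_restrict₂ hJ) (Finset.measurable_restrict J),
      Finset.restrict₂_comp_restrict]
    refine (hP.placedLaw_map_restrict (by simp only [rad]; omega) ?_ (hrad J')).symm
    have := Finset.sup_mono (f := Int.natAbs) hJ
    simp only [rad]
    omega
  obtain ⟨μ, hμ⟩ := exists_isProjectiveLimit hproj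
  have huniv : ∀ R, m ≤ 2 * R → placedLaw P R Set.univ = 1 := by
    intro R hR
    rw [hP.placedLaw_apply R MeasurableSet.univ]
    simp [hP.wordSum_of_le hR]
  have hprob : IsProbabilityMeasure μ := by
    constructor
    have := congrArg (fun ν => ν Set.univ) (hμ ∅)
    simp only at this
    rw [Measure.map_apply (Finset.measurable_restrict ∅) MeasurableSet.univ,
      Measure.map_apply (Finset.measurable_restrict ∅) MeasurableSet.univ, Set.preimage_univ,
      huniv _ (by simp only [rad]; omega)] at this
    exact this
  refine ⟨μ, hprob, ?_⟩
  have hwin : ∀ (R : ℕ) (w : List (Fin K)), m ≤ 2 * R → w.length = 2 * R →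
      μ.real (wordEvent (-(R : ℤ)) w) = P w := by
    intro R w hR hw
    set J : Finset ℤ := Finset.Ico (-(R : ℤ)) R with hJ
    have hpw : ∀ v : List (Fin K), v.length = 2 * R →
        (place R v ∈ wordEvent (-(R : ℤ)) w ↔ v = w) := by
      intro v hv
      have : wordAt (place R v) (-(R : ℤ)) w.length = v := by
        refine List.ext_getElem (by simp [length_wordAt, hv, hw]) fun k h1 h2 => ?_
        simp [wordAt, place, List.getElem?_eq_getElem h2]
      rw [mem_wordEvent, this]
    have hpre : wordEvent (-(R : ℤ)) w = J.restrict ⁻¹' (J.restrict '' wordEvent (-(R : ℤ)) w) := by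
      refine (Set.subset_preimage_image _ _).antisymm ?_
      rintro x ⟨y, hy, hxy⟩
      rw [mem_wordEvent] at hy ⊢
      rw [← hy, length_wordAt, wordAt, wordAt]
      congr 1
      ext1 k
      have hk := k.2
      have := congrFun hxy ⟨-(R : ℤ) + k, by simp [hJ]; omega⟩
      exact this.symm
    have h1 := congrArg (fun ν => ν (J.restrict '' wordEvent (-(R : ℤ)) w)) (hμ J)
    simp only at h1
    have hms : MeasurableSet (J.restrict '' wordEvent (-(R : ℤ)) w) :=
      (Set.toFinite _).measurableSet
    have h2 : (placedLaw P (rad J)).map J.restrict = (placedLaw P R).map J.restrict := by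
      have hin : ∀ i ∈ J, -(R : ℤ) ≤ i ∧ i < R := fun i hi => Finset.mem_Ico.1 hi
      rcases le_total R (rad J) with h | h
      · exact hP.placedLaw_map_restrict hR h hin
      · exact (hP.placedLaw_map_restrict (by simp only [rad]; omega) h (hrad J)).symm
    rw [h2, Measure.map_apply (Finset.measurable_restrict J) hms,
      Measure.map_apply (Finset.measurable_restrict J) hms, ← hpre,
      hP.placedLaw_apply R (measurableSet_wordEvent _ _)] at h1
    rw [measureReal_def, h1, ENNReal.toReal_ofReal]
    · obtain ⟨z, rfl⟩ := exists_ofFn_eq hw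
      rw [wordSum, Finset.sum_eq_single z]
      · rw [Set.indicator_of_mem ((hpw _ hw).2 rfl)]; simp
      · intro y _ hy
        rw [Set.indicator_of_notMem]
        · simp
        · rw [hpw _ (by simp)]
          exact fun h => hy (List.ofFn_injective h)
      · simp
    · exact Finset.sum_nonneg fun z _ =>
        mul_nonneg (hP.nonneg _) (Set.indicator_nonneg (by simp) _)
  -- A word inside `[-R, R)` with `c` free places on its left and `d` on its right is reached from
  -- full windows by summing out one letter at a time. Below, `R = |i| + |w|` makes room for any
  -- word at any time.
  have hdesc : ∀ (c d R : ℕ) (w : List (Fin K)), m ≤ w.length → w.length + c + d = 2 * R →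
      μ.real (wordEvent (-(R : ℤ) + c) w) = P w := by
    intro c
    induction c with
    | zero =>
      intro d
      induction d with
      | zero => intro R w h1 h2; simpa using hwin R w (by omega) (by omega)
      | succ d ih =>
        intro R w h1 h2
        rw [measureReal_wordEvent_eq_sum_concat, ← hP.sum_concat w h1]
        exact Finset.sum_congr rfl fun b _ => ih R _ (by simp; omega) (by simp; omega)
    | succ c ih =>
      intro d R w h1 h2
      push_cast
      rw [← add_assoc, measureReal_wordEvent_eq_sum_cons, ← hP.sum_cons w h1]
      exact Finset.sum_congr rfl fun b _ => ih d R _ (by simp; omega) (by simp; omega)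
  intro i w hw
  have := hdesc (i + (i.natAbs + w.length : ℕ)).toNat
    ((i.natAbs + w.length : ℕ) - i - w.length).toNat (i.natAbs + w.length) w hw (by omega)
  rw [← this]
  congr 2
  omega

end IsConsistent

/-! ### The Perron–Frobenius eigenvector -/

section PerronFrobenius

variable {ι : Type*} [Fintype ι]

/-- Adding the identity makes the entries of the powers nondecreasing in the exponent. Paths of
different lengths then fit one common exponent, and no aperiodicity is needed. -/
lemma exists_one_add_pow_pos [DecidableEq ι] {A : Matrix ι ι ℝ} (hA : ∀ i j, 0 ≤ A i j)
    (hirr : ∀ i j, Relation.ReflTransGen (fun i j => 0 < A i j) i j) :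
    ∃ n : ℕ, ∀ i j, 0 < ((1 + A) ^ n) i j := by
  have hnn : ∀ (n : ℕ) i j, 0 ≤ ((1 + A) ^ n) i j := by
    intro n
    induction n with
    | zero => intro i j; rw [pow_zero, Matrix.one_apply]; split_ifs <;> simp
    | succ n ih =>
      intro i j
      rw [pow_succ, mul_add, mul_one, Matrix.add_apply, Matrix.mul_apply]
      exact add_nonneg (ih i j) (Finset.sum_nonneg fun k _ => mul_nonneg (ih i k) (hA k j))
  have hmono : ∀ (n k : ℕ) i j, ((1 + A) ^ n) i j ≤ ((1 + A) ^ (n + k)) i j := by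
    intro n k i j
    induction k with
    | zero => simp
    | succ k ih =>
      rw [← add_assoc, pow_succ _ (n + k), mul_add, mul_one, Matrix.add_apply, Matrix.mul_apply]
      have := Finset.sum_nonneg fun l (_ : l ∈ Finset.univ) => mul_nonneg (hnn (n + k) i l) (hA l j)
      linarith
  have hex : ∀ i j, ∃ n : ℕ, 0 < ((1 + A) ^ n) i j := by
    intro i j
    induction hirr i j with
    | refl => exact ⟨0, by simp⟩
    | @tail b c _ hbc ih =>
      obtain ⟨n, hn⟩ := ih
      refine ⟨n + 1, ?_⟩
      rw [pow_succ, mul_add, mul_one, Matrix.add_apply, Matrix.mul_apply]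
      have h1 : ((1 + A) ^ n) i b * A b c ≤ ∑ k, ((1 + A) ^ n) i k * A k c :=
        Finset.single_le_sum (f := fun k => ((1 + A) ^ n) i k * A k c)
          (fun k _ => mul_nonneg (hnn n i k) (hA k c)) (Finset.mem_univ b)
      have := mul_pos hn hbc
      have := hnn n i c
      linarith
  choose f hf using hex
  refine ⟨Finset.univ.sup fun p : ι × ι => f p.1 p.2, fun i j => ?_⟩
  have : f i j ≤ Finset.univ.sup fun p : ι × ι => f p.1 p.2 :=
    Finset.le_sup (f := fun p : ι × ι => f p.1 p.2) (Finset.mem_univ (i, j))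
  obtain ⟨k, hk⟩ := Nat.exists_eq_add_of_le this
  rw [hk]
  exact (hf i j).trans_le (hmono _ _ _ _)

/-- **Perron–Frobenius**: an irreducible nonnegative matrix has a positive eigenvector. -/
lemma exists_pos_eigenvector [Nonempty ι] {A : Matrix ι ι ℝ} (hA : ∀ i j, 0 ≤ A i j)
    (hirr : ∀ i j, Relation.ReflTransGen (fun i j => 0 < A i j) i j) :
    ∃ (c : ℝ) (x : ι → ℝ), (∀ i, 0 < x i) ∧ ∀ i, ∑ j, A i j * x j = c * x i := by
  classical
  obtain ⟨n, hn⟩ := exists_one_add_pow_pos hA hirr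
  set B := (1 + A) ^ n with hB
  have hcomm : ∀ y, A.mulVec (B.mulVec y) = B.mulVec (A.mulVec y) := by
    intro y
    rw [Matrix.mulVec_mulVec, Matrix.mulVec_mulVec]
    have : Commute A B := ((Commute.one_right A).add_right (Commute.refl A)).pow_right n
    rw [this.eq]
  have hBpos : ∀ y : ι → ℝ, (∀ i, 0 ≤ y i) → y ≠ 0 → ∀ i, 0 < B.mulVec y i := by
    intro y hy hne i
    obtain ⟨j, hj⟩ := Function.ne_iff.1 hne
    exact Finset.sum_pos' (fun k _ => mul_nonneg (hn i k).le (hy k))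
      ⟨j, Finset.mem_univ j, mul_pos (hn i j) ((hy j).lt_of_ne' hj)⟩
  -- Collatz–Wielandt: maximise `c` subject to `c x ≤ A x` on the simplex. The sum of all entries
  -- bounds every admissible `c`, so capping `c` there makes the set compact without excluding
  -- anything.
  set Z : Set (ℝ × (ι → ℝ)) := (Set.Icc 0 (∑ i, ∑ j, A i j) ×ˢ stdSimplex ℝ ι) ∩
    {p | ∀ i, p.1 * p.2 i ≤ A.mulVec p.2 i} with hZ
  have hZc : IsCompact Z := by
    refine (isCompact_Icc.prod (isCompact_stdSimplex ℝ ι)).inter_right ?_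
    have : {p : ℝ × (ι → ℝ) | ∀ i, p.1 * p.2 i ≤ A.mulVec p.2 i} =
        ⋂ i, {p | p.1 * p.2 i ≤ A.mulVec p.2 i} := by ext; simp
    rw [this]
    refine isClosed_iInter fun i => isClosed_le (by fun_prop) ?_
    simp only [Matrix.mulVec, dotProduct]
    fun_prop
  have hZn : Z.Nonempty := by
    obtain ⟨i₀⟩ := ‹Nonempty ι›
    refine ⟨(0, Pi.single i₀ 1), ⟨⟨le_rfl, Finset.sum_nonneg fun i _ => Finset.sum_nonneg
      fun j _ => hA i j⟩, single_mem_stdSimplex ℝ i₀⟩, fun i => ?_⟩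
    simp only [zero_mul]
    refine Finset.sum_nonneg fun j _ => mul_nonneg (hA i j) ?_
    simp only [Pi.single_apply]; split_ifs <;> simp
  obtain ⟨⟨c, x⟩, hmem, hmax⟩ := hZc.exists_isMaxOn hZn continuous_fst.continuousOn
  obtain ⟨⟨⟨hc0, -⟩, hx⟩, hcx⟩ := hmem
  simp only at hc0 hx hcx
  have hxne : x ≠ 0 := by
    rintro rfl
    simpa using hx.2
  -- If `A x - c x` were nonzero, the positive matrix `B`, which commutes with `A`, would make the
  -- inequality strict in every coordinate at `B x`, leaving room to raise `c` by `δ`.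
  have heig : A.mulVec x = c • x := by
    by_contra hne
    set y := A.mulVec x - c • x with hy
    have hy0 : ∀ i, 0 ≤ y i := fun i => sub_nonneg.2 (hcx i)
    have hyne : y ≠ 0 := sub_ne_zero.2 hne
    set z := B.mulVec x with hz
    have hzpos : ∀ i, 0 < z i := hBpos x hx.1 hxne
    have hBy : ∀ i, A.mulVec z i = c * z i + B.mulVec y i := by
      intro i
      have : A.mulVec z = c • z + B.mulVec y := by
        rw [hz, hcomm, hy, Matrix.mulVec_sub, Matrix.mulVec_smul]; abel
      rw [this]; simp
    have hBypos := hBpos y hy0 hyne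
    obtain ⟨i₀, -, hi₀⟩ := Finset.exists_min_image Finset.univ (fun i => B.mulVec y i / z i)
      Finset.univ_nonempty
    set δ := B.mulVec y i₀ / z i₀ with hδ
    have hδpos : 0 < δ := div_pos (hBypos i₀) (hzpos i₀)
    have hle : ∀ i, (c + δ) * z i ≤ A.mulVec z i := by
      intro i
      rw [hBy, add_mul]
      have := (le_div_iff₀ (hzpos i)).1 (hi₀ i (Finset.mem_univ i))
      linarith
    set s := ∑ i, z i with hs
    have hspos : 0 < s := Finset.sum_pos (fun i _ => hzpos i) Finset.univ_nonempty
    have hsimp : s⁻¹ • z ∈ stdSimplex ℝ ι := by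
      refine ⟨fun i => ?_, ?_⟩
      · have := hzpos i
        simp only [Pi.smul_apply, smul_eq_mul]; positivity
      · simp only [Pi.smul_apply, smul_eq_mul, ← Finset.mul_sum]
        exact inv_mul_cancel₀ hspos.ne'
    have hle' : ∀ i, (c + δ) * (s⁻¹ • z) i ≤ A.mulVec (s⁻¹ • z) i := by
      intro i
      rw [Matrix.mulVec_smul]
      simp only [Pi.smul_apply, smul_eq_mul]
      have := mul_le_mul_of_nonneg_left (hle i) (inv_nonneg.2 hspos.le)
      linarith
    have hbd : c + δ ≤ ∑ i, ∑ j, A i j := by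
      have h1 : c + δ = ∑ i, (c + δ) * (s⁻¹ • z) i := by rw [← Finset.mul_sum, hsimp.2, mul_one]
      rw [h1]
      refine Finset.sum_le_sum fun i _ => (hle' i).trans (Finset.sum_le_sum fun j _ => ?_)
      have h2 : (s⁻¹ • z) j ≤ 1 := by
        rw [← hsimp.2]
        exact Finset.single_le_sum (fun k _ => hsimp.1 k) (Finset.mem_univ j)
      exact mul_le_of_le_one_right (hA i j) h2
    have := hmax (a := (c + δ, s⁻¹ • z)) ⟨⟨⟨by positivity, hbd⟩, hsimp⟩, hle'⟩
    simp only [Set.mem_ofPred_eq] at this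
    linarith
  refine ⟨c, x, fun i => ?_, fun i => congrFun heig i⟩
  -- Positivity of `x`: `B x` is strictly positive and is a multiple of `x`.
  have hpow : ∀ k : ℕ, ((1 + A) ^ k).mulVec x = (1 + c) ^ k • x := by
    intro k
    induction k with
    | zero => simp
    | succ k ih =>
      rw [pow_succ, ← Matrix.mulVec_mulVec, Matrix.add_mulVec, Matrix.one_mulVec, heig,
        Matrix.mulVec_add, Matrix.mulVec_smul, ih, pow_succ]
      ext j; simp; ring
  have h1 := hBpos x hx.1 hxne i
  rw [hB, hpow] at h1
  refine (hx.1 i).lt_of_ne' fun h0 => ?_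
  simp [h0] at h1

end PerronFrobenius

/-! ### Irreducible constraints of finite memory -/

/-- The combinatorial properties of an irreducible finite-type constraint of order at most `m`. -/
structure IsMarkovShift (S : Set (List (Fin K))) (m : ℕ) : Prop where
  mem_of_infix : ∀ {u w}, w ∈ S → u <:+: w → u ∈ S
  glue : ∀ {a b u}, m ≤ u.length → a :: u ∈ S → u ++ [b] ∈ S → a :: (u ++ [b]) ∈ S
  connect : ∀ u ∈ S, ∀ v ∈ S, ∃ w, u ++ w ++ v ∈ S
  exists_ne_nil : ∃ w ∈ S, w ≠ []

/-- A shortest defining set has words of length at most `m + 1`, also when the subtraction in `m` is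
truncated. A forbidden word inside `a u b` with `|u| ≥ m` therefore already lies in `a u` or in `u
b`. -/
lemma isMarkovShift_topologicalOrder {S : Set (List (Fin K))} (hS : IsFiniteType S)
    (hirr : IsIrreducibleConstraint S) (hne : ∃ w ∈ S, w ≠ []) :
    IsMarkovShift S (topologicalOrder S) := by
  have hn : {L | ∃ F : Finset (List (Fin K)), S = constraint F ∧ F.sup List.length = L}.Nonempty := by
    obtain ⟨F, hF⟩ := hS
    exact ⟨_, F, hF, rfl⟩
  obtain ⟨F, hF, hL⟩ := Nat.sInf_mem hn
  have hlen : ∀ f ∈ F, f.length ≤ topologicalOrder S + 1 := by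
    intro f hf
    have := Finset.le_sup (f := List.length) hf
    rw [hL] at this
    rw [topologicalOrder]
    omega
  refine ⟨?_, ?_, fun u hu v hv => ?_, hne⟩
  · intro u w hw huw
    rw [hF] at hw ⊢
    exact fun f hf hfu => hw f hf (hfu.trans huw)
  · intro a b u hu h1 h2
    rw [hF] at h1 h2 ⊢
    intro f hf hfu
    rcases List.infix_cons_iff.1 hfu with h | h
    · refine h1 f hf (List.prefix_of_prefix_length_le h ?_ ?_).isInfix
      · exact ⟨[b], by simp⟩
      · have := hlen f hf
        simp; omega
    · exact h2 f hf h
  · obtain ⟨w, -, h⟩ := hirr u hu v hv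
    exact ⟨w, h⟩

namespace IsMarkovShift

variable {S : Set (List (Fin K))} {m : ℕ}

lemma nil_mem (h : IsMarkovShift S m) : [] ∈ S := by
  obtain ⟨w, hw, -⟩ := h.exists_ne_nil
  exact h.mem_of_infix hw (List.nil_infix)

lemma neZero (h : IsMarkovShift S m) : NeZero K := by
  obtain ⟨w, -, hw⟩ := h.exists_ne_nil
  obtain ⟨a, w, rfl⟩ := List.exists_cons_of_ne_nil hw
  exact ⟨by rintro rfl; exact a.elim0⟩

lemma exists_append_mem (h : IsMarkovShift S m) {w : List (Fin K)} (hw : w ∈ S) (n : ℕ) :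
    ∃ u, w ++ u ∈ S ∧ n ≤ (w ++ u).length := by
  induction n with
  | zero => exact ⟨[], by simpa using hw, by simp⟩
  | succ n ih =>
    obtain ⟨u, hu, hn⟩ := ih
    obtain ⟨v, hv, hne⟩ := h.exists_ne_nil
    obtain ⟨t, ht⟩ := h.connect _ hu v hv
    refine ⟨u ++ t ++ v, by simpa using ht, ?_⟩
    have := List.length_pos_iff.2 hne
    simp only [List.length_append] at hn ⊢
    omega

lemma exists_mem_length (h : IsMarkovShift S m) (n : ℕ) : ∃ w ∈ S, w.length = n := by
  obtain ⟨u, hu, hn⟩ := h.exists_append_mem h.nil_mem n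
  exact ⟨([] ++ u).take n, h.mem_of_infix hu (List.take_prefix _ _).isInfix,
    by rw [List.length_take]; omega⟩

/-- Whether a letter may follow depends on the last `m` letters only: restore the earlier letters
one at a time by `glue`. -/
lemma concat_mem (h : IsMarkovShift S m) {w : List (Fin K)} {b : Fin K} (hw : w ∈ S)
    (hm : m ≤ w.length) (hb : w.drop (w.length - m) ++ [b] ∈ S) : w ++ [b] ∈ S := by
  induction w with
  | nil => simpa using hb
  | cons a w ih =>
    rcases Nat.lt_or_ge w.length m with hlt | hge
    · rw [List.length_cons] at hm hb
      have : w.length + 1 - m = 0 := by omega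
      simpa [this] using hb
    · refine h.glue hge hw (ih (h.mem_of_infix hw (List.suffix_cons a w).isInfix) hge ?_)
      rw [List.length_cons, Nat.sub_add_comm hge, List.drop_succ_cons] at hb
      exact hb

lemma cons_mem (h : IsMarkovShift S m) {w : List (Fin K)} {a : Fin K} (hw : w ∈ S)
    (hm : m ≤ w.length) (ha : a :: w.take m ∈ S) : a :: w ∈ S := by
  induction w using List.reverseRecOn with
  | nil => simpa using ha
  | append_singleton w b ih =>
    rcases Nat.lt_or_ge w.length m with hlt | hge
    · rwa [List.take_of_length_le (by simp; omega)] at ha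
    · refine h.glue hge (ih (h.mem_of_infix hw (List.prefix_append w [b]).isInfix) hge ?_) hw
      rwa [List.take_append_of_le_length hge] at ha

/-- Transitions between words of the same length. -/
def Step (S : Set (List (Fin K))) (u v : List (Fin K)) : Prop :=
  ∃ b, u ++ [b] ∈ S ∧ (u ++ [b]).tail = v

/-- Slide a window of fixed length along an allowed word. -/
lemma reflTransGen_step_drop (h : IsMarkovShift S m) (y : List (Fin K)) {u : List (Fin K)}
    (hu : u ++ y ∈ S) : Relation.ReflTransGen (Step S) u ((u ++ y).drop y.length) := by
  induction y generalizing u with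
  | nil => simpa using Relation.ReflTransGen.refl
  | cons b y ih =>
    have e : u ++ b :: y = (u ++ [b]) ++ y := by simp
    have e' : (u ++ b :: y).tail = (u ++ [b]).tail ++ y := by
      rw [e, List.tail_append_of_ne_nil (by simp)]
    refine Relation.ReflTransGen.head ⟨b, h.mem_of_infix hu ?_, rfl⟩ ?_
    · rw [e]; exact (List.prefix_append _ _).isInfix
    · have := ih (u := (u ++ [b]).tail) (by
        rw [← e']; exact h.mem_of_infix hu (List.tail_suffix _).isInfix)
      have e2 : (u ++ b :: y).tail.drop y.length = (u ++ b :: y).drop (b :: y).length := by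
        rw [← List.drop_one, List.drop_drop, List.length_cons, Nat.add_comm]
      rwa [← e', e2] at this

lemma reflTransGen_step (h : IsMarkovShift S m) {u v : List (Fin K)} (hu : u ∈ S) (hv : v ∈ S)
    (huv : u.length = v.length) : Relation.ReflTransGen (Step S) u v := by
  obtain ⟨w, hw⟩ := h.connect u hu v hv
  have := h.reflTransGen_step_drop (w ++ v) (u := u) (by simpa using hw)
  rwa [← List.append_assoc, List.drop_left' (by simp; omega)] at this

open scoped Classical in
/-- The right and left Perron eigenfunctions of the transition graph on words of length `m`. -/
lemma exists_eigenfunctions (h : IsMarkovShift S m) :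
    ∃ (c : ℝ) (l r : List (Fin K) → ℝ), 0 < c ∧
      (∀ w, 0 ≤ l w ∧ 0 ≤ r w) ∧ (∀ w ∈ S, w.length = m → 0 < l w ∧ 0 < r w) ∧
      (∀ w ∈ S, w.length = m → ∑ b, (if w ++ [b] ∈ S then r (w ++ [b]).tail else 0) = c * r w) ∧
      (∀ w ∈ S, w.length = m → ∑ a, (if a :: w ∈ S then l (a :: w).dropLast else 0) = c * l w) ∧
      wordSum m (fun w => if w ∈ S then l w * r w else 0) = 1 := by
  let ι := {w : List (Fin K) // w ∈ S ∧ w.length = m}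
  have : Finite ι :=
    ((List.finite_length_eq (Fin K) m).subset fun w (hw : w ∈ S ∧ w.length = m) => hw.2).to_subtype
  have : Fintype ι := Fintype.ofFinite ι
  have : Nonempty ι := by
    obtain ⟨w, hw, hl⟩ := h.exists_mem_length m
    exact ⟨⟨w, hw, hl⟩⟩
  -- Entries count allowed words of length `m + 1` from `u` to `v` instead of merely indicating
  -- them. For `m = 0` the only state is the empty word, and its entry must be the number of allowed
  -- letters.
  let A : Matrix ι ι ℝ := fun u v => wordSum (m + 1)
    (fun x => if x ∈ S ∧ x.dropLast = u.1 ∧ x.tail = v.1 then 1 else 0)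
  have hA : ∀ u v, 0 ≤ A u v := fun u v => Finset.sum_nonneg fun z _ => by
    dsimp only; split_ifs <;> simp
  have hApos : ∀ u v : ι, Step S u.1 v.1 → 0 < A u v := by
    rintro u v ⟨b, hb, hv⟩
    have hlen : (u.1 ++ [b]).length = m + 1 := by simp [u.2.2]
    have := le_wordSum (f := fun x => if x ∈ S ∧ x.dropLast = u.1 ∧ x.tail = v.1 then (1 : ℝ) else 0)
      (n := m + 1) (fun w _ => by split_ifs <;> simp) hlen
    rw [if_pos ⟨hb, by simp, hv⟩] at this
    exact one_pos.trans_le this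
  have hpath : ∀ u v : ι, Relation.ReflTransGen (fun u v => 0 < A u v) u v := by
    have key : ∀ x y, Relation.ReflTransGen (Step S) x y → ∀ hx : x ∈ S ∧ x.length = m,
        ∃ hy : y ∈ S ∧ y.length = m,
          Relation.ReflTransGen (fun u v : ι => 0 < A u v) ⟨x, hx⟩ ⟨y, hy⟩ := by
      intro x y hxy hx
      induction hxy with
      | refl => exact ⟨hx, Relation.ReflTransGen.refl⟩
      | @tail y z _ hyz ih =>
        obtain ⟨hy, hp⟩ := ih
        have hz : z ∈ S ∧ z.length = m := by
          obtain ⟨b, hb, rfl⟩ := hyz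
          exact ⟨h.mem_of_infix hb (List.tail_suffix _).isInfix, by simp [hy.2]⟩
        exact ⟨hz, hp.tail (hApos ⟨y, hy⟩ ⟨z, hz⟩ hyz)⟩
    intro u v
    exact (key u.1 v.1 (h.reflTransGen_step u.2.1 v.2.1 (u.2.2.trans v.2.2.symm)) u.2).2
  obtain ⟨c, r, hr, hcr⟩ := exists_pos_eigenvector hA hpath
  obtain ⟨c', l, hl, hcl⟩ := exists_pos_eigenvector (A := A.transpose) (fun u v => hA v u)
    (fun u v => Relation.reflTransGen_swap.1 (hpath v u))
  let R : List (Fin K) → ℝ := fun w => if hw : w ∈ S ∧ w.length = m then r ⟨w, hw⟩ else 0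
  let L : List (Fin K) → ℝ := fun w => if hw : w ∈ S ∧ w.length = m then l ⟨w, hw⟩ else 0
  have hR : ∀ u : ι, R u.1 = r u := fun u => dif_pos u.2
  have hL : ∀ u : ι, L u.1 = l u := fun u => dif_pos u.2
  have hsum : ∀ (f : ι → ℝ) (x : List (Fin K)) (hx : x ∈ S ∧ x.length = m),
      ∑ v : ι, (if x = v.1 then f v else 0) = f ⟨x, hx⟩ := by
    intro f x hx
    rw [Finset.sum_eq_single (⟨x, hx⟩ : ι)]
    · simp
    · intro v _ hv
      rw [if_neg]
      rintro rfl
      exact hv rfl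
    · simp
  have hwsum : ∀ (f : List (Fin K) → ℝ) (x : List (Fin K)), x.length = m →
      wordSum m (fun w => if w = x then f w else 0) = f x := by
    intro f x hx
    obtain ⟨z, rfl⟩ := exists_ofFn_eq hx
    rw [wordSum, Finset.sum_eq_single z]
    · simp
    · intro y _ hy
      rw [if_neg fun hh => hy (List.ofFn_injective hh)]
    · simp
  have hRe : ∀ w ∈ S, w.length = m →
      ∑ b, (if w ++ [b] ∈ S then R (w ++ [b]).tail else 0) = c * R w := by
    intro w hw hlen
    have h1 := hcr ⟨w, hw, hlen⟩
    rw [← hR] at h1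
    rw [← h1]
    simp only [A, wordSum, Finset.sum_mul]
    rw [Finset.sum_comm]
    have h2 : ∀ z : Fin (m + 1) → Fin K, ∑ v : ι, (if List.ofFn z ∈ S ∧
        (List.ofFn z).dropLast = w ∧ (List.ofFn z).tail = v.1 then (1 : ℝ) else 0) * r v =
        if List.ofFn z ∈ S ∧ (List.ofFn z).dropLast = w then R (List.ofFn z).tail else 0 := by
      intro z
      by_cases hz : List.ofFn z ∈ S ∧ (List.ofFn z).dropLast = w
      · have ht : (List.ofFn z).tail ∈ S ∧ (List.ofFn z).tail.length = m :=
          ⟨h.mem_of_infix hz.1 (List.tail_suffix _).isInfix, by simp⟩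
        rw [if_pos hz]
        simp only [hz.1, hz.2, true_and, ite_mul, one_mul, zero_mul]
        rw [hsum _ _ ht, ← hR]
      · rw [if_neg hz]
        refine Finset.sum_eq_zero fun v _ => ?_
        rw [if_neg fun hh => hz ⟨hh.1, hh.2.1⟩, zero_mul]
    rw [Finset.sum_congr rfl fun z _ => h2 z]
    have h3 := wordSum_succ_last m (fun x : List (Fin K) =>
      if x ∈ S ∧ x.dropLast = w then R x.tail else 0)
    rw [wordSum] at h3
    rw [h3]
    refine (hwsum (fun w => ∑ b, if w ++ [b] ∈ S then R (w ++ [b]).tail else 0) w hlen).symm.trans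
      (wordSum_congr fun x _ => ?_)
    simp only [List.dropLast_concat]
    split_ifs with hx
    · simp [hx]
    · simp [hx]
  have hLe : ∀ w ∈ S, w.length = m →
      ∑ a, (if a :: w ∈ S then L (a :: w).dropLast else 0) = c' * L w := by
    intro w hw hlen
    have h1 : ∑ j, A j ⟨w, hw, hlen⟩ * l j = c' * l ⟨w, hw, hlen⟩ := hcl ⟨w, hw, hlen⟩
    rw [← hL] at h1
    rw [← h1]
    simp only [A, wordSum, Finset.sum_mul]
    rw [Finset.sum_comm]
    have h2 : ∀ z : Fin (m + 1) → Fin K, ∑ v : ι, (if List.ofFn z ∈ S ∧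
        (List.ofFn z).dropLast = v.1 ∧ (List.ofFn z).tail = w then (1 : ℝ) else 0) * l v =
        if List.ofFn z ∈ S ∧ (List.ofFn z).tail = w then L (List.ofFn z).dropLast else 0 := by
      intro z
      by_cases hz : List.ofFn z ∈ S ∧ (List.ofFn z).tail = w
      · have ht : (List.ofFn z).dropLast ∈ S ∧ (List.ofFn z).dropLast.length = m :=
          ⟨h.mem_of_infix hz.1 (List.dropLast_prefix _).isInfix, by simp⟩
        rw [if_pos hz]
        simp only [hz.1, hz.2, true_and, and_true, ite_mul, one_mul, zero_mul]
        rw [hsum _ _ ht, ← hL]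
      · rw [if_neg hz]
        refine Finset.sum_eq_zero fun v _ => ?_
        rw [if_neg fun hh => hz ⟨hh.1, hh.2.2⟩, zero_mul]
    rw [Finset.sum_congr rfl fun z _ => h2 z]
    have h3 := wordSum_succ' m (fun x : List (Fin K) =>
      if x ∈ S ∧ x.tail = w then L x.dropLast else 0)
    rw [wordSum] at h3
    rw [h3]
    refine (hwsum (fun w => ∑ a, if a :: w ∈ S then L (a :: w).dropLast else 0) w hlen).symm.trans
      (wordSum_congr fun x _ => ?_)
    simp only [List.tail_cons]
    split_ifs with hx
    · simp [hx]
    · simp [hx]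
  have hRpos : ∀ w ∈ S, w.length = m → 0 < R w := fun w hw hlen => by
    rw [hR ⟨w, hw, hlen⟩]; exact hr _
  have hLpos : ∀ w ∈ S, w.length = m → 0 < L w := fun w hw hlen => by
    rw [hL ⟨w, hw, hlen⟩]; exact hl _
  set s := wordSum m (fun w => if w ∈ S then L w * R w else 0) with hs
  have hspos : 0 < s := by
    obtain ⟨w, hw, hlen⟩ := h.exists_mem_length m
    have := le_wordSum (f := fun w => if w ∈ S then L w * R w else 0) (n := m) (fun v hv => by
      split_ifs with hvS
      · exact (mul_pos (hLpos v hvS hv) (hRpos v hvS hv)).le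
      · exact le_rfl) hlen
    rw [if_pos hw] at this
    exact (mul_pos (hLpos w hw hlen) (hRpos w hw hlen)).trans_le this
  -- Left and right eigenvalues agree: both times `s` compute the sum of `L x.dropLast * R x.tail`
  -- over allowed words `x` of length `m + 1`, and `s > 0`.
  have hcc : c = c' := by
    have h1 : wordSum (m + 1) (fun x => if x ∈ S then L x.dropLast * R x.tail else 0) = c * s := by
      rw [wordSum_succ_last, hs, wordSum, wordSum, Finset.mul_sum]
      refine Finset.sum_congr rfl fun z _ => ?_
      have hlen : (List.ofFn z).length = m := by simp
      generalize List.ofFn z = w at hlen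
      simp only [List.dropLast_concat]
      split_ifs with hw
      · rw [mul_left_comm, ← hRe w hw hlen, Finset.mul_sum]
        exact Finset.sum_congr rfl fun b _ => by split_ifs <;> simp
      · rw [mul_zero]
        refine Finset.sum_eq_zero fun b _ => if_neg fun hb => hw ?_
        exact h.mem_of_infix hb (List.prefix_append _ _).isInfix
    have h2 : wordSum (m + 1) (fun x => if x ∈ S then L x.dropLast * R x.tail else 0) = c' * s := by
      rw [wordSum_succ', hs, wordSum, wordSum, Finset.mul_sum]
      refine Finset.sum_congr rfl fun z _ => ?_
      have hlen : (List.ofFn z).length = m := by simp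
      generalize List.ofFn z = w at hlen
      simp only [List.tail_cons]
      split_ifs with hw
      · rw [← mul_assoc, ← hLe w hw hlen, Finset.sum_mul]
        exact Finset.sum_congr rfl fun b _ => by split_ifs <;> simp
      · rw [mul_zero]
        refine Finset.sum_eq_zero fun b _ => if_neg fun hb => hw ?_
        exact h.mem_of_infix hb (List.suffix_cons _ _).isInfix
    exact mul_right_cancel₀ hspos.ne' (h1.symm.trans h2)
  have hcpos : 0 < c := by
    obtain ⟨x, hx, hlen⟩ := h.exists_mem_length (m + 1)
    obtain ⟨w, b, rfl⟩ : ∃ w b, x = w ++ [b] := by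
      have hne : x ≠ [] := by rintro rfl; simp at hlen
      exact ⟨_, _, (List.dropLast_append_getLast hne).symm⟩
    have hwl : w.length = m := by simpa using hlen
    have hw : w ∈ S := h.mem_of_infix hx (List.prefix_append _ _).isInfix
    have hnn : ∀ b ∈ Finset.univ, 0 ≤ if w ++ [b] ∈ S then R (w ++ [b]).tail else 0 := by
      intro b _
      split_ifs with hb
      · exact (hRpos _ (h.mem_of_infix hb (List.tail_suffix _).isInfix) (by simp [hwl])).le
      · exact le_rfl
    have h1 := Finset.single_le_sum hnn (Finset.mem_univ b)
    rw [hRe w hw hwl, if_pos hx] at h1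
    have h2 := hRpos _ (h.mem_of_infix hx (List.tail_suffix _).isInfix) (by simp [hwl])
    exact pos_of_mul_pos_left (h2.trans_le h1) (hRpos w hw hwl).le
  have hR0 : ∀ w, 0 ≤ R w := fun w => by
    simp only [R]
    split_ifs
    · exact (hr _).le
    · exact le_rfl
  have hL0 : ∀ w, 0 ≤ L w := fun w => by
    simp only [L]
    split_ifs
    · exact (hl _).le
    · exact le_rfl
  refine ⟨c, fun w => s⁻¹ * L w, R, hcpos, fun w =>
    ⟨mul_nonneg (inv_pos.2 hspos).le (hL0 w), hR0 w⟩, fun w hw hlen =>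
    ⟨mul_pos (inv_pos.2 hspos) (hLpos w hw hlen), hRpos w hw hlen⟩, hRe, fun w hw hlen => ?_, ?_⟩
  · rw [mul_left_comm, hcc, ← hLe w hw hlen, Finset.mul_sum]
    exact Finset.sum_congr rfl fun a _ => by split_ifs <;> simp
  · rw [← inv_mul_cancel₀ hspos.ne', hs, wordSum, wordSum, Finset.mul_sum]
    exact Finset.sum_congr rfl fun z _ => by split_ifs <;> simp [mul_assoc]

end IsMarkovShift

/-! ### The Parry measure -/

/-- Word probabilities `P` of the maxentropic chain, with Perron eigenvalue `c` and right
eigenfunction `ρ`. -/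
structure IsParry (S : Set (List (Fin K))) (m : ℕ) (c : ℝ) (ρ P : List (Fin K) → ℝ) : Prop where
  consistent : IsConsistent m P
  pos_iff : ∀ w, m ≤ w.length → (0 < P w ↔ w ∈ S)
  pos : 0 < c
  rho_pos : ∀ w ∈ S, m ≤ w.length → 0 < ρ w
  rho_drop : ∀ w, m ≤ w.length → ρ (w.drop (w.length - m)) = ρ w
  step : ∀ w b, m ≤ w.length → w ++ [b] ∈ S → P (w ++ [b]) * (c * ρ w) = P w * ρ (w ++ [b]).tail

-- Parry's formula: an allowed word gets `l(first m letters) r(last m letters) / c ^ (length - m)`.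
-- The right eigenvector equation gives consistency when a letter is appended, the left one when a
-- letter is prepended.
open scoped Classical in
lemma IsMarkovShift.exists_isParry {S : Set (List (Fin K))} {m : ℕ} (h : IsMarkovShift S m) :
    ∃ c ρ P, IsParry S m c ρ P := by
  obtain ⟨c, l, r, hc, hnn, hpos, hr, hl, hone⟩ := h.exists_eigenfunctions
  let ρ : List (Fin K) → ℝ := fun w => r (w.drop (w.length - m))
  let P : List (Fin K) → ℝ := fun w =>
    if w ∈ S then l (w.take m) * r (w.drop (w.length - m)) / c ^ (w.length - m) else 0
  have hdropS : ∀ w ∈ S, w.drop (w.length - m) ∈ S := fun w hw =>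
    h.mem_of_infix hw (List.drop_suffix _ _).isInfix
  have htakeS : ∀ w ∈ S, w.take m ∈ S := fun w hw =>
    h.mem_of_infix hw (List.take_prefix _ _).isInfix
  have hdl : ∀ w : List (Fin K), m ≤ w.length → (w.drop (w.length - m)).length = m := by
    intro w hw; simp; omega
  have htl : ∀ w : List (Fin K), m ≤ w.length → (w.take m).length = m := by
    intro w hw; simp; omega
  have hPpos : ∀ w ∈ S, m ≤ w.length → 0 < P w := by
    intro w hw hm
    simp only [P, if_pos hw]
    exact div_pos (mul_pos (hpos _ (htakeS w hw) (htl w hm)).1 (hpos _ (hdropS w hw) (hdl w hm)).2)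
      (pow_pos hc _)
  have hdropc : ∀ (w : List (Fin K)) (b : Fin K), m ≤ w.length →
      (w ++ [b]).drop ((w ++ [b]).length - m) = (w.drop (w.length - m) ++ [b]).tail := by
    intro w b hm
    have e : (w ++ [b]).length - m = w.length - m + 1 := by simp; omega
    rw [e, ← List.tail_drop, List.drop_append_of_le_length (by omega)]
  have hPc : ∀ (w : List (Fin K)) (b : Fin K), m ≤ w.length → w ++ [b] ∈ S →
      P (w ++ [b]) = l (w.take m) * r (w.drop (w.length - m) ++ [b]).tail /
        c ^ (w.length - m + 1) := by
    intro w b hm hb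
    have e : (w ++ [b]).length - m = w.length - m + 1 := by simp; omega
    simp only [P, if_pos hb]
    rw [hdropc w b hm, e, List.take_append_of_le_length hm]
  have hmemc : ∀ (w : List (Fin K)) (b : Fin K), m ≤ w.length → w ∈ S →
      (w ++ [b] ∈ S ↔ w.drop (w.length - m) ++ [b] ∈ S) := by
    intro w b hm hw
    refine ⟨fun hb => ?_, fun hb => h.concat_mem hw hm hb⟩
    refine h.mem_of_infix hb (List.IsSuffix.isInfix ?_)
    have := List.drop_suffix (w.length - m) (w ++ [b])
    rwa [List.drop_append_of_le_length (by omega)] at this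
  have hmeml : ∀ (w : List (Fin K)) (a : Fin K), m ≤ w.length → w ∈ S →
      (a :: w ∈ S ↔ a :: w.take m ∈ S) := by
    intro w a hm hw
    refine ⟨fun ha => ?_, fun ha => h.cons_mem hw hm ha⟩
    exact h.mem_of_infix ha (List.take_prefix (m + 1) (a :: w)).isInfix
  have hPl : ∀ (w : List (Fin K)) (a : Fin K), m ≤ w.length → a :: w ∈ S →
      P (a :: w) = l (a :: w.take m).dropLast * r (w.drop (w.length - m)) /
        c ^ (w.length - m + 1) := by
    intro w a hm ha
    have e : (a :: w).length - m = w.length - m + 1 := by simp; omega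
    simp only [P, if_pos ha]
    rw [e, List.drop_succ_cons]
    congr 3
    rw [List.dropLast_eq_take, List.length_cons, htl w hm, Nat.add_sub_cancel,
      ← List.take_succ_cons, List.take_take]
    simp
  refine ⟨c, ρ, P, ⟨fun w => ?_, fun w hm => ?_, fun w hm => ?_, ?_⟩, fun w hm => ?_, hc, ?_, ?_, ?_⟩
  · by_cases hw : w ∈ S
    · simp only [P, if_pos hw]
      exact div_nonneg (mul_nonneg (hnn _).1 (hnn _).2) (pow_pos hc _).le
    · simp [P, hw]
  · by_cases hw : w ∈ S
    · have e : ∀ b, P (w ++ [b]) = l (w.take m) / c ^ (w.length - m + 1) *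
          if w.drop (w.length - m) ++ [b] ∈ S then r (w.drop (w.length - m) ++ [b]).tail else 0 := by
        intro b
        by_cases hb : w ++ [b] ∈ S
        · rw [hPc w b hm hb, if_pos ((hmemc w b hm hw).1 hb)]; ring
        · rw [if_neg (mt (hmemc w b hm hw).2 hb)]; simp [P, hb]
      rw [Finset.sum_congr rfl fun b _ => e b, ← Finset.mul_sum,
        hr _ (hdropS w hw) (hdl w hm)]
      simp only [P, if_pos hw]
      rw [pow_succ]
      field_simp
    · have e : ∀ b, P (w ++ [b]) = 0 := fun b =>
        if_neg fun hb => hw (h.mem_of_infix hb (List.prefix_append _ _).isInfix)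
      simp [e, P, hw]
  · by_cases hw : w ∈ S
    · have e : ∀ a, P (a :: w) = r (w.drop (w.length - m)) / c ^ (w.length - m + 1) *
          if a :: w.take m ∈ S then l (a :: w.take m).dropLast else 0 := by
        intro a
        by_cases ha : a :: w ∈ S
        · rw [hPl w a hm ha, if_pos ((hmeml w a hm hw).1 ha)]; ring
        · rw [if_neg (mt (hmeml w a hm hw).2 ha)]; simp [P, ha]
      rw [Finset.sum_congr rfl fun b _ => e b, ← Finset.mul_sum,
        hl _ (htakeS w hw) (htl w hm)]
      simp only [P, if_pos hw]
      rw [pow_succ]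
      field_simp
    · have e : ∀ a, P (a :: w) = 0 := fun a =>
        if_neg fun ha => hw (h.mem_of_infix ha (List.suffix_cons _ _).isInfix)
      simp [e, P, hw]
  · rw [← hone]
    refine wordSum_congr fun w hw => ?_
    simp only [P, hw, Nat.sub_self, List.drop_zero, pow_zero, div_one]
    rw [List.take_of_length_le hw.le]
  · refine ⟨fun hw => ?_, fun hw => hPpos w hw hm⟩
    by_contra hn
    simp [P, hn] at hw
  · intro w hw hm
    exact (hpos _ (hdropS w hw) (hdl w hm)).2
  · intro w hm
    simp only [ρ, hdl w hm, Nat.sub_self, List.drop_zero]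
  · intro w b hm hb
    have hw : w ∈ S := h.mem_of_infix hb (List.prefix_append _ _).isInfix
    have e : ρ (w ++ [b]).tail = r (w.drop (w.length - m) ++ [b]).tail := by
      simp only [ρ]
      congr 1
      rw [← hdropc w b hm, ← List.drop_one, List.drop_drop]
      congr 1
      simp; omega
    rw [hPc w b hm hb, e]
    simp only [P, ρ, if_pos hw]
    rw [pow_succ]
    field_simp

/-! ### From word probabilities to the Parry chain -/

lemma agreeOn_Ico_eq_wordEvent (t : ℤ) (k : ℕ) (z : ℤ → Fin K) :
    agreeOn (Set.Ico (t - k) t) z = wordEvent (t - k) (wordAt z (t - k) k) := by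
  ext x
  rw [mem_wordEvent, length_wordAt, wordAt, wordAt, List.ofFn_inj, funext_iff]
  constructor
  · intro h j
    have := j.2
    exact h _ (by simp; omega)
  · intro h i hi
    rw [Set.mem_Ico] at hi
    have := h ⟨(i - (t - k)).toNat, by omega⟩
    have e : t - (k : ℤ) + (((i - (t - k)).toNat : ℕ) : ℤ) = i := by omega
    simpa only [e] using this

lemma agreeOn_Ico_inter_eq_wordEvent (t : ℤ) (k : ℕ) (z : ℤ → Fin K) :
    agreeOn (Set.Ico (t - k) t) z ∩ agreeOn {t} z =
      wordEvent (t - k) (wordAt z (t - k) k ++ [z t]) := by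
  ext x
  rw [mem_wordEvent_concat, ← agreeOn_Ico_eq_wordEvent, length_wordAt, sub_add_cancel]
  simp [agreeOn]

lemma wordAt_drop (z : ℤ → Fin K) (i : ℤ) (d l : ℕ) :
    (wordAt z i (d + l)).drop d = wordAt z (i + d) l := by
  refine List.ext_getElem (by simp [length_wordAt]) fun k h1 h2 => ?_
  simp [wordAt, add_assoc]

/-- The stationary Markov chain with the Parry word probabilities. -/
lemma IsParry.exists_law {S : Set (List (Fin K))} {m : ℕ} {c : ℝ} {ρ P : List (Fin K) → ℝ}
    (hP : IsParry S m c ρ P) (hS : IsMarkovShift S m) :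
    ∃ μ : Measure (ℤ → Fin K), IsStationaryLaw μ ∧ IsMarkovOfOrder m μ ∧ allowedWords μ = S ∧
      ∀ w, m ≤ w.length → wordProb μ w = P w := by
  have := hS.neZero
  obtain ⟨μ, hμ, hw⟩ := hP.consistent.exists_measure
  have hst : IsStationaryLaw μ := by
    refine ⟨hμ, measurable_shift, ?_⟩
    have := Measure.isProbabilityMeasure_map (μ := μ) measurable_shift.aemeasurable
    refine measure_ext_of_wordEvent m fun i w hm => ?_
    rw [Measure.map_apply measurable_shift (measurableSet_wordEvent i w)]
    have e : shift ⁻¹' wordEvent i w = wordEvent (i + 1) w := by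
      ext x; exact shift_mem_wordEvent
    rw [e, ← ofReal_measureReal, ← ofReal_measureReal, hw _ _ hm, hw _ _ hm]
  have hwp : ∀ w, m ≤ w.length → wordProb μ w = P w := fun w hm => hw 0 w hm
  refine ⟨μ, hst, ?_, ?_, hwp⟩
  · intro t k z hmk hne
    have hmeas : ∀ k : ℕ, MeasurableSet (agreeOn (Set.Ico (t - k) t) z) := fun k => by
      rw [agreeOn_Ico_eq_wordEvent]; exact measurableSet_wordEvent _ _
    rw [cond_apply (hmeas k), cond_apply (hmeas m), agreeOn_Ico_inter_eq_wordEvent,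
      agreeOn_Ico_inter_eq_wordEvent]
    rw [agreeOn_Ico_eq_wordEvent] at hne ⊢
    rw [agreeOn_Ico_eq_wordEvent]
    obtain ⟨d, rfl⟩ := Nat.exists_eq_add_of_le' hmk
    set w := wordAt z (t - (d + m : ℕ)) (d + m) with hwdef
    have hwl : w.length = d + m := length_wordAt _ _ _
    have hs : wordAt z (t - m) m = w.drop (w.length - m) := by
      rw [hwl, Nat.add_sub_cancel, hwdef, wordAt_drop]
      congr 1
      push_cast; ring
    rw [hs]
    set s := w.drop (w.length - m) with hsdef
    have hsl : s.length = m := by rw [hsdef, List.length_drop]; omega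
    have hPw : 0 < P w := by
      rw [← hw (t - (d + m : ℕ)) w (by omega)]
      exact ENNReal.toReal_pos hne (measure_ne_top _ _)
    have hwS : w ∈ S := (hP.pos_iff w (by omega)).1 hPw
    have hsS : s ∈ S := hS.mem_of_infix hwS (List.drop_suffix _ _).isInfix
    have hPs : 0 < P s := (hP.pos_iff s hsl.ge).2 hsS
    -- For an allowed step the transition probability is `ρ(tail) / (c ρ(w))`, which sees only the
    -- last `m` letters. Whether the step is allowed is also decided by these letters.
    have key : (P w)⁻¹ * P (w ++ [z t]) = (P s)⁻¹ * P (s ++ [z t]) := by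
      have hsuf : s ++ [z t] <:+ w ++ [z t] := by
        have := List.drop_suffix (w.length - m) (w ++ [z t])
        rwa [List.drop_append_of_le_length (by omega)] at this
      by_cases hb : w ++ [z t] ∈ S
      · have hb' : s ++ [z t] ∈ S := hS.mem_of_infix hb hsuf.isInfix
        have h1 := hP.step w (z t) (by omega) hb
        have h2 := hP.step s (z t) hsl.ge hb'
        have h3 : ρ s = ρ w := hP.rho_drop w (by omega)
        have h4 : ρ (s ++ [z t]).tail = ρ (w ++ [z t]).tail := by
          rw [← hP.rho_drop (w ++ [z t]).tail (by simp; omega)]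
          congr 1
          rw [List.length_tail, List.length_append, List.length_singleton, ← List.drop_one,
            ← List.drop_one, List.drop_drop, hsdef, ← List.drop_append_of_le_length (by omega),
            List.drop_drop]
          congr 1
          omega
        have hρ := hP.rho_pos w hwS (by omega)
        have hc := hP.pos
        rw [h3, h4] at h2
        field_simp
        have hne : c * ρ w ≠ 0 := by positivity
        refine mul_right_cancel₀ hne ?_
        linear_combination P s * h1 - P w * h2
      · have hb' : s ++ [z t] ∉ S := fun hb' => hb (hS.concat_mem hwS (by omega) hb')
        have e1 : P (w ++ [z t]) = 0 := le_antisymm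
          (not_lt.1 fun h => hb ((hP.pos_iff _ (by simp; omega)).1 h)) (hP.consistent.nonneg _)
        have e2 : P (s ++ [z t]) = 0 := le_antisymm
          (not_lt.1 fun h => hb' ((hP.pos_iff _ (by simp; omega)).1 h)) (hP.consistent.nonneg _)
        rw [e1, e2, mul_zero, mul_zero]
    have e : ∀ i v, m ≤ v.length → μ (wordEvent i v) = ENNReal.ofReal (P v) := fun i v hv => by
      rw [← hw i v hv, ofReal_measureReal]
    rw [e _ _ (by omega), e _ _ (by simp; omega), e _ _ (by omega), e _ _ (by simp; omega),
      ← ENNReal.ofReal_inv_of_pos hPw, ← ENNReal.ofReal_inv_of_pos hPs,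
      ← ENNReal.ofReal_mul (by positivity), ← ENNReal.ofReal_mul (by positivity), key]
  -- `P` describes only words of length at least `m`, so a shorter word is compared through right
  -- extensions: of positive probability in one direction, inside `S` in the other.
  · ext w
    rw [hst.mem_allowedWords]
    have hpre : ∀ u, wordProb μ (w ++ u) ≤ wordProb μ w := by
      intro u
      induction u using List.reverseRecOn with
      | nil => simp
      | append_singleton u b ih =>
        refine le_trans ?_ ih
        rw [← List.append_assoc, ← hst.sum_wordProb_concat (w ++ u)]
        exact Finset.single_le_sum (f := fun b => wordProb μ (w ++ u ++ [b]))
          (fun b _ => wordProb_nonneg _ _) (Finset.mem_univ b)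
    constructor
    · intro hpos
      have hext : ∀ n, ∃ u, 0 < wordProb μ (w ++ u) ∧ n ≤ (w ++ u).length := by
        intro n
        induction n with
        | zero => exact ⟨[], by simpa using hpos, by simp⟩
        | succ n ih =>
          obtain ⟨u, hu, hn⟩ := ih
          rw [← hst.sum_wordProb_concat] at hu
          obtain ⟨b, -, hb⟩ := Finset.exists_lt_of_sum_lt
            (f := fun _ => (0 : ℝ)) (by simpa using hu)
          refine ⟨u ++ [b], by simpa using hb, ?_⟩
          simp only [List.length_append, List.length_singleton] at hn ⊢
          omega
      obtain ⟨u, hu, hn⟩ := hext m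
      rw [hwp _ hn, hP.pos_iff _ hn] at hu
      exact hS.mem_of_infix hu (List.prefix_append _ _).isInfix
    · intro hw
      obtain ⟨u, hu, hn⟩ := hS.exists_append_mem hw m
      rw [← hP.pos_iff _ hn, ← hwp _ hn] at hu
      exact hu.trans_le (hpre u)

/-! ### Quadratic entropy gap -/

/-- A quadratic lower bound for the terms of a relative entropy. -/
lemma sub_add_sq_le_mul_log_sub {p q : ℝ} (hp : 0 ≤ p) (hp1 : p ≤ 1) (hq : 0 ≤ q) (hq1 : q ≤ 1)
    (h : q = 0 → p = 0) : p - q + (p - q) ^ 2 / 4 ≤ p * (Real.log p - Real.log q) := by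
  rcases hp.eq_or_lt with rfl | hp'
  · nlinarith
  have hq' : 0 < q := hq.lt_of_ne' fun h0 => hp'.ne' (h h0)
  -- With `a = √p` and `b = √q`, the bound `log (b/a) ≤ b/a - 1` gives `p log (p/q) ≥ 2p - 2ab = p -
  -- q + (a - b)²`. Finally `(p - q)² = (a - b)² (a + b)² ≤ 4 (a - b)²`.
  have hs : 0 < Real.sqrt q / Real.sqrt p := div_pos (Real.sqrt_pos.2 hq') (Real.sqrt_pos.2 hp')
  have h1 := Real.log_le_sub_one_of_pos hs
  rw [Real.log_div (Real.sqrt_pos.2 hq').ne' (Real.sqrt_pos.2 hp').ne', Real.log_sqrt hq,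
    Real.log_sqrt hp] at h1
  set a := Real.sqrt p with ha
  set b := Real.sqrt q with hb
  have hap : a * a = p := Real.mul_self_sqrt hp
  have hbq : b * b = q := Real.mul_self_sqrt hq
  have ha0 : 0 < a := Real.sqrt_pos.2 hp'
  have hb0 : 0 < b := Real.sqrt_pos.2 hq'
  have ha1 : a ≤ 1 := Real.sqrt_le_one.2 hp1
  have hb1 : b ≤ 1 := Real.sqrt_le_one.2 hq1
  have h2 : p * (b / a - 1) = a * b - p := by rw [← hap]; field_simp
  have h3 := mul_le_mul_of_nonneg_left h1 hp
  rw [h2] at h3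
  have h4 : (p - q) ^ 2 / 4 ≤ (a - b) ^ 2 := by
    have : (p - q) ^ 2 = (a - b) ^ 2 * (a + b) ^ 2 := by rw [← hap, ← hbq]; ring
    rw [this]
    have : (a + b) ^ 2 ≤ 4 := by nlinarith
    nlinarith [sq_nonneg (a - b)]
  nlinarith

namespace IsParry

variable {S : Set (List (Fin K))} {m : ℕ} {c : ℝ} {ρ P : List (Fin K) → ℝ}

lemma eq_zero_of_notMem (hP : IsParry S m c ρ P) {w : List (Fin K)} (hm : m ≤ w.length)
    (hw : w ∉ S) : P w = 0 :=
  le_antisymm (not_lt.1 fun h => hw ((hP.pos_iff w hm).1 h)) (hP.consistent.nonneg w)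

lemma le_one (hP : IsParry S m c ρ P) {w : List (Fin K)} (hm : m ≤ w.length) : P w ≤ 1 := by
  rw [← hP.consistent.wordSum_of_le hm]
  exact le_wordSum (fun v _ => hP.consistent.nonneg v) rfl

/-- The defect of the entropy increment as a conditional relative entropy. -/
lemma log_sub_increment (hP : IsParry S m c ρ P) (hS : IsMarkovShift S m)
    {ν : Measure (ℤ → Fin K)} (hν : IsStationaryLaw ν) (hsub : allowedWords ν ⊆ S) {N : ℕ}
    (hN : m ≤ N) :
    Real.log c - increment (blockEntropy ν) (Finset.Ico (-(N : ℤ)) 0) =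
      wordSum N fun w => ∑ b, (wordProb ν (w ++ [b]) * (Real.log (wordProb ν (w ++ [b])) -
        Real.log (wordProb ν w) - (Real.log (P (w ++ [b])) - Real.log (P w)))) := by
  set Q := wordProb ν with hQ
  have hQ0 : ∀ w, w ∉ S → Q w = 0 := fun w hw => hν.wordProb_eq_zero_of_notMem fun h => hw (hsub h)
  -- The logarithm of a Parry transition probability is `log ρ(tail) - log ρ(w) - log c`. The two
  -- `ρ` terms have the same mean by stationarity of `ν`.
  have hlog : wordSum N (fun w => ∑ b, Q (w ++ [b]) * (Real.log (P (w ++ [b])) - Real.log (P w))) =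
      -Real.log c := by
    have e1 : ∀ w : List (Fin K), w.length = N → ∀ b,
        Q (w ++ [b]) * (Real.log (P (w ++ [b])) - Real.log (P w)) =
          Q (w ++ [b]) * Real.log (ρ (w ++ [b]).tail) - Q (w ++ [b]) * Real.log c -
            Q (w ++ [b]) * Real.log (ρ w) := by
      intro w hw b
      by_cases hb : w ++ [b] ∈ S
      · have hwS : w ∈ S := hS.mem_of_infix hb (List.prefix_append _ _).isInfix
        have h1 := hP.step w b (by omega) hb
        have p1 := (hP.pos_iff (w ++ [b]) (by simp; omega)).2 hb
        have p2 := (hP.pos_iff w (by omega)).2 hwS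
        have p3 := hP.rho_pos w hwS (by omega)
        have p4 := hP.rho_pos (w ++ [b]).tail
          (hS.mem_of_infix hb (List.tail_suffix _).isInfix) (by simp; omega)
        have p5 := hP.pos
        have h2 := congrArg Real.log h1
        rw [Real.log_mul p1.ne' (by positivity), Real.log_mul p5.ne' p3.ne',
          Real.log_mul p2.ne' p4.ne'] at h2
        have : Real.log (P (w ++ [b])) - Real.log (P w) =
          Real.log (ρ (w ++ [b]).tail) - Real.log c - Real.log (ρ w) := by linarith
        rw [this]; ring
      · rw [hQ0 _ hb]; ring
    have e2 : wordSum N (fun w => ∑ b, Q (w ++ [b]) * Real.log (ρ (w ++ [b]).tail)) =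
        wordSum N (fun w => Q w * Real.log (ρ w)) := by
      rw [← wordSum_succ_last N (fun x => Q x * Real.log (ρ x.tail)), wordSum_succ']
      refine wordSum_congr fun w _ => ?_
      simp only [List.tail_cons]
      rw [← Finset.sum_mul, hν.sum_wordProb_cons]
    have e3 : wordSum N (fun w => ∑ b, Q (w ++ [b]) * Real.log c) = Real.log c := by
      have : wordSum N (fun w => ∑ b, Q (w ++ [b]) * Real.log c) = wordSum N Q * Real.log c := by
        rw [wordSum, wordSum, Finset.sum_mul]
        refine Finset.sum_congr rfl fun z _ => ?_
        rw [← Finset.sum_mul, hν.sum_wordProb_concat]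
      rw [this, hν.wordSum_wordProb, one_mul]
    have e4 : wordSum N (fun w => ∑ b, Q (w ++ [b]) * Real.log (ρ w)) =
        wordSum N (fun w => Q w * Real.log (ρ w)) := by
      refine wordSum_congr fun w _ => ?_
      rw [← Finset.sum_mul, hν.sum_wordProb_concat]
    rw [wordSum_congr fun w hw => Finset.sum_congr rfl fun b _ => e1 w hw b]
    simp only [Finset.sum_sub_distrib]
    simp only [wordSum, Finset.sum_sub_distrib] at e2 e3 e4 ⊢
    rw [e2, e3, e4]; ring
  have hinc : increment (blockEntropy ν) (Finset.Ico (-(N : ℤ)) 0) =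
      -wordSum N (fun w => ∑ b, Q (w ++ [b]) * (Real.log (Q (w ++ [b])) - Real.log (Q w))) := by
    rw [hν.increment_Ico, wordSum_succ_last]
    simp only [wordSum, ← Finset.sum_neg_distrib, ← Finset.sum_sub_distrib]
    refine Finset.sum_congr rfl fun z _ => ?_
    generalize List.ofFn z = w
    have : Real.negMulLog (wordProb ν w) = ∑ b, -(Q (w ++ [b]) * Real.log (Q w)) := by
      rw [Finset.sum_neg_distrib, ← Finset.sum_mul, hν.sum_wordProb_concat, Real.negMulLog, neg_mul]
    rw [this, ← Finset.sum_sub_distrib]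
    refine Finset.sum_congr rfl fun b _ => ?_
    rw [Real.negMulLog]; ring
  rw [hinc, ← neg_neg (Real.log c), ← hlog]
  simp only [wordSum, ← Finset.sum_neg_distrib, ← Finset.sum_sub_distrib]
  refine Finset.sum_congr rfl fun z _ => Finset.sum_congr rfl fun b _ => ?_
  ring

/-- The deviation of the transition probabilities of `ν` from those of the Parry measure. -/
noncomputable def defect (P : List (Fin K) → ℝ) (ν : Measure (ℤ → Fin K)) (w : List (Fin K))
    (b : Fin K) : ℝ :=
  wordProb ν (w ++ [b]) - wordProb ν w * P (w ++ [b]) / P w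

/-- Apply the quadratic bound with `p = ν(wb)` and `q = ν(w) P(wb) / P(w)`. The linear terms `p - q`
sum to zero over `b`. -/
lemma sum_defect_sq_le (hP : IsParry S m c ρ P) (hS : IsMarkovShift S m)
    {ν : Measure (ℤ → Fin K)} (hν : IsStationaryLaw ν) (hsub : allowedWords ν ⊆ S) {N : ℕ}
    (hN : m ≤ N) :
    wordSum N (fun w => ∑ b, defect P ν w b ^ 2) ≤
      4 * (Real.log c - increment (blockEntropy ν) (Finset.Ico (-(N : ℤ)) 0)) := by
  rw [hP.log_sub_increment hS hν hsub hN]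
  have hQ0 : ∀ w, w ∉ S → wordProb ν w = 0 := fun w hw =>
    hν.wordProb_eq_zero_of_notMem fun h => hw (hsub h)
  have hQ1 : ∀ w, wordProb ν w ≤ 1 := fun w => by
    rw [← hν.wordSum_wordProb w.length]
    exact le_wordSum (fun v _ => wordProb_nonneg ν v) rfl
  rw [wordSum, wordSum, Finset.mul_sum]
  refine Finset.sum_le_sum fun z _ => ?_
  have hlen : (List.ofFn z).length = N := by simp
  generalize List.ofFn z = w at hlen
  by_cases hw : w ∈ S
  swap
  · have h0 : ∀ b, wordProb ν (w ++ [b]) = 0 := fun b =>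
      hQ0 _ fun hb => hw (hS.mem_of_infix hb (List.prefix_append _ _).isInfix)
    simp [defect, h0, hQ0 w hw]
  have hPw := (hP.pos_iff w (by omega)).2 hw
  have key : ∀ b, (wordProb ν (w ++ [b]) - wordProb ν w * P (w ++ [b]) / P w) +
      defect P ν w b ^ 2 / 4 ≤ wordProb ν (w ++ [b]) * (Real.log (wordProb ν (w ++ [b])) -
        Real.log (wordProb ν w) - (Real.log (P (w ++ [b])) - Real.log (P w))) := by
    intro b
    have hPb : P (w ++ [b]) ≤ P w := by
      rw [← hP.consistent.sum_concat w (by omega)]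
      exact Finset.single_le_sum (f := fun b => P (w ++ [b]))
        (fun b _ => hP.consistent.nonneg _) (Finset.mem_univ b)
    have hQb : wordProb ν (w ++ [b]) ≤ wordProb ν w := by
      rw [← hν.sum_wordProb_concat w]
      exact Finset.single_le_sum (f := fun b => wordProb ν (w ++ [b]))
        (fun b _ => wordProb_nonneg _ _) (Finset.mem_univ b)
    have hPb0 := hP.consistent.nonneg (w ++ [b])
    have hQw0 := wordProb_nonneg ν w
    rcases (wordProb_nonneg ν (w ++ [b])).eq_or_lt with hz | hpos
    · rw [defect, ← hz]
      have h0 : 0 ≤ wordProb ν w * P (w ++ [b]) / P w := by positivity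
      have h1 : wordProb ν w * P (w ++ [b]) / P w ≤ 1 := by
        rw [div_le_one hPw]
        have := hQ1 w
        nlinarith
      nlinarith
    · have hwb : w ++ [b] ∈ S := by
        by_contra h; exact hpos.ne' (hQ0 _ h)
      have hPb' := (hP.pos_iff _ (by simp; omega)).2 hwb
      have hQw := hpos.trans_le hQb
      have h1 : wordProb ν w * P (w ++ [b]) / P w ≤ 1 := by
        rw [div_le_one hPw]
        have := hQ1 w
        nlinarith
      have hq : 0 < wordProb ν w * P (w ++ [b]) / P w := by positivity
      have := sub_add_sq_le_mul_log_sub hpos.le (hQ1 _) hq.le h1 (fun h => absurd h hq.ne')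
      rw [Real.log_div (by positivity) hPw.ne', Real.log_mul hQw.ne' hPb'.ne'] at this
      refine this.trans_eq ?_
      ring
  have hsum := Finset.sum_le_sum fun b (_ : b ∈ Finset.univ) => key b
  have hzero : ∑ b, (wordProb ν (w ++ [b]) - wordProb ν w * P (w ++ [b]) / P w) = 0 := by
    rw [Finset.sum_sub_distrib, hν.sum_wordProb_concat, ← Finset.sum_div, ← Finset.mul_sum,
      hP.consistent.sum_concat w (by omega)]
    field_simp
    simp
  rw [Finset.sum_add_distrib, hzero, zero_add, ← Finset.sum_div] at hsum
  linarith

/-- Functions that are invariant under the time-reversed chain are constant. -/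
lemma eq_of_invariant (hP : IsParry S m c ρ P) (hS : IsMarkovShift S m) {N : ℕ} (hN : m ≤ N)
    {F : List (Fin K) → ℝ}
    (hF : ∀ v ∈ S, v.length = N → P v * F v = ∑ a, P (a :: v) * F (a :: v).dropLast) :
    ∃ M, ∀ v ∈ S, v.length = N → F v = M := by
  have hfin : {v | v ∈ S ∧ v.length = N}.Finite :=
    (List.finite_length_eq (Fin K) N).subset fun w hw => hw.2
  have hne : {v | v ∈ S ∧ v.length = N}.Nonempty := by
    obtain ⟨w, hw, hl⟩ := hS.exists_mem_length N
    exact ⟨w, hw, hl⟩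
  -- Minimum principle: `F` at a minimiser is a weighted mean of its values at the predecessors, so
  -- every allowed predecessor is a minimiser too. Irreducibility supplies a path from any `u` to
  -- `v₀`, followed backwards.
  obtain ⟨v₀, ⟨hv₀, hl₀⟩, hmin⟩ := Set.exists_min_image _ F hfin hne
  refine ⟨F v₀, fun u hu hl => ?_⟩
  have hpath := hS.reflTransGen_step hu hv₀ (hl.trans hl₀.symm)
  induction hpath using Relation.ReflTransGen.head_induction_on with
  | refl => rfl
  | @head u v huv _ ih =>
    obtain ⟨b, hb, rfl⟩ := huv
    set v := (u ++ [b]).tail with hv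
    have hvS : v ∈ S := hS.mem_of_infix hb (List.tail_suffix _).isInfix
    have hvl : v.length = N := by simp [hv, hl]
    have hFv := ih hvS hvl
    obtain ⟨a, ha⟩ : ∃ a, a :: v = u ++ [b] := by
      have : u ++ [b] ≠ [] := by simp
      exact ⟨(u ++ [b]).head this, List.cons_head_tail this⟩
    have h1 : ∑ a, P (a :: v) * (F (a :: v).dropLast - F v₀) = 0 := by
      simp only [mul_sub, Finset.sum_sub_distrib]
      rw [← hF v hvS hvl, ← Finset.sum_mul, hP.consistent.sum_cons v (by omega), hFv, sub_self]
    have h2 : ∀ a ∈ Finset.univ, 0 ≤ P (a :: v) * (F (a :: v).dropLast - F v₀) := by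
      intro a _
      by_cases haS : a :: v ∈ S
      · refine mul_nonneg (hP.consistent.nonneg _) (sub_nonneg.2 (hmin _ ⟨?_, ?_⟩))
        · exact hS.mem_of_infix haS (List.dropLast_prefix _).isInfix
        · simp [hvl]
      · rw [hP.eq_zero_of_notMem (by simp; omega) haS, zero_mul]
    have h3 := (Finset.sum_eq_zero_iff_of_nonneg h2).1 h1 a (Finset.mem_univ a)
    rw [ha, List.dropLast_concat] at h3
    have := (hP.pos_iff (u ++ [b]) (by simp; omega)).2 hb
    rcases mul_eq_zero.1 h3 with h | h
    · exact absurd h this.ne'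
    · linarith

open scoped Classical in
/-- Stability of the invariant density: almost invariant functions are almost constant. -/
lemma exists_stability (hP : IsParry S m c ρ P) (hS : IsMarkovShift S m) {N : ℕ} (hN : m ≤ N) :
    ∃ C : ℝ, 0 ≤ C ∧ ∀ (F : List (Fin K) → ℝ) (η : ℝ), 0 ≤ η →
      (∀ v ∈ S, v.length = N → |P v * F v - ∑ a, P (a :: v) * F (a :: v).dropLast| ≤ η) →
      wordSum N (fun w => P w * F w) = 0 → ∀ v ∈ S, v.length = N → |F v| ≤ C * η := by
  have := hS.neZero
  let toFn : List (Fin K) → Fin N → Fin K := fun w k => w.getD k 0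
  have hto : ∀ z : Fin N → Fin K, toFn (List.ofFn z) = z := by
    intro z; ext k; simp [toFn]
  have hof : ∀ w : List (Fin K), w.length = N → List.ofFn (toFn w) = w := by
    intro w hw
    obtain ⟨z, rfl⟩ := exists_ofFn_eq hw
    rw [hto]
  -- Records the failure of invariance and the mean; outside `S` it is the identity, so that the
  -- values there cannot produce a kernel. Invariant functions are constant on `S` and mean zero
  -- kills the constant, so `Λ` is injective, hence bounded below in finite dimension.
  let Λ : ((Fin N → Fin K) → ℝ) →ₗ[ℝ] ((Fin N → Fin K) → ℝ) × ℝ :=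
    { toFun := fun f => (fun z => if List.ofFn z ∈ S then P (List.ofFn z) * f z -
          ∑ a, P (a :: List.ofFn z) * f (toFn (a :: List.ofFn z).dropLast) else f z,
        ∑ z, P (List.ofFn z) * f z)
      map_add' := by
        intro f g
        ext z
        · simp only [Pi.add_apply, Prod.fst_add, mul_add, Finset.sum_add_distrib]
          split_ifs <;> ring
        · simp only [Pi.add_apply, Prod.snd_add, mul_add, Finset.sum_add_distrib]
      map_smul' := by
        intro t f
        ext z
        · simp only [Pi.smul_apply, Prod.smul_fst, smul_eq_mul, RingHom.id_apply,
            mul_left_comm _ t, ← Finset.mul_sum]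
          split_ifs <;> ring
        · simp only [Pi.smul_apply, Prod.smul_snd, smul_eq_mul, RingHom.id_apply,
            mul_left_comm _ t, ← Finset.mul_sum] }
  have hker : LinearMap.ker Λ = ⊥ := by
    rw [LinearMap.ker_eq_bot']
    intro f hf
    have h1 : ∀ z, (if List.ofFn z ∈ S then P (List.ofFn z) * f z -
          ∑ a, P (a :: List.ofFn z) * f (toFn (a :: List.ofFn z).dropLast) else f z) = 0 :=
      fun z => congrFun (congrArg Prod.fst hf) z
    have h2 : ∑ z, P (List.ofFn z) * f z = 0 := congrArg Prod.snd hf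
    obtain ⟨M, hM⟩ := hP.eq_of_invariant hS hN (F := fun w => f (toFn w)) (by
      intro v hv hl
      have := h1 (toFn v)
      rw [hof v hl, if_pos hv] at this
      linarith)
    have hM' : ∀ z : Fin N → Fin K, List.ofFn z ∈ S → f z = M := by
      intro z hz
      have := hM _ hz (by simp)
      rwa [hto] at this
    have hM0 : M = 0 := by
      rw [← h2, ← one_mul M, ← hP.consistent.wordSum_of_le hN, wordSum, Finset.sum_mul]
      refine Finset.sum_congr rfl fun z _ => ?_
      by_cases hz : List.ofFn z ∈ S
      · rw [hM' z hz]
      · rw [hP.eq_zero_of_notMem (by simpa using hN) hz, zero_mul, zero_mul]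
    ext z
    by_cases hz : List.ofFn z ∈ S
    · rw [hM' z hz, hM0]; rfl
    · have := h1 z
      rwa [if_neg hz] at this
  obtain ⟨C, -, hC⟩ := Λ.exists_antilipschitzWith hker
  refine ⟨C, C.2, fun F η hη hF hsum v hv hl => ?_⟩
  let f : (Fin N → Fin K) → ℝ := fun z => if List.ofFn z ∈ S then F (List.ofFn z) else 0
  have hfv : ∀ v, v.length = N → v ∈ S → f (toFn v) = F v := by
    intro v hl hv
    simp only [f, hof v hl, if_pos hv]
  have hb := hC.le_mul_dist f 0
  rw [map_zero, dist_zero_right, dist_zero_right] at hb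
  have hnorm : ‖Λ f‖ ≤ η := by
    rw [Prod.norm_def, max_le_iff]
    constructor
    · rw [pi_norm_le_iff_of_nonneg hη]
      intro z
      change ‖if List.ofFn z ∈ S then P (List.ofFn z) * f z -
          ∑ a, P (a :: List.ofFn z) * f (toFn (a :: List.ofFn z).dropLast) else f z‖ ≤ η
      by_cases hz : List.ofFn z ∈ S
      · rw [if_pos hz, Real.norm_eq_abs]
        convert hF _ hz (by simp) using 3
        · simp only [f, if_pos hz]
        · refine Finset.sum_congr rfl fun a _ => ?_
          by_cases ha : a :: List.ofFn z ∈ S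
          · rw [hfv _ (by simp) (hS.mem_of_infix ha (List.dropLast_prefix _).isInfix)]
          · rw [hP.eq_zero_of_notMem (by simp; omega) ha, zero_mul, zero_mul]
      · rw [if_neg hz]
        simp only [f, if_neg hz, norm_zero]
        exact hη
    · change ‖∑ z, P (List.ofFn z) * f z‖ ≤ η
      have : ∑ z, P (List.ofFn z) * f z = 0 := by
        rw [← hsum, wordSum]
        refine Finset.sum_congr rfl fun z _ => ?_
        by_cases hz : List.ofFn z ∈ S
        · simp only [f, if_pos hz]
        · rw [hP.eq_zero_of_notMem (by simpa using hN) hz, zero_mul, zero_mul]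
      rw [this, norm_zero]
      exact hη
  have h1 : |F v| ≤ ‖f‖ := by
    rw [← hfv v hl hv, ← Real.norm_eq_abs]
    exact norm_le_pi_norm f _
  calc |F v| ≤ ‖f‖ := h1
    _ ≤ C * ‖Λ f‖ := hb
    _ ≤ C * η := mul_le_mul_of_nonneg_left hnorm C.2

/-- The entropy increment is bounded away from its maximum by the squared distance to the Parry
measure. -/
lemma exists_increment_le (hP : IsParry S m c ρ P) (hS : IsMarkovShift S m) {N : ℕ} (hN : m ≤ N) :
    ∃ κ : ℝ, 0 < κ ∧ ∀ ν : Measure (ℤ → Fin K), IsStationaryLaw ν → allowedWords ν ⊆ S →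
      increment (blockEntropy ν) (Finset.Ico (-(N : ℤ)) 0) ≤
        Real.log c - κ * wordSum (N + 1) (fun w => |wordProb ν w - P w|) ^ 2 := by
  obtain ⟨C, hC, hstab⟩ := hP.exists_stability hS hN
  set B : ℝ := Fintype.card (Fin (N + 1) → Fin K) * (1 + C * K) with hB
  have hB0 : 0 ≤ B := by positivity
  -- `B` is the number of words times the bound per word, so that `δ ≤ B η` with `η² = E ≤ 4 · gap`.
  -- The `+ 1` keeps the denominator positive without inspecting `B`.
  refine ⟨1 / (4 * (B ^ 2 + 1)), by positivity, fun ν hν hsub => ?_⟩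
  set E := wordSum N (fun w => ∑ b, defect P ν w b ^ 2) with hE
  have hgap := hP.sum_defect_sq_le hS hν hsub hN
  have hQ0 : ∀ w, w ∉ S → wordProb ν w = 0 := fun w hw =>
    hν.wordProb_eq_zero_of_notMem fun h => hw (hsub h)
  set η := Real.sqrt E with hη
  have hη0 : 0 ≤ η := Real.sqrt_nonneg _
  have hE0 : 0 ≤ E := Finset.sum_nonneg fun z _ => Finset.sum_nonneg fun b _ => sq_nonneg _
  have hd : ∀ w b, w.length = N → |defect P ν w b| ≤ η := by
    intro w b hw
    rw [← Real.sqrt_sq_eq_abs]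
    refine Real.sqrt_le_sqrt ?_
    calc defect P ν w b ^ 2 ≤ ∑ b, defect P ν w b ^ 2 :=
          Finset.single_le_sum (f := fun b => defect P ν w b ^ 2) (fun b _ => sq_nonneg _)
            (Finset.mem_univ b)
      _ ≤ E := le_wordSum (f := fun w => ∑ b, defect P ν w b ^ 2)
        (fun w _ => Finset.sum_nonneg fun b _ => sq_nonneg _) hw
  -- For the density `ν / P` minus `1`, the failure of invariance at `v` is the sum of the defects
  -- at the `K` words `a v`, each at most `η`; its mean is zero because both laws have mass one.
  have hdens : ∀ w ∈ S, w.length = N → |wordProb ν w / P w - 1| ≤ C * (K * η) := by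
    refine hstab (fun w => wordProb ν w / P w - 1) (K * η) (by positivity) ?_ ?_
    · intro v hv hl
      have hPv := (hP.pos_iff v (by omega)).2 hv
      have e : P v * (wordProb ν v / P v - 1) -
          ∑ a, P (a :: v) * (wordProb ν (a :: v).dropLast / P (a :: v).dropLast - 1) =
          ∑ a, (wordProb ν (a :: v) -
            wordProb ν (a :: v).dropLast * P (a :: v) / P (a :: v).dropLast) := by
        rw [Finset.sum_sub_distrib, hν.sum_wordProb_cons, mul_sub, mul_div_cancel₀ _ hPv.ne']
        simp only [mul_sub, mul_one, Finset.sum_sub_distrib]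
        rw [hP.consistent.sum_cons v (by omega)]
        have : ∑ a, P (a :: v) * (wordProb ν (a :: v).dropLast / P (a :: v).dropLast) =
            ∑ a, wordProb ν (a :: v).dropLast * P (a :: v) / P (a :: v).dropLast :=
          Finset.sum_congr rfl fun a _ => by ring
        rw [this]; ring
      rw [e]
      refine (Finset.abs_sum_le_sum_abs _ _).trans ?_
      refine (Finset.sum_le_card_nsmul _ _ η fun a _ => ?_).trans_eq (by simp)
      have hne : a :: v ≠ [] := by simp
      have := hd (a :: v).dropLast ((a :: v).getLast hne) (by simp [hl])
      rwa [defect, List.dropLast_append_getLast hne] at this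
    · have : wordSum N (fun w => P w * (wordProb ν w / P w - 1)) =
          wordSum N (wordProb ν) - wordSum N P := by
        simp only [wordSum, ← Finset.sum_sub_distrib]
        refine Finset.sum_congr rfl fun z _ => ?_
        have hlen : (List.ofFn z).length = N := by simp
        generalize List.ofFn z = w at hlen
        by_cases hw : w ∈ S
        · have hPw := (hP.pos_iff w (by omega)).2 hw
          field_simp
        · rw [hP.eq_zero_of_notMem (by omega) hw, hQ0 w hw]; simp
      rw [this, hν.wordSum_wordProb, hP.consistent.wordSum_of_le hN, sub_self]
  have hdist : ∀ x : List (Fin K), x.length = N + 1 →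
      |wordProb ν x - P x| ≤ (1 + C * K) * η := by
    intro x hx
    obtain ⟨w, b, rfl⟩ : ∃ w b, x = w ++ [b] := by
      have hne : x ≠ [] := by rintro rfl; simp at hx
      exact ⟨_, _, (List.dropLast_append_getLast hne).symm⟩
    have hwl : w.length = N := by simpa using hx
    by_cases hw : w ∈ S
    · have hPw := (hP.pos_iff w (by omega)).2 hw
      have e : wordProb ν (w ++ [b]) - P (w ++ [b]) =
          defect P ν w b + P (w ++ [b]) * (wordProb ν w / P w - 1) := by
        rw [defect]; field_simp; ring
      rw [e]
      refine (abs_add_le _ _).trans ?_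
      rw [abs_mul, abs_of_nonneg (hP.consistent.nonneg _)]
      have h1 := hd w b hwl
      have h2 : P (w ++ [b]) * |wordProb ν w / P w - 1| ≤ 1 * (C * (K * η)) :=
        mul_le_mul (hP.le_one (by simp; omega)) (hdens w hw hwl) (abs_nonneg _) zero_le_one
      linarith
    · have hb : w ++ [b] ∉ S := fun hb => hw (hS.mem_of_infix hb (List.prefix_append _ _).isInfix)
      rw [hP.eq_zero_of_notMem (by simp; omega) hb, hQ0 _ hb, sub_self, abs_zero]
      positivity
  have hδ : wordSum (N + 1) (fun w => |wordProb ν w - P w|) ≤ B * η := by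
    refine (Finset.sum_le_card_nsmul _ _ ((1 + C * K) * η) fun z _ => hdist _ (by simp)).trans_eq ?_
    rw [nsmul_eq_mul, hB, Finset.card_univ]; ring
  have hδ0 : 0 ≤ wordSum (N + 1) (fun w => |wordProb ν w - P w|) :=
    Finset.sum_nonneg fun z _ => abs_nonneg _
  set δ := wordSum (N + 1) (fun w => |wordProb ν w - P w|)
  have hδ2 : δ ^ 2 ≤ B ^ 2 * E := by
    have := pow_le_pow_left₀ hδ0 hδ 2
    rwa [mul_pow, hη, Real.sq_sqrt hE0] at this
  have h3 : 1 / (4 * (B ^ 2 + 1)) * δ ^ 2 ≤ E / 4 := by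
    rw [one_div, inv_mul_le_iff₀ (by positivity)]
    nlinarith
  linarith

end IsParry

/-! ### Lipschitz dependence of entropies on the word probabilities -/

/-- `negMulLog` has infinite slope at `0`, but chords from a fixed `q > 0` to points of `[0, 1]`
have bounded slope, even those ending at `0`. -/
lemma exists_abs_negMulLog_sub_le {q : ℝ} (hq : 0 < q) (hq1 : q ≤ 1) :
    ∃ L : ℝ, 0 ≤ L ∧ ∀ p, 0 ≤ p → p ≤ 1 →
      |Real.negMulLog p - Real.negMulLog q| ≤ L * |p - q| := by
  have hinv : 1 ≤ 1 / q := by rw [le_div_iff₀ hq]; linarith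
  refine ⟨|Real.log q| + 1 / q, by positivity, fun p hp hp1 => ?_⟩
  have h0 : Real.negMulLog p - Real.negMulLog q =
      -((p - q) * Real.log q) - p * (Real.log p - Real.log q) := by
    simp only [Real.negMulLog]; ring
  have h1 : |p * (Real.log p - Real.log q)| ≤ 1 / q * |p - q| := by
    rcases hp.eq_or_lt with rfl | hp'
    · rw [zero_mul, abs_zero]; positivity
    have u := Real.log_le_sub_one_of_pos (div_pos hp' hq)
    have l := Real.one_sub_inv_le_log_of_pos (div_pos hp' hq)
    rw [Real.log_div hp'.ne' hq.ne'] at u l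
    have u' : p * (Real.log p - Real.log q) ≤ p / q * (p - q) := by
      have := mul_le_mul_of_nonneg_left u hp
      have e : p * (p / q - 1) = p / q * (p - q) := by field_simp
      linarith
    have l' : p - q ≤ p * (Real.log p - Real.log q) := by
      have := mul_le_mul_of_nonneg_left l hp
      have e : p * (1 - (p / q)⁻¹) = p - q := by field_simp
      linarith
    have hpq : p / q ≤ 1 / q := div_le_div_of_nonneg_right hp1 hq.le
    have hpq0 : 0 ≤ p / q := by positivity
    rw [abs_le]
    constructor
    · have := neg_abs_le (p - q)
      have := mul_le_mul_of_nonneg_right hinv (abs_nonneg (p - q))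
      linarith
    · have := mul_le_mul_of_nonneg_left (le_abs_self (p - q)) hpq0
      have := mul_le_mul_of_nonneg_right hpq (abs_nonneg (p - q))
      linarith
  rw [h0]
  refine (abs_sub _ _).trans ?_
  rw [abs_neg, abs_mul]
  linarith

open scoped Classical in
lemma IsStationaryLaw.measureReal_restrict_eq_sum {ν : Measure (ℤ → Fin K)}
    (hν : IsStationaryLaw ν) {N : ℕ} {D : Finset ℤ} (hD : D ⊆ Finset.Icc (-(N : ℤ)) 0)
    (z : D → Fin K) :
    ν.real ((fun x (d : D) => x (d : ℤ)) ⁻¹' {z}) = ∑ y : Fin (N + 1) → Fin K,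
      if ∀ d : D, z d = y ⟨((d : ℤ) + N).toNat, by have := Finset.mem_Icc.1 (hD d.2); omega⟩ then
        wordProb ν (List.ofFn y) else 0 := by
  have := hν.isProbabilityMeasure
  rw [measureReal_eq_sum_inter (measurableSet_restrict_fiber _ z) (window (-(N : ℤ)) (N + 1))
    (fun y => measurable_window _ _ (measurableSet_singleton y))]
  refine Finset.sum_congr rfl fun y _ => ?_
  have hval : ∀ (x : ℤ → Fin K) (d : D), window (-(N : ℤ)) (N + 1) x = y →
      x (d : ℤ) = y ⟨((d : ℤ) + N).toNat, by have := Finset.mem_Icc.1 (hD d.2); omega⟩ := by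
    rintro x d rfl
    have := Finset.mem_Icc.1 (hD d.2)
    simp only [window]
    congr 1
    omega
  split_ifs with h
  · rw [← hν.measureReal_wordEvent (-(N : ℤ)), ← window_preimage_singleton]
    congr 1
    refine Set.inter_eq_right.2 fun x hx => ?_
    ext1 d
    exact (hval x d hx).trans (h d).symm
  · have : (fun x (d : D) => x (d : ℤ)) ⁻¹' {z} ∩ window (-(N : ℤ)) (N + 1) ⁻¹' {y} = ∅ := by
      rw [Set.eq_empty_iff_forall_notMem]
      rintro x ⟨hx, hy⟩
      refine h fun d => ?_
      rw [← hval x d hy]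
      exact (congrFun hx d).symm
    rw [this, measureReal_empty]

/-- Block entropies are Lipschitz at a law with full support. -/
lemma exists_abs_blockEntropy_sub_le {S : Set (List (Fin K))} {μ : Measure (ℤ → Fin K)}
    (hμ : IsStationaryLaw μ) (hμS : allowedWords μ = S) {N : ℕ} {D : Finset ℤ}
    (hD : D ⊆ Finset.Icc (-(N : ℤ)) 0) :
    ∃ L : ℝ, 0 ≤ L ∧ ∀ ν : Measure (ℤ → Fin K), IsStationaryLaw ν → allowedWords ν ⊆ S →
      |blockEntropy ν D - blockEntropy μ D| ≤
        L * wordSum (N + 1) (fun w => |wordProb ν w - wordProb μ w|) := by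
  classical
  have := hμ.isProbabilityMeasure
  have key : ∀ z : D → Fin K, ∃ L : ℝ, 0 ≤ L ∧ ∀ ν : Measure (ℤ → Fin K), IsStationaryLaw ν →
      allowedWords ν ⊆ S →
      |Real.negMulLog (ν.real ((fun x (d : D) => x (d : ℤ)) ⁻¹' {z})) -
        Real.negMulLog (μ.real ((fun x (d : D) => x (d : ℤ)) ⁻¹' {z}))| ≤
        L * wordSum (N + 1) (fun w => |wordProb ν w - wordProb μ w|) := by
    intro z
    -- An event null under `μ` consists of words outside `S`, hence is null under `ν` as well. The
    -- singularity of `negMulLog` at `0` therefore never matters.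
    rcases (measureReal_nonneg (μ := μ)
      (s := (fun x (d : D) => x (d : ℤ)) ⁻¹' {z})).eq_or_lt with h0 | hpos
    · refine ⟨0, le_rfl, fun ν hν hsub => ?_⟩
      have hz : ν.real ((fun x (d : D) => x (d : ℤ)) ⁻¹' {z}) = 0 := by
        rw [hμ.measureReal_restrict_eq_sum hD, eq_comm, Finset.sum_eq_zero_iff_of_nonneg] at h0
        · rw [hν.measureReal_restrict_eq_sum hD]
          refine Finset.sum_eq_zero fun y hy => ?_
          have h1 := h0 y hy
          split_ifs with h
          · rw [if_pos h] at h1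
            refine hν.wordProb_eq_zero_of_notMem fun hmem => ?_
            have := hsub hmem
            rw [← hμS, hμ.mem_allowedWords, h1] at this
            exact lt_irrefl _ this
          · rfl
        · intro y _
          split_ifs
          · exact wordProb_nonneg _ _
          · exact le_rfl
      rw [hz, ← h0, sub_self, abs_zero, zero_mul]
    · obtain ⟨L, hL, hLip⟩ := exists_abs_negMulLog_sub_le hpos measureReal_le_one
      refine ⟨L, hL, fun ν hν hsub => ?_⟩
      have := hν.isProbabilityMeasure
      refine (hLip _ measureReal_nonneg measureReal_le_one).trans
        (mul_le_mul_of_nonneg_left ?_ hL)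
      rw [hμ.measureReal_restrict_eq_sum hD, hν.measureReal_restrict_eq_sum hD,
        ← Finset.sum_sub_distrib]
      refine (Finset.abs_sum_le_sum_abs _ _).trans (Finset.sum_le_sum fun y _ => ?_)
      split_ifs
      · exact le_rfl
      · simp
  choose L hL hLip using key
  refine ⟨∑ z, L z, Finset.sum_nonneg fun z _ => hL z, fun ν hν hsub => ?_⟩
  rw [blockEntropy, blockEntropy, entropy, entropy, ← Finset.sum_sub_distrib, Finset.sum_mul]
  exact (Finset.abs_sum_le_sum_abs _ _).trans (Finset.sum_le_sum fun z _ => hLip z ν hν hsub)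

lemma exists_abs_erasureSlope_sub_le {S : Set (List (Fin K))} {μ : Measure (ℤ → Fin K)}
    (hμ : IsStationaryLaw μ) (hμS : allowedWords μ = S) (N : ℕ) :
    ∃ L : ℝ, 0 ≤ L ∧ ∀ ν : Measure (ℤ → Fin K), IsStationaryLaw ν → allowedWords ν ⊆ S →
      |erasureSlope (blockEntropy ν) N - erasureSlope (blockEntropy μ) N| ≤
        L * wordSum (N + 1) (fun w => |wordProb ν w - wordProb μ w|) := by
  set W := Finset.Ico (-(N : ℤ)) 0 with hW
  have hinc : ∀ D : Finset ℤ, ∃ L : ℝ, 0 ≤ L ∧ (D ⊆ W → ∀ ν : Measure (ℤ → Fin K),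
      IsStationaryLaw ν → allowedWords ν ⊆ S →
      |increment (blockEntropy ν) D - increment (blockEntropy μ) D| ≤
        L * wordSum (N + 1) (fun w => |wordProb ν w - wordProb μ w|)) := by
    intro D
    by_cases hD : D ⊆ W
    · have h1 : D ⊆ Finset.Icc (-(N : ℤ)) 0 := hD.trans Finset.Ico_subset_Icc_self
      have h2 : insert 0 D ⊆ Finset.Icc (-(N : ℤ)) 0 := Finset.insert_subset (by simp) h1
      obtain ⟨L₁, hL₁, hLip₁⟩ := exists_abs_blockEntropy_sub_le hμ hμS h1
      obtain ⟨L₂, hL₂, hLip₂⟩ := exists_abs_blockEntropy_sub_le hμ hμS h2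
      refine ⟨L₁ + L₂, by positivity, fun _ ν hν hsub => ?_⟩
      have e : increment (blockEntropy ν) D - increment (blockEntropy μ) D =
          (blockEntropy ν (insert 0 D) - blockEntropy μ (insert 0 D)) -
            (blockEntropy ν D - blockEntropy μ D) := by simp only [increment]; ring
      rw [e]
      refine (abs_sub _ _).trans ?_
      have := hLip₁ ν hν hsub
      have := hLip₂ ν hν hsub
      linarith
    · exact ⟨0, le_rfl, fun h => absurd h hD⟩
  choose L hL hLip using hinc
  refine ⟨∑ i ∈ W, L (W.erase i) + (N + 1) * L W, ?_, fun ν hν hsub => ?_⟩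
  · have := Finset.sum_nonneg fun i (_ : i ∈ W) => hL (W.erase i)
    have := hL W
    positivity
  · have e : erasureSlope (blockEntropy ν) N - erasureSlope (blockEntropy μ) N =
        ∑ i ∈ W, (increment (blockEntropy ν) (W.erase i) - increment (blockEntropy μ) (W.erase i)) -
          (N + 1) * (increment (blockEntropy ν) W - increment (blockEntropy μ) W) := by
      simp only [erasureSlope, Finset.sum_sub_distrib, ← hW]; ring
    rw [e, add_mul (∑ i ∈ W, L (W.erase i))]
    refine (abs_sub _ _).trans (add_le_add ?_ ?_)
    · rw [Finset.sum_mul]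
      exact (Finset.abs_sum_le_sum_abs _ _).trans
        (Finset.sum_le_sum fun i _ => hLip _ (Finset.erase_subset _ _) ν hν hsub)
    · rw [abs_mul, abs_of_nonneg (by positivity : (0 : ℝ) ≤ N + 1), mul_assoc]
      exact mul_le_mul_of_nonneg_left (hLip _ subset_rfl ν hν hsub) (by positivity)

/-- Both conditional laws reduce to the one of order `m`. This makes the maxentropic chain a
competitor for every order `n ≥ m`. -/
lemma IsMarkovOfOrder.mono {μ : Measure (ℤ → Fin K)} {m n : ℕ} (h : IsMarkovOfOrder m μ)
    (hmn : m ≤ n) : IsMarkovOfOrder n μ := by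
  intro t k z hnk hne
  rw [h t k z (hmn.trans hnk) hne, h t n z hmn]
  intro h0
  have hsub : agreeOn (Set.Ico (t - k) t) z ⊆ agreeOn (Set.Ico (t - n) t) z := by
    intro x hx i hi
    refine hx i ?_
    simp only [Set.mem_Ico] at hi ⊢
    omega
  exact hne (measure_mono_null hsub h0)

/-! ### Asymptotics of the capacity -/

section Capacity

variable {S : Set (List (Fin K))} {m : ℕ} {c : ℝ} {ρ P : List (Fin K) → ℝ}
  {μ : Measure (ℤ → Fin K)}

/-- The conditional relative entropy of the chain with respect to itself vanishes. -/
lemma IsParry.increment_eq_log (hP : IsParry S m c ρ P) (hS : IsMarkovShift S m)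
    (hμ : IsStationaryLaw μ) (hμS : allowedWords μ = S)
    (hμP : ∀ w, m ≤ w.length → wordProb μ w = P w) (k : ℕ) (hk : m ≤ k) :
    increment (blockEntropy μ) (Finset.Ico (-(k : ℤ)) 0) = Real.log c := by
  have := hP.log_sub_increment hS hμ hμS.subset hk
  have h0 : (wordSum k fun w => ∑ b, (wordProb μ (w ++ [b]) * (Real.log (wordProb μ (w ++ [b])) -
        Real.log (wordProb μ w) - (Real.log (P (w ++ [b])) - Real.log (P w))))) = 0 := by
    refine Finset.sum_eq_zero fun z _ => Finset.sum_eq_zero fun b _ => ?_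
    rw [hμP _ (by simp; omega), hμP _ (by simp; omega), sub_self, mul_zero]
  linarith

lemma IsStationaryLaw.mutualInfoRate_zero_le {ν : Measure (ℤ → Fin K)} (hν : IsStationaryLaw ν)
    (N : ℕ) : mutualInfoRate ν 0 ≤ increment (blockEntropy ν) (Finset.Ico (-(N : ℤ)) 0) := by
  obtain ⟨l, hl, hle, -⟩ := hν.exists_mutualInfoRate_eq 0
  rw [hl]
  have := hle N
  simp only [Set.Icc.coe_zero, erasureAvg_zero] at this
  simpa using this

lemma IsParry.mutualInfoRate_zero (hP : IsParry S m c ρ P) (hS : IsMarkovShift S m)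
    (hμ : IsStationaryLaw μ) (hμS : allowedWords μ = S)
    (hμP : ∀ w, m ≤ w.length → wordProb μ w = P w) : mutualInfoRate μ 0 = Real.log c := by
  obtain ⟨l, hl, hle, hge⟩ := hμ.exists_mutualInfoRate_eq 0
  simp only [Set.Icc.coe_zero, erasureAvg_zero] at hl hle hge
  rw [hl, sub_zero, one_mul]
  refine le_antisymm ?_ (hge _ m fun n hn => ?_)
  · rw [← hP.increment_eq_log hS hμ hμS hμP m le_rfl]; exact hle m
  · rw [hP.increment_eq_log hS hμ hμS hμP n hn]

lemma IsParry.mutualInfoRate_zero_le (hP : IsParry S m c ρ P) (hS : IsMarkovShift S m)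
    {ν : Measure (ℤ → Fin K)} (hν : IsStationaryLaw ν) (hsub : allowedWords ν ⊆ S) :
    mutualInfoRate ν 0 ≤ Real.log c := by
  obtain ⟨κ, hκ, h⟩ := hP.exists_increment_le hS (le_refl m)
  have h1 := h ν hν hsub
  have h2 := hν.mutualInfoRate_zero_le m
  have : 0 ≤ κ * wordSum (m + 1) (fun w => |wordProb ν w - P w|) ^ 2 := by positivity
  linarith

lemma IsParry.isMaxentropic (hP : IsParry S m c ρ P) (hS : IsMarkovShift S m)
    (hμ : IsStationaryLaw μ) (hμm : IsMarkovOfOrder m μ) (hμS : allowedWords μ = S)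
    (hμP : ∀ w, m ≤ w.length → wordProb μ w = P w) : IsMaxentropic S m μ := by
  refine ⟨hμ, hμm, hμS, fun ν hν hsub => ?_⟩
  rw [hν.entropyRate_eq, hμ.entropyRate_eq, hP.mutualInfoRate_zero hS hμ hμS hμP]
  exact hP.mutualInfoRate_zero_le hS hν hsub

/-- An optimal rate leaves no room for the term `κ δ²`. For every `N ≥ m` this forces the Parry
probabilities on words of length `N + 1`, and these determine the law. -/
lemma IsParry.eq_of_isMaxentropic (hP : IsParry S m c ρ P) (hS : IsMarkovShift S m)
    (hμ : IsStationaryLaw μ) (hμS : allowedWords μ = S)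
    (hμP : ∀ w, m ≤ w.length → wordProb μ w = P w) {ν : Measure (ℤ → Fin K)}
    (hν : IsMaxentropic S m ν) : ν = μ := by
  have h1 := hμ.isProbabilityMeasure
  have h2 := hν.stationary.isProbabilityMeasure
  have hrate := hν.entropyRate_le μ hμ hμS.subset
  rw [hν.stationary.entropyRate_eq, hμ.entropyRate_eq, hP.mutualInfoRate_zero hS hμ hμS hμP] at hrate
  refine measure_ext_of_wordEvent (m + 1) fun i w hw => ?_
  obtain ⟨N, hN⟩ : ∃ N, w.length = N + 1 := ⟨w.length - 1, by omega⟩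
  obtain ⟨κ, hκ, h⟩ := hP.exists_increment_le hS (N := N) (by omega)
  have h3 := h ν hν.stationary hν.allowedWords_eq.subset
  have h4 := hν.stationary.mutualInfoRate_zero_le N
  have h5 : wordSum (N + 1) (fun w => |wordProb ν w - P w|) = 0 := by
    have : κ * wordSum (N + 1) (fun w => |wordProb ν w - P w|) ^ 2 ≤ 0 := by linarith
    exact pow_eq_zero_iff two_ne_zero |>.1
      (le_antisymm (nonpos_of_mul_nonpos_right this hκ) (sq_nonneg _))
  have h6 := le_wordSum (f := fun w => |wordProb ν w - P w|) (n := N + 1)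
    (fun _ _ => abs_nonneg _) hN
  rw [h5] at h6
  have h7 : wordProb ν w = P w := sub_eq_zero.1 (abs_nonpos_iff.1 h6)
  rw [← ofReal_measureReal, ← ofReal_measureReal, hν.stationary.measureReal_wordEvent,
    hμ.measureReal_wordEvent, h7, hμP w (by omega)]

lemma IsParry.erasureSlope_eq (hP : IsParry S m c ρ P) (hS : IsMarkovShift S m)
    (hμ : IsStationaryLaw μ) (hμS : allowedWords μ = S)
    (hμP : ∀ w, m ≤ w.length → wordProb μ w = P w) :
    erasureSlope (blockEntropy μ) (2 * m) = -linearCoeff m μ := by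
  have := hμ.isProbabilityMeasure
  rw [hμ.isStationaryEntropy.erasureSlope_of_markov (hP.increment_eq_log hS hμ hμS hμP), linearCoeff]
  simp only [condEntropyZero_eq_sub]
  rfl

/-- First-order upper bound for the information rate, uniform over the input process. -/
lemma IsParry.exists_mutualInfoRate_le (hP : IsParry S m c ρ P) (hS : IsMarkovShift S m)
    (hμ : IsStationaryLaw μ) (hμS : allowedWords μ = S)
    (hμP : ∀ w, m ≤ w.length → wordProb μ w = P w) :
    ∃ C : ℝ, ∀ ν : Measure (ℤ → Fin K), IsStationaryLaw ν → allowedWords ν ⊆ S → ∀ ε : I,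
      mutualInfoRate ν ε ≤ Real.log c - linearCoeff m μ * ε + C * (ε : ℝ) ^ 2 := by
  obtain ⟨C, hC, hexp⟩ := IsStationaryEntropy.exists_abs_erasureAvg_expansion_le (2 * m) (K : ℝ) (by positivity)
  obtain ⟨κ, hκ, hgap⟩ := hP.exists_increment_le hS (N := 2 * m) (by omega)
  obtain ⟨L, hL, hlip⟩ := exists_abs_erasureSlope_sub_le hμ hμS (2 * m)
  refine ⟨C + L ^ 2 / (4 * κ), fun ν hν hsub ε => ?_⟩
  have h0 : (0 : ℝ) ≤ ε := ε.2.1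
  have h1 : (ε : ℝ) ≤ 1 := ε.2.2
  obtain ⟨l, hl, hle, -⟩ := hν.exists_mutualInfoRate_eq ε
  have a1 := mul_le_mul_of_nonneg_left (hle (2 * m)) (by linarith : 0 ≤ 1 - (ε : ℝ))
  have a2 := (abs_le.1 (hexp ε h0 h1 (increment (blockEntropy ν))
    hν.isStationaryEntropy.abs_increment_le)).2
  have a3 := hgap ν hν hsub
  have a4 := (abs_le.1 (hlip ν hν hsub)).2
  have e : wordSum (2 * m + 1) (fun w => |wordProb ν w - wordProb μ w|) =
      wordSum (2 * m + 1) (fun w => |wordProb ν w - P w|) :=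
    wordSum_congr fun w hw => by rw [hμP w (by omega)]
  rw [e, hP.erasureSlope_eq hS hμ hμS hμP] at a4
  change _ - (_ + (ε : ℝ) * erasureSlope (blockEntropy ν) (2 * m)) ≤ _ at a2
  set δ := wordSum (2 * m + 1) (fun w => |wordProb ν w - P w|)
  have a5 := mul_le_mul_of_nonneg_left a4 h0
  -- Completing the square in `δ`: the first-order gain from changing the input against its
  -- quadratic entropy cost.
  have a6 : (ε : ℝ) * (L * δ) ≤ κ * δ ^ 2 + L ^ 2 / (4 * κ) * (ε : ℝ) ^ 2 := by
    have : κ * δ ^ 2 + L ^ 2 / (4 * κ) * (ε : ℝ) ^ 2 - (ε : ℝ) * (L * δ) =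
        κ * (δ - L * ε / (2 * κ)) ^ 2 := by field_simp; ring
    have : 0 ≤ κ * (δ - L * ε / (2 * κ)) ^ 2 := by positivity
    linarith
  rw [hl]
  linarith

/-- First-order lower bound for the information rate of the maxentropic chain. -/
lemma IsParry.exists_le_mutualInfoRate (hP : IsParry S m c ρ P) (hS : IsMarkovShift S m)
    (hμ : IsStationaryLaw μ) (hμS : allowedWords μ = S)
    (hμP : ∀ w, m ≤ w.length → wordProb μ w = P w) :
    ∃ C : ℝ, ∀ ε : I, Real.log c - linearCoeff m μ * ε - C * (ε : ℝ) ^ 2 ≤ mutualInfoRate μ ε := by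
  obtain ⟨C, hC, hexp⟩ := IsStationaryEntropy.exists_abs_erasureAvg_expansion_le (2 * m) (K : ℝ) (by positivity)
  refine ⟨C, fun ε => ?_⟩
  have h0 : (0 : ℝ) ≤ ε := ε.2.1
  have h1 : (ε : ℝ) ≤ 1 := ε.2.2
  obtain ⟨l, hl, -, hge⟩ := hμ.exists_mutualInfoRate_eq ε
  have key : ∀ k : ℕ, 2 * m ≤ k → Real.log c - linearCoeff m μ * ε - C * (ε : ℝ) ^ 2 ≤
      (1 - ε) * erasureAvg ε (Finset.Ico (-(k : ℤ)) 0) (increment (blockEntropy μ)) := by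
    intro k hk
    have := hμ.isStationaryEntropy.le_erasureAvg_of_markov
      (hP.increment_eq_log hS hμ hμS hμP) h0 h1 (hexp ε h0 h1) hk
    rw [hP.erasureSlope_eq hS hμ hμS hμP] at this
    linarith
  rw [hl]
  -- At `ε = 1` one cannot divide by `1 - ε`, but the rate is then `0` and `key` already says so.
  rcases h1.eq_or_lt with h | h
  · have := key _ le_rfl
    rw [h] at this ⊢
    simpa using this
  · have hpos : 0 < 1 - (ε : ℝ) := by linarith
    rw [← div_le_iff₀' hpos]
    refine hge _ (2 * m) fun n hn => ?_
    rw [div_le_iff₀' hpos]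
    exact key n hn

end Capacity

end ErasureChannel

/-! ### Assembly of the theorem -/

open ErasureChannel
theorem mainTheorem1 {K : ℕ} (S : Set (List (Fin K))) (hS : IsFiniteType S)
    (hirr : IsIrreducibleConstraint S) (hne : ∃ w ∈ S, w ≠ []) :
    (∃! μ : Measure (ℤ → Fin K), IsMaxentropic S (topologicalOrder S) μ) ∧
    ∀ μ : Measure (ℤ → Fin K), IsMaxentropic S (topologicalOrder S) μ →
      ((fun ε : I => capacity S ε -
          (capacity S 0 - linearCoeff (topologicalOrder S) μ * (ε : ℝ)))
        =O[𝓝 (0 : I)] fun ε : I => (ε : ℝ) ^ 2) ∧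
      ∀ n : ℕ, topologicalOrder S ≤ n →
        (fun ε : I => markovCapacity n S ε -
          (capacity S 0 - linearCoeff (topologicalOrder S) μ * (ε : ℝ)))
        =O[𝓝 (0 : I)] fun ε : I => (ε : ℝ) ^ 2 := by
  have hM := isMarkovShift_topologicalOrder hS hirr hne
  obtain ⟨c, ρ, P, hP⟩ := hM.exists_isParry
  obtain ⟨μ₀, hst, hmk, hall, hword⟩ := hP.exists_law hM
  refine ⟨⟨μ₀, hP.isMaxentropic hM hst hmk hall hword, fun ν hν =>
    hP.eq_of_isMaxentropic hM hst hall hword hν⟩, fun μ hμ => ?_⟩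
  obtain rfl := hP.eq_of_isMaxentropic hM hst hall hword hμ
  obtain ⟨C₁, hup⟩ := hP.exists_mutualInfoRate_le hM hst hall hword
  obtain ⟨C₂, hlow⟩ := hP.exists_le_mutualInfoRate hM hst hall hword
  have hcap0 : capacity S 0 = Real.log c := by
    refine IsGreatest.csSup_eq ⟨⟨μ, hst, hall.subset, (hP.mutualInfoRate_zero hM hst hall hword).symm⟩, ?_⟩
    rintro r ⟨ν, hν, hsub, rfl⟩
    exact hP.mutualInfoRate_zero_le hM hν hsub
  -- One argument for all capacities: a set of rates of laws supported on `S` that contains the rate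
  -- of the maxentropic chain has its supremum between the two first-order bounds.
  have key : ∀ (T : I → Set ℝ), (∀ ε, mutualInfoRate μ ε ∈ T ε) →
      (∀ ε, ∀ r ∈ T ε, ∃ ν : Measure (ℤ → Fin K),
        IsStationaryLaw ν ∧ allowedWords ν ⊆ S ∧ r = mutualInfoRate ν ε) →
      (fun ε : I => sSup (T ε) - (capacity S 0 - linearCoeff (topologicalOrder S) μ * (ε : ℝ)))
        =O[𝓝 (0 : I)] fun ε : I => (ε : ℝ) ^ 2 := by
    intro T hmem hT
    refine Asymptotics.IsBigO.of_bound (max C₁ C₂) (Eventually.of_forall fun ε => ?_)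
    have hb : ∀ r ∈ T ε, r ≤ Real.log c - linearCoeff (topologicalOrder S) μ * ε +
        C₁ * (ε : ℝ) ^ 2 := by
      intro r hr
      obtain ⟨ν, hν, hsub, rfl⟩ := hT ε r hr
      exact hup ν hν hsub ε
    have h1 : sSup (T ε) ≤ _ := csSup_le ⟨_, hmem ε⟩ hb
    have h2 : mutualInfoRate μ ε ≤ sSup (T ε) := le_csSup ⟨_, hb⟩ (hmem ε)
    have h3 := hlow ε
    have h4 := mul_le_mul_of_nonneg_right (le_max_left C₁ C₂) (sq_nonneg (ε : ℝ))
    have h5 := mul_le_mul_of_nonneg_right (le_max_right C₁ C₂) (sq_nonneg (ε : ℝ))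
    rw [hcap0, Real.norm_eq_abs, Real.norm_eq_abs, abs_of_nonneg (sq_nonneg (ε : ℝ)), abs_le]
    constructor <;> linarith
  refine ⟨key _ (fun ε => ⟨μ, hst, hall.subset, rfl⟩) fun ε r hr => hr, fun n hn => ?_⟩
  refine key _ (fun ε => ⟨μ, hst, hmk.mono hn, hall.subset, rfl⟩) fun ε r hr => ?_
  obtain ⟨ν, hν, -, hsub, rfl⟩ := hr
  exact ⟨ν, hν, hsub, rfl⟩
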